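/- Let $\overline X$ be a compact connected Riemann surface with canonical bundle $\mathcal K_{\overline X}$, and let $D\subset\overline X$ be a finite, possibly empty, set of points, also regarded as a reduced divisor; put $X=\overline X\setminus D$. **Parabolic $\mathrm{SO}_0(2,3)$-Higgs bundles.** Such an object over $(\overline X,D)$ consists of: holomorphic vector bundles $\mathcal U,\mathcal V$ over $\overline X$ of ranks $2$ and $3$ with trivial determinants, and $\mathcal E=\mathcal U\oplus\mathcal V$; holomorphic nondegenerate symmetric bilinear forms $Q_{\mathcal U},Q_{\mathcal V}$ on them, with $Q=Q_{\mathcal U}\oplus Q_{\mathcal V}$; for each $x\in D$, reverse isotropic flags of $\mathcal U_x$ and $\mathcal V_x$ with decreasing weights in $(-1/2,1/2)$ that are symmetric about $0$, giving a reverse flag $\mathcal E_x=F_1\supsetneq F_2\supsetneq\dots\supsetneq F_k=0$ with weights $\tilde\zeta_1>\dots>\tilde\zeta_{k-1}$ ($\tilde\zeta_i$ being the weight of $F_i/F_{i+1}$); and a holomorphic section $\Phi$ of $\mathrm{End}(\mathcal E)\otimes\mathcal K_{\overline X}(D)$ that exchanges $\mathcal U$ and $\mathcal V$, is skew with respect to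 $Q$, and whose residue at each $x\in D$ preserves the flag $(F_i)$. For a holomorphic subbundle $\mathcal E'\subset\mathcal E$ put $$\operatorname{pardeg}(\mathcal E')=\deg\mathcal E'-\sum_{x\in D}\sum_{i=1}^{k-1}(\tilde\zeta_i-\tilde\zeta_{i-1})\dim(\mathcal E'_x\cap F_i),\qquad \tilde\zeta_0:=0,$$ where $k$, $F_i$ and $\tilde\zeta_i$ depend on $x$. The Higgs bundle is *semistable* if $\operatorname{pardeg}(\mathcal U'\oplus\mathcal V')\le 0$ for all holomorphic subbundles $\mathcal U'\subset\mathcal U$, $\mathcal V'\subset\mathcal V$ such that $\mathcal U'\oplus\mathcal V'$ is $Q$-isotropic and $\Phi$-invariant; it is *stable* if moreover this inequality is strict whenever $\mathcal V'\ne0$. **$\alpha_1$-cyclic.** The Higgs bundle is $\alpha_1$-cyclic if $\mathcal U=\mathcal L_{-1}\oplus\mathcal L_1$ and $\mathcal V=\mathcal L_{-2}\oplus\mathcal L_0\oplus\mathcal L_2$ for holomorphic line bundles $\mathcal L_i$ with $\mathcal L_{-i}\cong\mathcal L_i^\vee$, the form $Q$ pairs $\mathcal L_i$ only with $\mathcal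 L_{-i}$ (by the natural pairing on $\mathcal U$ and by its negative on $\mathcal V$), and $\Phi$ consists of $\tau:\mathcal L_1\to\mathcal L_2$, $\beta:\mathcal L_0\to\mathcal L_1$, $\gamma:\mathcal L_2\to\mathcal L_{-1}$ and their duals $\tau^\vee:\mathcal L_{-2}\to\mathcal L_{-1}$, $\beta^\vee:\mathcal L_{-1}\to\mathcal L_0$, $\gamma^\vee:\mathcal L_1\to\mathcal L_{-2}$ (all twisted by $\mathcal K_{\overline X}(D)$), where $\tau|_X$ is an isomorphism $\mathcal L_1|_X\to\mathcal L_2|_X\otimes\mathcal K_X$ and $\beta\not\equiv0$. **Assumption A.** For every $x\in D$ there is $\zeta\in[0,1/2)$ such that: if $\zeta=0$, the flag of $\mathcal E_x$ is trivial with weight $0$; if $\zeta\ne0$, the weights are $\zeta>0>-\zeta$ and the flag is either $\mathcal E_x\supset(\mathcal L_0\oplus\mathcal L_1\oplus\mathcal L_2)_x\supset(\mathcal L_1\oplus\mathcal L_2)_x\supset0$ or $\mathcal E_x\supset(\mathcal L_{-2}\oplus\mathcal L_{-1}\oplus\mathcal L_0)_x\supset(\mathcal L_{-2}\oplus\mathcal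 L_{-1})_x\supset0$. Moreover $\tau:\mathcal L_1\to\mathcal L_2\otimes\mathcal K_{\overline X}(D)$ is an isomorphism over all of $\overline X$. **Proposition.** Let $(\mathcal E,\Phi)$ be an $\alpha_1$-cyclic parabolic $\mathrm{SO}_0(2,3)$-Higgs bundle over $(\overline X,D)$ that satisfies assumption A. 1. $(\mathcal E,\Phi)$ is semistable if and only if either $\gamma\not\equiv0$, or $\gamma\equiv0$ and $\operatorname{pardeg}(\mathcal L_1)\le\tfrac12\deg\mathcal K_{\overline X}(D)$. 2. $(\mathcal E,\Phi)$ is stable if and only if either $\gamma\not\equiv0$, or $\gamma\equiv0$ and $\operatorname{pardeg}(\mathcal L_1)<\tfrac12\deg\mathcal K_{\overline X}(D)$. -/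

import Mathlib

open scoped Manifold ContDiff Topology ComplexConjugate
open Bundle MeasureTheory

noncomputable section

/-! Holomorphic vector bundles over a Riemann surface `X` are bundles of class `ω` over the
complex manifold `X` (modelled on `ℂ`); subbundles are families of subspaces of the fibres. -/

section Bundles

variable {X : Type*} [TopologicalSpace X] [ChartedSpace ℂ X]
variable (F : Type*) [NormedAddCommGroup F] [NormedSpace ℂ F]
variable {E : X → Type*} [∀ x, AddCommGroup (E x)] [∀ x, Module ℂ (E x)]
variable [TopologicalSpace (TotalSpace F E)] [∀ x, TopologicalSpace (E x)] [FiberBundle F E]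

/-- The section `s` is holomorphic near `x`. -/
def HolAt (s : ∀ y, E y) (x : X) : Prop :=
  ContMDiffAt 𝓘(ℂ, ℂ) (𝓘(ℂ, ℂ).prod 𝓘(ℂ, F)) ω (fun y => TotalSpace.mk' F y (s y)) x

/-- The endomorphism field `A` is holomorphic near `x`: it sends germs of holomorphic sections
at `x` to germs of holomorphic sections. -/
def HolEndAt (A : ∀ y, Module.End ℂ (E y)) (x : X) : Prop :=
  ∀ s : ∀ y, E y, HolAt F s x → HolAt F (fun y => A y (s y)) x

/-- `s 0, …, s (k - 1)` is a holomorphic frame, near `x`, of the family of subspaces `S`. -/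
def IsLocalFrame (S : ∀ y, Submodule ℂ (E y)) (x : X) {k : ℕ} (s : Fin k → ∀ y, E y) : Prop :=
  (∀ i, HolAt F (s i) x) ∧
    ∀ᶠ y in 𝓝 x, LinearIndependent ℂ (fun i => s i y) ∧
      Submodule.span ℂ (Set.range fun i => s i y) = S y

/-- `S` is a holomorphic subbundle of rank `k`. -/
def IsHolSubbundle (S : ∀ y, Submodule ℂ (E y)) (k : ℕ) : Prop :=
  ∀ x, ∃ s : Fin k → ∀ y, E y, IsLocalFrame F S x s

/-- The determinant line bundle of the rank `k` subbundle `S` is holomorphically trivial: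
there is a nowhere vanishing holomorphic family of `k`-linear alternating forms on it. -/
def HasTrivialDet (S : ∀ y, Submodule ℂ (E y)) (k : ℕ) : Prop :=
  ∃ vol : ∀ y, E y [⋀^Fin k]→ₗ[ℂ] ℂ, ∀ (x : X) (s : Fin k → ∀ y, E y), IsLocalFrame F S x s →
    ContMDiffAt 𝓘(ℂ, ℂ) 𝓘(ℂ, ℂ) ω (fun y => vol y fun i => s i y) x ∧ (vol x fun i => s i x) ≠ 0

variable (E) in
/-- A smooth (`C^∞` in the real sense) Hermitian metric on the bundle `E`. -/
structure HermitianMetric where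
  form : ∀ x, E x →ₗ⋆[ℂ] E x →ₗ[ℂ] ℂ
  symm : ∀ x v w, form x v w = conj (form x w v)
  pos : ∀ x v, v ≠ 0 → 0 < (form x v v).re
  smooth : ∀ (x : X) (s t : ∀ y, E y), HolAt F s x → HolAt F t x →
    ContMDiffAt 𝓘(ℝ, ℂ) 𝓘(ℝ, ℂ) ∞ (fun y => form y (s y) (t y)) x

/-- The determinant of the Gram matrix of `s` with respect to `h`. -/
def gramDet (h : HermitianMetric F E) {k : ℕ} (s : Fin k → ∀ y, E y) (y : X) : ℝ :=
  (Matrix.of fun i j => h.form y (s i y) (s j y)).det.re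

open Classical in
/-- A holomorphic frame of `S` near `x`, together with the number of its members. -/
def someLocalFrame (S : ∀ y, Submodule ℂ (E y)) (x : X) : Σ k : ℕ, Fin k → ∀ y, E y :=
  if H : ∃ p : Σ k : ℕ, Fin k → ∀ y, E y, IsLocalFrame F S x p.2 then H.choose
  else ⟨0, fun i => i.elim0⟩

/-- The first Chern form `(i / 2π) ∂̄∂ log det H = -(1 / 4π) Δ (log det H) dx ∧ dy` of the metric
that `h` induces on the subbundle `S`, as a density in the coordinate `chartAt ℂ c`, where `H` is
the Gram matrix of a holomorphic frame of `S`. -/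
def chernDensity (h : HermitianMetric F E) (S : ∀ y, Submodule ℂ (E y)) (c : X) (z : ℂ) : ℝ :=
  -(1 / (4 * Real.pi)) * Laplacian.laplacian
    (fun w : ℂ => Real.log (gramDet F h (someLocalFrame F S ((chartAt ℂ c).symm z)).2
      ((chartAt ℂ c).symm w))) z

variable (X) in
/-- A smooth partition of unity on `X` subordinate to the cover by coordinate domains. -/
def ChartPartition : Type _ :=
  {ρ : SmoothPartitionOfUnity X 𝓘(ℝ, ℂ) X // ρ.IsSubordinate fun c => (chartAt ℂ c).source}

/-- The integral over `X` of the first Chern form of `S`. -/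
def chernNumber (h : HermitianMetric F E) (ρ : ChartPartition X)
    (S : ∀ y, Submodule ℂ (E y)) : ℝ :=
  ∑ᶠ c : X, ∫ z in (chartAt ℂ c).target,
    ρ.1 c ((chartAt ℂ c).symm z) * chernDensity F h S c z

open Classical in
/-- The degree of the holomorphic subbundle `S`: the integral of its first Chern form. On a
compact Riemann surface it depends neither on the metric nor on the partition of unity, and
both exist. -/
def bundleDegree (S : ∀ y, Submodule ℂ (E y)) : ℝ :=
  if H : Nonempty (HermitianMetric F E × ChartPartition X) then
    chernNumber F H.some.1 H.some.2 S
  else 0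

end Bundles

section Canonical

variable (X : Type*) [TopologicalSpace X] [ChartedSpace ℂ X] [IsManifold 𝓘(ℂ, ℂ) ω X]

/-- The degree of the canonical (holomorphic cotangent) bundle of `X`. -/
def canonicalDegree : ℝ :=
  bundleDegree (X := X) (ℂ →L[ℂ] ℂ)
    (E := fun x : X => TangentSpace 𝓘(ℂ, ℂ) x →L[ℂ] Bundle.Trivial X ℂ x) (fun _ => ⊤)

variable {X} in
/-- The differential at `y` of the coordinate `chartAt ℂ c`. -/
def coordDiff (c y : X) : TangentSpace 𝓘(ℂ, ℂ) y →L[ℂ] ℂ :=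
  mfderiv 𝓘(ℂ, ℂ) 𝓘(ℂ, ℂ) (chartAt ℂ c) y

end Canonical

/-- A reverse flag `⊤ = fil 0 ⊋ fil 1 ⊋ … ⊋ fil len = ⊥` in a vector space, together with the
weight `wt i` of the graded piece `fil i / fil (i + 1)` (raw data; see `IsReverseFlag`). -/
structure WeightedFlag (V : Type*) [AddCommGroup V] [Module ℂ V] where
  len : ℕ
  fil : Fin (len + 1) → Submodule ℂ V
  wt : Fin len → ℝ

namespace WeightedFlag

variable {V : Type*} [AddCommGroup V] [Module ℂ V]

/-- A reverse flag equipped with decreasing weights. -/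
structure IsReverseFlag (f : WeightedFlag V) : Prop where
  top : f.fil 0 = ⊤
  bot : f.fil (Fin.last f.len) = ⊥
  fil_anti : StrictAnti f.fil
  wt_anti : StrictAnti f.wt

/-- The parabolic contribution `∑ᵢ (ζ̃ᵢ - ζ̃ᵢ₋₁) dim (S ∩ Fᵢ)` of a subspace `S`, where the weight
preceding the first one is `0`. -/
def contribution (f : WeightedFlag V) (S : Submodule ℂ V) : ℝ :=
  ∑ i : Fin f.len, (f.wt i - (Fin.cons 0 f.wt : Fin (f.len + 1) → ℝ) i.castSucc) *
    (Module.finrank ℂ ↥(S ⊓ f.fil i.castSucc) : ℝ)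

end WeightedFlag

section Higgs

variable {X : Type*} [TopologicalSpace X] [ChartedSpace ℂ X] [IsManifold 𝓘(ℂ, ℂ) ω X]

/-- A parabolic `SO₀(2,3)`-Higgs bundle over `(X, D)` with underlying rank `5` holomorphic vector
bundle `E = U ⊕ V`. The two orthogonal structures are recorded as one form `Q = Q_U ⊕ Q_V`, and at
`x ∈ D` the two weighted reverse isotropic flags of `U_x` and `V_x` are recorded as one weighted
reverse isotropic flag of `E_x` whose members split along `U_x ⊕ V_x`. The Higgs field is a
holomorphic section of `End E ⊗ K` away from `D` with at most simple poles along `D`. -/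
structure ParabolicHiggsBundle (D : Finset X) (E : X → Type*)
    [∀ x, AddCommGroup (E x)] [∀ x, Module ℂ (E x)]
    [TopologicalSpace (TotalSpace (Fin 5 → ℂ) E)] [∀ x, TopologicalSpace (E x)]
    [FiberBundle (Fin 5 → ℂ) E] [VectorBundle ℂ (Fin 5 → ℂ) E]
    [ContMDiffVectorBundle ω (Fin 5 → ℂ) E 𝓘(ℂ, ℂ)] where
  U : ∀ x, Submodule ℂ (E x)
  V : ∀ x, Submodule ℂ (E x)
  U_hol : IsHolSubbundle (Fin 5 → ℂ) U 2
  V_hol : IsHolSubbundle (Fin 5 → ℂ) V 3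
  isCompl : ∀ x, IsCompl (U x) (V x)
  U_det : HasTrivialDet (Fin 5 → ℂ) U 2
  V_det : HasTrivialDet (Fin 5 → ℂ) V 3
  /-- The holomorphic nondegenerate symmetric bilinear form `Q_U ⊕ Q_V`. -/
  Q : ∀ x, LinearMap.BilinForm ℂ (E x)
  Q_symm : ∀ x v w, Q x v w = Q x w v
  Q_nondeg : ∀ x, (Q x).Nondegenerate
  Q_UV : ∀ x, ∀ u ∈ U x, ∀ v ∈ V x, Q x u v = 0
  Q_hol : ∀ (x : X) (s t : ∀ y, E y), HolAt (Fin 5 → ℂ) s x → HolAt (Fin 5 → ℂ) t x →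
    ContMDiffAt 𝓘(ℂ, ℂ) 𝓘(ℂ, ℂ) ω (fun y => Q y (s y) (t y)) x
  /-- The weighted reverse isotropic flags at the marked points. -/
  flag : ∀ x : D, WeightedFlag (E x)
  flag_isReverseFlag : ∀ x, (flag x).IsReverseFlag
  flag_split : ∀ x i, (flag x).fil i = ((flag x).fil i ⊓ U x) ⊔ ((flag x).fil i ⊓ V x)
  flag_isotropic : ∀ x i, (flag x).fil i.rev = (Q x).orthogonal ((flag x).fil i)
  wt_symm : ∀ x i, (flag x).wt i.rev = -(flag x).wt i
  wt_mem : ∀ x i, (flag x).wt i ∈ Set.Ioo (-(1 / 2) : ℝ) (1 / 2)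
  /-- The Higgs field, `Φ x ξ` being its contraction with a tangent vector `ξ` at `x`. Only the
  values at points outside `D` are meaningful. -/
  Φ : ∀ x, TangentSpace 𝓘(ℂ, ℂ) x → Module.End ℂ (E x)
  /-- The residue of the Higgs field at a marked point. -/
  res : ∀ x : D, Module.End ℂ (E x)
  /-- Near `x ∉ D`, with `z` a coordinate, `Φ = A dz` for a holomorphic `A`. -/
  Φ_hol : ∀ x ∉ D, ∃ A : ∀ y, Module.End ℂ (E y), HolEndAt (Fin 5 → ℂ) A x ∧
    ∀ᶠ y in 𝓝 x, ∀ ξ, Φ y ξ = coordDiff x y ξ • A y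
  /-- Near `x ∈ D`, with `z` a coordinate vanishing at `x`, `Φ = A dz / z` for a holomorphic `A`,
  whose value at `x` is the residue. -/
  Φ_log : ∀ x : D, ∃ A : ∀ y, Module.End ℂ (E y), HolEndAt (Fin 5 → ℂ) A x ∧ A x = res x ∧
    ∀ᶠ y in 𝓝[≠] (x : X), ∀ ξ,
      Φ y ξ = (coordDiff (x : X) y ξ / (chartAt ℂ (x : X) y - chartAt ℂ (x : X) x)) • A y
  Φ_UV : ∀ x ∉ D, ∀ ξ, ∀ u ∈ U x, Φ x ξ u ∈ V x
  Φ_VU : ∀ x ∉ D, ∀ ξ, ∀ v ∈ V x, Φ x ξ v ∈ U x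
  /-- The component `U → V ⊗ K` is minus the adjoint of the component `V → U ⊗ K`. -/
  Φ_skew : ∀ x ∉ D, ∀ ξ v w, Q x (Φ x ξ v) w + Q x v (Φ x ξ w) = 0
  /-- In a frame compatible with the flag, the entry of `Φ` from weight `η` to weight `ζ` is
  holomorphic when `ζ > η`: the residue preserves the flag. -/
  res_flag : ∀ x i, ∀ v ∈ (flag x).fil i, res x v ∈ (flag x).fil i

variable {D : Finset X} {E : X → Type*}
    [∀ x, AddCommGroup (E x)] [∀ x, Module ℂ (E x)]
    [TopologicalSpace (TotalSpace (Fin 5 → ℂ) E)] [∀ x, TopologicalSpace (E x)]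
    [FiberBundle (Fin 5 → ℂ) E] [VectorBundle ℂ (Fin 5 → ℂ) E]
    [ContMDiffVectorBundle ω (Fin 5 → ℂ) E 𝓘(ℂ, ℂ)]

namespace ParabolicHiggsBundle

/-- The parabolic degree of a holomorphic subbundle of `E`. -/
def pardeg (P : ParabolicHiggsBundle D E) (S : ∀ x, Submodule ℂ (E x)) : ℝ :=
  bundleDegree (Fin 5 → ℂ) S - ∑ x : D, (P.flag x).contribution (S x)

/-- `U' ⊕ V'` is an isotropic `Φ`-invariant holomorphic subbundle of `E`, where `U'` and `V'` are
holomorphic subbundles of `U` and `V`. -/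
structure IsTestPair (P : ParabolicHiggsBundle D E) (U' V' : ∀ x, Submodule ℂ (E x)) : Prop where
  U_hol : ∃ k, IsHolSubbundle (Fin 5 → ℂ) U' k
  V_hol : ∃ k, IsHolSubbundle (Fin 5 → ℂ) V' k
  U_le : ∀ x, U' x ≤ P.U x
  V_le : ∀ x, V' x ≤ P.V x
  isotropic : ∀ x, ∀ a ∈ U' x ⊔ V' x, ∀ b ∈ U' x ⊔ V' x, P.Q x a b = 0
  invariant : ∀ x ∉ D, ∀ ξ, ∀ a ∈ U' x ⊔ V' x, P.Φ x ξ a ∈ U' x ⊔ V' x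

def IsSemistable (P : ParabolicHiggsBundle D E) : Prop :=
  ∀ U' V', P.IsTestPair U' V' → P.pardeg (fun x => U' x ⊔ V' x) ≤ 0

def IsStable (P : ParabolicHiggsBundle D E) : Prop :=
  P.IsSemistable ∧ ∀ U' V', P.IsTestPair U' V' → (∃ x, V' x ≠ ⊥) →
    P.pardeg (fun x => U' x ⊔ V' x) < 0

/-- An `α₁`-cyclic structure: `U = L₋₁ ⊕ L₁`, `V = L₋₂ ⊕ L₀ ⊕ L₂` with holomorphic line bundles
`Lᵢ` (`m` stands for minus) such that `Q` pairs `Lᵢ` with `L₋ᵢ` only, which identifies `L₋ᵢ` with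
the dual of `Lᵢ`, and such that `Φ` consists of `τ : L₁ → L₂`, `β : L₀ → L₁`, `γ : L₂ → L₋₁`
and their duals (which are determined by `Φ_skew`), all with values in `K`. -/
structure CyclicStructure (P : ParabolicHiggsBundle D E) where
  (Lm2 Lm1 L0 L1 L2 : ∀ x, Submodule ℂ (E x))
  Lm2_hol : IsHolSubbundle (Fin 5 → ℂ) Lm2 1
  Lm1_hol : IsHolSubbundle (Fin 5 → ℂ) Lm1 1
  L0_hol : IsHolSubbundle (Fin 5 → ℂ) L0 1
  L1_hol : IsHolSubbundle (Fin 5 → ℂ) L1 1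
  L2_hol : IsHolSubbundle (Fin 5 → ℂ) L2 1
  /-- By ranks, the sums are direct. -/
  U_eq : ∀ x, P.U x = Lm1 x ⊔ L1 x
  V_eq : ∀ x, P.V x = Lm2 x ⊔ L0 x ⊔ L2 x
  Q_L1 : ∀ x, ∀ a ∈ L1 x, ∀ b ∈ L1 x, P.Q x a b = 0
  Q_Lm1 : ∀ x, ∀ a ∈ Lm1 x, ∀ b ∈ Lm1 x, P.Q x a b = 0
  Q_L2 : ∀ x, ∀ a ∈ L2 x, ∀ b ∈ L2 x, P.Q x a b = 0
  Q_Lm2 : ∀ x, ∀ a ∈ Lm2 x, ∀ b ∈ Lm2 x, P.Q x a b = 0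
  Q_L0_L2 : ∀ x, ∀ a ∈ L0 x, ∀ b ∈ L2 x, P.Q x a b = 0
  Q_L0_Lm2 : ∀ x, ∀ a ∈ L0 x, ∀ b ∈ Lm2 x, P.Q x a b = 0
  Φ_Lm2 : ∀ x ∉ D, ∀ ξ, ∀ e ∈ Lm2 x, P.Φ x ξ e ∈ Lm1 x
  Φ_Lm1 : ∀ x ∉ D, ∀ ξ, ∀ e ∈ Lm1 x, P.Φ x ξ e ∈ L0 x
  Φ_L0 : ∀ x ∉ D, ∀ ξ, ∀ e ∈ L0 x, P.Φ x ξ e ∈ L1 x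
  Φ_L1 : ∀ x ∉ D, ∀ ξ, ∀ e ∈ L1 x, P.Φ x ξ e ∈ Lm2 x ⊔ L2 x
  Φ_L2 : ∀ x ∉ D, ∀ ξ, ∀ e ∈ L2 x, P.Φ x ξ e ∈ Lm1 x
  /-- `τ`, the `L₂`-component of `Φ` on `L₁`, is an isomorphism outside `D`. -/
  τ_iso : ∀ x ∉ D, ∀ ξ, ξ ≠ 0 → ∀ e ∈ L1 x, P.Φ x ξ e ∈ Lm2 x → e = 0
  /-- `β`, the restriction of `Φ` to `L₀`, does not vanish identically. -/
  β_ne_zero : ∃ x ∉ D, ∃ ξ, ∃ e ∈ L0 x, P.Φ x ξ e ≠ 0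

namespace CyclicStructure

variable {P : ParabolicHiggsBundle D E}

/-- `γ`, the restriction of `Φ` to `L₂`, vanishes identically. -/
def GammaEqZero (C : P.CyclicStructure) : Prop :=
  ∀ x ∉ D, ∀ ξ, ∀ e ∈ C.L2 x, P.Φ x ξ e = 0

/-- Assumption A. Flags are listed from the whole space down to `⊥`. -/
structure AssumptionA (C : P.CyclicStructure) : Prop where
  flag_eq : ∀ x : D, ∃ ζ : ℝ, 0 ≤ ζ ∧ ζ < 1 / 2 ∧
    (ζ = 0 → P.flag x = ⟨1, ![⊤, ⊥], ![0]⟩) ∧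
    (ζ ≠ 0 →
      P.flag x =
        ⟨3, ![⊤, C.L0 x ⊔ C.L1 x ⊔ C.L2 x, C.L1 x ⊔ C.L2 x, ⊥], ![ζ, 0, -ζ]⟩ ∨
      P.flag x =
        ⟨3, ![⊤, C.Lm2 x ⊔ C.Lm1 x ⊔ C.L0 x, C.Lm2 x ⊔ C.Lm1 x, ⊥], ![ζ, 0, -ζ]⟩)
  /-- `τ : L₁ → L₂ ⊗ K(D)` is an isomorphism at the points of `D` too: the `L₂`-component of the
  residue on `L₁` is injective. -/
  τ_iso : ∀ x : D, ∀ e ∈ C.L1 x, P.res x e ∈ C.Lm2 x → e = 0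

end CyclicStructure

end ParabolicHiggsBundle

/-- The degree of `K(D)`. -/
def logCanonicalDegree (D : Finset X) : ℝ :=
  canonicalDegree X + (D.card : ℝ)

end Higgs

end

set_option linter.unusedSectionVars false

noncomputable section

/-! ### The Laplacian in the plane -/

/-! Let `U' ⊕ V'` be a test pair and look at a fibre over a point outside `D` where β does not
vanish. Skewness makes the duals of β and τ nonzero there too, and `L₀` is anisotropic. Isotropy and
invariance then force `U' ⊆ L₁` and `V' ⊆ L₂`, with `V' ≠ 0` as soon as `U' ≠ 0`
(`IsAntidiagonal.isotropic_invariant`). By the identity theorem the exceptional points are isolated,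
so constant rank and continuity determine the pair globally: it is `(0, 0)`, or γ vanishes and it is
`(0, L₂)` or `(L₁, L₂)` (`testPair_cases`). In particular γ ≢ 0 gives stability at once.

If γ ≡ 0, the isomorphism τ gives `pardeg L₂ = pardeg L₁ - deg K(D)`, so that `pardeg (L₁ ⊕ L₂) = 2
pardeg L₁ - deg K(D)`, whose sign is the asserted criterion. The pair `(0, L₂)` imposes no further
condition. Indeed β is a nonzero morphism `L₀ → L₁ ⊗ K(D)` and `deg L₀ = 0`, whence `pardeg L₁ + deg
K(D) ≥ 0` (`pardeg_L1_add_nonneg`): a positive weight, which would lower the parabolic degree,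
forces β to have a vanishing residue, and this zero outweighs it. With the criterion this gives
`pardeg L₂ ≤ 0`, strictly in the stable case.

These arguments need that the degree counts the zeros of a morphism of line bundles, while the
degree is defined as a curvature integral. The bridge is a residue formula (`surfInt_potential_eq`).
The logarithm of a Gram determinant is a local potential for the Chern form, and a change of frame
adds a harmonic `log ‖a‖`. If the potentials agree with one global function up to such terms and
logarithmic poles, the integral of the Laplacian is 2π times the sum of the pole coefficients. This
follows from two computations: the Laplacian of a global smooth function has integral zero, and that
of a cut-off `log ‖z‖`, taken off the origin, has integral -2π. Applied to the norm of a component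
of the Higgs field, the formula gives `exists_vanishing_orders`. All subbundles of one bundle are
measured with one metric, so independence of the metric is never needed; independence of the
partition of unity is, to compare with the canonical bundle. -/

lemma two_le_infty : (2 : WithTop ℕ∞) ≤ ∞ := by
  exact WithTop.coe_le_coe.2 (le_top : (2 : ℕ∞) ≤ ⊤)

lemma laplacian_eq_of_hasFDerivAt {f : ℂ → ℝ} {f' : ℂ → ℂ →L[ℝ] ℝ} {f'' : ℂ →L[ℝ] ℂ →L[ℝ] ℝ}
    {z : ℂ} (h : ∀ᶠ w in 𝓝 z, HasFDerivAt f (f' w) w) (h' : HasFDerivAt f' f'' z) :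
    Laplacian.laplacian f z = f'' 1 1 + f'' Complex.I Complex.I := by
  have h1 : fderiv ℝ f =ᶠ[𝓝 z] f' := h.mono fun w hw => hw.fderiv
  rw [InnerProductSpace.laplacian_eq_iteratedFDeriv_complexPlane]
  simp only [iteratedFDeriv_two_apply, h1.fderiv_eq, h'.fderiv]
  simp

lemma laplacian_eq_fderiv (f : ℂ → ℝ) (z : ℂ) : Laplacian.laplacian f z =
    fderiv ℝ (fderiv ℝ f) z 1 1 + fderiv ℝ (fderiv ℝ f) z Complex.I Complex.I := by
  rw [InnerProductSpace.laplacian_eq_iteratedFDeriv_complexPlane]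
  simp [iteratedFDeriv_two_apply]

/-- In the chain rule the term with the second derivative `e` of φ is the value of a linear form at
`e + e * I * I = 0`. The other term evaluates the Hessian of `g` on `d` and `d * I`, an orthogonal
pair of length `‖d‖`, so the mixed terms cancel. -/
lemma laplacian_comp_holomorphic {g : ℂ → ℝ} {φ : ℂ → ℂ} {z : ℂ} (hφ : AnalyticAt ℂ φ z)
    (hg : ContDiffAt ℝ 2 g (φ z)) :
    Laplacian.laplacian (fun w => g (φ w)) z =
      ‖deriv φ z‖ ^ 2 * Laplacian.laplacian g (φ z) := by
  let L : ℂ →L[ℝ] ℂ →L[ℝ] ℂ := ContinuousLinearMap.mul ℝ ℂ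
  have hd : ∀ᶠ w in 𝓝 z, HasFDerivAt φ (L (deriv φ w)) w := by
    filter_upwards [hφ.eventually_analyticAt] with w hw
    have h1 := hw.differentiableAt.hasDerivAt.hasFDerivAt.restrictScalars ℝ
    exact h1.congr_fderiv (by ext v; simp [L, mul_comm])
  have hgd : ∀ᶠ w in 𝓝 z, DifferentiableAt ℝ g (φ w) := by
    have h1 : ∀ᶠ y in 𝓝 (φ z), ContDiffAt ℝ 2 g y := hg.eventually (by simp)
    exact (hφ.continuousAt.eventually h1).mono fun w hw => hw.differentiableAt (by simp)
  have h1 : ∀ᶠ w in 𝓝 z, HasFDerivAt (fun w => g (φ w))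
      ((fderiv ℝ g (φ w)).comp (L (deriv φ w))) w := by
    filter_upwards [hd, hgd] with w hw hw'
    exact hw'.hasFDerivAt.comp w hw
  have hz : HasFDerivAt φ (L (deriv φ z)) z := hd.self_of_nhds
  have h2 : HasFDerivAt (fun w => fderiv ℝ g (φ w))
      ((fderiv ℝ (fderiv ℝ g) (φ z)).comp (L (deriv φ z))) z := by
    have : DifferentiableAt ℝ (fderiv ℝ g) (φ z) :=
      (hg.fderiv_right (m := 1) (by norm_num)).differentiableAt (by simp)
    exact this.hasFDerivAt.comp z hz
  have h3 : HasFDerivAt (fun w => L (deriv φ w)) (L.comp (L (deriv (deriv φ) z))) z := by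
    have h4 : HasFDerivAt (deriv φ) (L (deriv (deriv φ) z)) z := by
      have h1 := hφ.deriv.differentiableAt.hasDerivAt.hasFDerivAt.restrictScalars ℝ
      exact h1.congr_fderiv (by ext v; simp [L, mul_comm])
    exact L.hasFDerivAt.comp z h4
  rw [laplacian_eq_of_hasFDerivAt h1 (h2.clm_comp h3), laplacian_eq_fderiv g]
  set B := fderiv ℝ (fderiv ℝ g) (φ z)
  set A := fderiv ℝ g (φ z)
  set d := deriv φ z
  set e := deriv (deriv φ) z
  have hd1 : d = d.re • (1 : ℂ) + d.im • Complex.I := by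
    simp [Complex.re_add_im]
  have hd2 : d * Complex.I = (-d.im) • (1 : ℂ) + d.re • Complex.I := by
    apply Complex.ext <;> simp
  have hn : ‖d‖ ^ 2 = d.re ^ 2 + d.im ^ 2 := by
    rw [← Complex.normSq_eq_norm_sq, Complex.normSq_apply]; ring
  have hI : e * Complex.I * Complex.I = -e := by
    rw [mul_assoc, Complex.I_mul_I]; ring
  simp only [_root_.add_apply, ContinuousLinearMap.comp_apply,
    ContinuousLinearMap.compL_apply, ContinuousLinearMap.flip_apply, L,
    ContinuousLinearMap.mul_apply', mul_one, hI, hd2, hn, map_neg]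
  rw [hd1]
  simp only [map_add, map_smul, _root_.add_apply, _root_.smul_apply,
    smul_eq_mul, Complex.add_re, Complex.add_im]
  simp
  ring

lemma laplacian_log_norm {a : ℂ → ℂ} {z : ℂ} (ha : AnalyticAt ℂ a z) (h0 : a z ≠ 0) :
    Laplacian.laplacian (fun w => Real.log ‖a w‖) z = 0 :=
  (ha.harmonicAt_log_norm h0).2.self_of_nhds

lemma contDiffAt_log_norm {a : ℂ → ℂ} {z : ℂ} (ha : AnalyticAt ℂ a z) (h0 : a z ≠ 0) :
    ContDiffAt ℝ ∞ (fun w => Real.log ‖a w‖) z := by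
  have h1 : ContDiffAt ℝ ∞ a z := ha.contDiffAt.restrict_scalars ℝ
  exact (h1.norm ℝ h0).log (by simpa using h0)

/-! ### Integration by parts and change of variables in the plane -/

lemma integral_fderiv_eq_zero {g : ℂ → ℝ} (hg : ContDiff ℝ 1 g) (hc : HasCompactSupport g) (v : ℂ) :
    ∫ z, fderiv ℝ g z v = 0 := by
  have h := integral_mul_fderiv_eq_neg_fderiv_mul_of_integrable (μ := (volume : Measure ℂ))
    (f := fun _ : ℂ => (1 : ℝ)) (g := g) (v := v) (by simp)
    (by
      simp only [one_mul]
      exact ((hg.continuous_fderiv (by simp)).clm_apply continuous_const).integrable_of_hasCompactSupport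
        (hc.fderiv_apply ℝ v))
    (by simpa using hg.continuous.integrable_of_hasCompactSupport hc)
    (by simp) (fun x _ => hg.differentiable (by simp) x)
  simpa using h

lemma integral_laplacian_eq_zero {g : ℂ → ℝ} (hg : ContDiff ℝ 2 g) (hc : HasCompactSupport g) :
    ∫ z, Laplacian.laplacian g z = 0 := by
  have h1 : ∀ v : ℂ, ContDiff ℝ 1 (fun z => fderiv ℝ g z v) := fun v =>
    (hg.fderiv_right (m := 1) (by norm_num)).clm_apply contDiff_const
  have h2 : ∀ v : ℂ, HasCompactSupport (fun z => fderiv ℝ g z v) := fun v => hc.fderiv_apply ℝ v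
  have h3 : ∀ v z, fderiv ℝ (fderiv ℝ g) z v v = fderiv ℝ (fun z => fderiv ℝ g z v) z v := by
    intro v z
    rw [fderiv_clm_apply (((hg.fderiv_right (m := 1) (by norm_num)).differentiable (by simp)) z)
      (by simp)]
    simp
  simp only [laplacian_eq_fderiv, h3]
  rw [integral_add, integral_fderiv_eq_zero (h1 1) (h2 1),
    integral_fderiv_eq_zero (h1 Complex.I) (h2 Complex.I), add_zero]
  · exact (((h1 1).continuous_fderiv (by simp)).clm_apply
      continuous_const).integrable_of_hasCompactSupport ((h2 1).fderiv_apply ℝ 1)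
  · exact (((h1 Complex.I).continuous_fderiv (by simp)).clm_apply
      continuous_const).integrable_of_hasCompactSupport ((h2 Complex.I).fderiv_apply ℝ Complex.I)

lemma continuousAt_laplacian {g : ℂ → ℝ} {z : ℂ} (hg : ContDiffAt ℝ 2 g z) :
    ContinuousAt (Laplacian.laplacian g) z := by
  have h1 : ContDiffAt ℝ 0 (fderiv ℝ (fderiv ℝ g)) z :=
    (hg.fderiv_right (m := 1) (by norm_num)).fderiv_right (m := 0) (by norm_num)
  have h2 := h1.continuousAt
  rw [show Laplacian.laplacian g = fun z => fderiv ℝ (fderiv ℝ g) z 1 1 +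
    fderiv ℝ (fderiv ℝ g) z Complex.I Complex.I from funext (laplacian_eq_fderiv g)]
  exact ((h2.clm_apply continuousAt_const).clm_apply continuousAt_const).add
    ((h2.clm_apply continuousAt_const).clm_apply continuousAt_const)

/-- Change of variables under an injective holomorphic map. -/
lemma integral_image_holomorphic {s : Set ℂ} (hs : MeasurableSet s) {φ : ℂ → ℂ}
    (hφ : ∀ z ∈ s, DifferentiableAt ℂ φ z) (hi : Set.InjOn φ s) (g : ℂ → ℝ) :
    ∫ z in φ '' s, g z = ∫ z in s, ‖deriv φ z‖ ^ 2 * g (φ z) := by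
  have h := integral_image_eq_integral_abs_det_fderiv_smul (volume : Measure ℂ) hs
    (f := φ) (f' := fun z => (ContinuousLinearMap.toSpanSingleton ℂ (deriv φ z)).restrictScalars ℝ)
    (fun z hz => ((hφ z hz).hasDerivAt.hasFDerivAt.restrictScalars ℝ).hasFDerivWithinAt) hi g
  rw [h]
  congr 1
  ext z
  rw [smul_eq_mul]
  congr 1
  -- The real determinant of multiplication by `w` is the norm of `w` from `ℂ` to `ℝ`, namely `‖w‖ ^
  -- 2`.
  simp [ContinuousLinearMap.det, LinearMap.det_restrictScalars,
    Algebra.norm_complex_eq, Complex.normSq_eq_norm_sq]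

/-! ### The cut-off logarithm and its Laplacian -/

/-- A smooth function on the line which is the identity near `-∞` and vanishes from `c` on. -/
def cutLine (c s : ℝ) : ℝ := s * Real.smoothTransition (c - s)

lemma contDiff_cutLine (c : ℝ) : ContDiff ℝ ∞ (cutLine c) :=
  contDiff_id.mul (Real.smoothTransition.contDiff.comp (contDiff_const.sub contDiff_id))

lemma cutLine_of_le {c s : ℝ} (h : s ≤ c - 1) : cutLine c s = s := by
  rw [cutLine, Real.smoothTransition.one_of_one_le (by linarith), mul_one]

lemma cutLine_of_ge {c s : ℝ} (h : c ≤ s) : cutLine c s = 0 := by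
  rw [cutLine, Real.smoothTransition.zero_of_nonpos (by linarith), mul_zero]

/-- Only the end values of the first derivative matter: it is 1 near `-∞` and 0 near `+∞`. -/
lemma integral_cutLine (c : ℝ) : ∫ s, deriv (deriv (cutLine c)) s = -1 := by
  have hC : ContDiff ℝ 1 (deriv (cutLine c)) :=
    ((contDiff_infty_iff_deriv.1 (contDiff_cutLine c)).2).of_le (by exact_mod_cast le_top)
  have hlow : ∀ s < c - 1, deriv (cutLine c) s = 1 := by
    intro s hs
    have : cutLine c =ᶠ[𝓝 s] id := by
      filter_upwards [Iio_mem_nhds hs] with t ht using cutLine_of_le (le_of_lt ht)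
    rw [this.deriv_eq]; simp
  have hhigh : ∀ s > c, deriv (cutLine c) s = 0 := by
    intro s hs
    have : cutLine c =ᶠ[𝓝 s] fun _ => 0 := by
      filter_upwards [Ioi_mem_nhds hs] with t ht using cutLine_of_ge (le_of_lt ht)
    rw [this.deriv_eq]; simp
  have hsupp : HasCompactSupport (deriv (deriv (cutLine c))) := by
    refine HasCompactSupport.intro (isCompact_Icc (a := c - 1) (b := c)) fun s hs => ?_
    rw [Set.mem_Icc, not_and_or, not_le, not_le] at hs
    rcases hs with hs | hs
    · have : deriv (cutLine c) =ᶠ[𝓝 s] fun _ => 1 := by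
        filter_upwards [Iio_mem_nhds hs] with t ht using hlow t ht
      rw [this.deriv_eq]; simp
    · have : deriv (cutLine c) =ᶠ[𝓝 s] fun _ => 0 := by
        filter_upwards [Ioi_mem_nhds hs] with t ht using hhigh t ht
      rw [this.deriv_eq]; simp
  rw [integral_of_hasDerivAt_of_tendsto (f := deriv (cutLine c)) (m := 1) (n := 0)
    (fun x => (hC.differentiable (by simp) x).hasDerivAt)
    ((hC.continuous_deriv (by simp)).integrable_of_hasCompactSupport hsupp)]
  · norm_num
  · refine tendsto_const_nhds.congr' ?_
    filter_upwards [Filter.Iio_mem_atBot (c - 1)] with s hs using (hlow s hs).symm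
  · refine tendsto_const_nhds.congr' ?_
    filter_upwards [Filter.Ioi_mem_atTop c] with s hs using (hhigh s hs).symm

/-- The logarithm `log ‖z‖`, cut off smoothly at radius `r`. -/
def cutLog (r : ℝ) (z : ℂ) : ℝ := cutLine (Real.log r) (Real.log ‖z‖)

lemma cutLog_of_ge {r : ℝ} (hr : 0 < r) {z : ℂ} (h : r ≤ ‖z‖) : cutLog r z = 0 :=
  cutLine_of_ge (Real.log_le_log hr h)

lemma cutLog_eventually (r : ℝ) : ∀ᶠ z in 𝓝[≠] (0 : ℂ), cutLog r z = Real.log ‖z‖ := by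
  have h1 : ∀ᶠ z in 𝓝[≠] (0 : ℂ), ‖z‖ < Real.exp (Real.log r - 1) :=
    nhdsWithin_le_nhds <| by
      filter_upwards [Metric.ball_mem_nhds (0 : ℂ) (Real.exp_pos (Real.log r - 1))] with z hz
      simpa using hz
  filter_upwards [h1, self_mem_nhdsWithin] with z hz hz0
  apply cutLine_of_le
  rw [Real.log_le_iff_le_exp (by simpa using hz0)]
  exact hz.le

lemma contDiffAt_cutLog (r : ℝ) {z : ℂ} (hz : z ≠ 0) : ContDiffAt ℝ ∞ (cutLog r) z :=
  (contDiff_cutLine _).contDiffAt.comp z (contDiffAt_log_norm analyticAt_id hz)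

lemma laplacian_comp_re {g : ℝ → ℝ} (hg : ContDiff ℝ ∞ g) (w : ℂ) :
    Laplacian.laplacian (fun w : ℂ => g w.re) w = deriv (deriv g) w.re := by
  have hg' : ContDiff ℝ ∞ (deriv g) := (contDiff_infty_iff_deriv.1 hg).2
  have h1 : ∀ (k : ℝ → ℝ), ContDiff ℝ ∞ k → ∀ w : ℂ,
      HasFDerivAt (fun w : ℂ => k w.re) (deriv k w.re • Complex.reCLM) w := fun k hk w =>
    ((hk.differentiable (by simp)) w.re).hasDerivAt.comp_hasFDerivAt w Complex.reCLM.hasFDerivAt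
  rw [laplacian_eq_of_hasFDerivAt (Filter.Eventually.of_forall (h1 g hg))
    ((h1 _ hg' w).smul_const Complex.reCLM)]
  simp

lemma integral_strip (k : ℝ → ℝ) :
    ∫ w in {w : ℂ | w.im ∈ Set.Ioo (-Real.pi) Real.pi}, k w.re = 2 * Real.pi * ∫ s, k s := by
  have h := (Complex.volume_preserving_equiv_real_prod.symm).setIntegral_preimage_emb
    Complex.measurableEquivRealProd.symm.measurableEmbedding (fun w : ℂ => k w.re)
    {w : ℂ | w.im ∈ Set.Ioo (-Real.pi) Real.pi}
  rw [← h]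
  have hs : Complex.measurableEquivRealProd.symm ⁻¹' {w : ℂ | w.im ∈ Set.Ioo (-Real.pi) Real.pi} =
      Set.univ ×ˢ Set.Ioo (-Real.pi) Real.pi := by
    ext ⟨a, b⟩; simp [Complex.measurableEquivRealProd_symm_apply]
  rw [hs]
  have : ∀ p : ℝ × ℝ, k (Complex.measurableEquivRealProd.symm p).re = k p.1 * 1 := by
    rintro ⟨a, b⟩; simp [Complex.measurableEquivRealProd_symm_apply]
  simp only [this]
  have := setIntegral_prod_mul (μ := (volume : Measure ℝ)) (ν := (volume : Measure ℝ)) k (fun _ => (1 : ℝ)) Set.univ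
    (Set.Ioo (-Real.pi) Real.pi)
  rw [Measure.volume_eq_prod, this]
  simp
  rw [max_eq_left (by positivity)]
  ring

/-- The substitution `z = exp w` turns `log ‖z‖` into `re w` and the slit plane into a strip of
width 2π. By conformal invariance the integral becomes 2π times the one-dimensional integral of
`cutLine''`. The minus sign appears because the point mass 2π at the origin, which the pointwise
Laplacian does not see, is missing. -/
lemma integral_laplacian_cutLog (r : ℝ) : ∫ z, Laplacian.laplacian (cutLog r) z = -(2 * Real.pi) := by
  -- The slit is a null set.
  have h1 : ∫ z, Laplacian.laplacian (cutLog r) z =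
      ∫ z in Complex.slitPlane, Laplacian.laplacian (cutLog r) z := by
    rw [← setIntegral_univ]
    apply setIntegral_congr_set
    have h := Complex.volume_preserving_equiv_real_prod.quasiMeasurePreserving.ae_eq_comp
      polarCoord_source_ae_eq_univ
    refine Filter.EventuallyEq.symm ?_
    filter_upwards [h] with z hz
    rw [← Complex.polarCoord_source]
    exact hz
  have himg : Complex.slitPlane =
      Complex.exp '' {w : ℂ | w.im ∈ Set.Ioo (-Real.pi) Real.pi} :=
    (Complex.expOpenPartialHomeomorph.image_source_eq_target).symm
  rw [h1, himg, integral_image_holomorphic]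
  · rw [show -(2 * Real.pi) = 2 * Real.pi * (-1) by ring, ← integral_cutLine (Real.log r),
      ← integral_strip]
    congr 1
    ext w
    rw [← laplacian_comp_re (contDiff_cutLine _),
      ← laplacian_comp_holomorphic (by fun_prop)
        ((contDiffAt_cutLog r (Complex.exp_ne_zero w)).of_le two_le_infty)]
    simp [cutLog, Complex.norm_exp]
  · exact (isOpen_Ioo.preimage Complex.continuous_im).measurableSet
  · exact fun z _ => Complex.differentiable_exp z
  · exact Complex.expOpenPartialHomeomorph.injOn

/-! ### Charts of a Riemann surface -/

section Surface

variable {X : Type*} [TopologicalSpace X] [ChartedSpace ℂ X] [IsManifold 𝓘(ℂ, ℂ) ω X]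

lemma analyticAt_chart_transition {c d p : X} (hc : p ∈ (chartAt ℂ c).source)
    (hd : p ∈ (chartAt ℂ d).source) :
    AnalyticAt ℂ (fun z => chartAt ℂ d ((chartAt ℂ c).symm z)) (chartAt ℂ c p) := by
  have h1 : ContMDiffAt 𝓘(ℂ, ℂ) 𝓘(ℂ, ℂ) ω (chartAt ℂ c).symm (chartAt ℂ c p) :=
    (contMDiffOn_chart_symm (x := c)).contMDiffAt
      ((chartAt ℂ c).open_target.mem_nhds ((chartAt ℂ c).map_source hc))
  have h2 : ContMDiffAt 𝓘(ℂ, ℂ) 𝓘(ℂ, ℂ) ω (chartAt ℂ d) ((chartAt ℂ c).symm (chartAt ℂ c p)) := by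
    rw [(chartAt ℂ c).left_inv hc]
    exact (contMDiffOn_chart (x := d)).contMDiffAt ((chartAt ℂ d).open_source.mem_nhds hd)
  exact (contMDiffAt_iff_contDiffAt.1 (h2.comp _ h1)).analyticAt

/-- Metrics and partitions of unity are smooth only in the real sense, so the complex charts must
also form a real smooth atlas. -/
instance isManifold_real : IsManifold 𝓘(ℝ, ℂ) ∞ X := by
  refine isManifold_of_contDiffOn 𝓘(ℝ, ℂ) ∞ X fun e e' he he' => ?_
  have h := (contDiffGroupoid ω 𝓘(ℂ, ℂ)).compatible he he'
  rw [contDiffGroupoid, mem_groupoid_of_pregroupoid] at h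
  have h1 := h.1
  simp only [contDiffPregroupoid] at h1
  exact (h1.restrict_scalars ℝ).of_le le_top

lemma HolomorphicAt.analyticAt_chart {a : X → ℂ} {c p : X}
    (h : ContMDiffAt 𝓘(ℂ, ℂ) 𝓘(ℂ, ℂ) ω a p) (hc : p ∈ (chartAt ℂ c).source) :
    AnalyticAt ℂ (fun z => a ((chartAt ℂ c).symm z)) (chartAt ℂ c p) := by
  have h1 : ContMDiffAt 𝓘(ℂ, ℂ) 𝓘(ℂ, ℂ) ω (chartAt ℂ c).symm (chartAt ℂ c p) :=
    (contMDiffOn_chart_symm (x := c)).contMDiffAt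
      ((chartAt ℂ c).open_target.mem_nhds ((chartAt ℂ c).map_source hc))
  have h2 : ContMDiffAt 𝓘(ℂ, ℂ) 𝓘(ℂ, ℂ) ω a ((chartAt ℂ c).symm (chartAt ℂ c p)) := by
    rwa [(chartAt ℂ c).left_inv hc]
  exact (contMDiffAt_iff_contDiffAt.1 (h2.comp _ h1)).analyticAt

section Real

variable {F : Type*} [NormedAddCommGroup F] [NormedSpace ℝ F]

lemma ContMDiffAt.contDiffAt_chart {f : X → F} {c p : X} (h : ContMDiffAt 𝓘(ℝ, ℂ) 𝓘(ℝ, F) ∞ f p)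
    (hc : p ∈ (chartAt ℂ c).source) :
    ContDiffAt ℝ ∞ (fun z => f ((chartAt ℂ c).symm z)) (chartAt ℂ c p) := by
  have h1 : ContMDiffAt 𝓘(ℝ, ℂ) 𝓘(ℝ, ℂ) ∞ (chartAt ℂ c).symm (chartAt ℂ c p) :=
    (contMDiffOn_chart_symm (x := c)).contMDiffAt
      ((chartAt ℂ c).open_target.mem_nhds ((chartAt ℂ c).map_source hc))
  have h2 : ContMDiffAt 𝓘(ℝ, ℂ) 𝓘(ℝ, F) ∞ f ((chartAt ℂ c).symm (chartAt ℂ c p)) := by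
    rwa [(chartAt ℂ c).left_inv hc]
  exact contMDiffAt_iff_contDiffAt.1 (h2.comp _ h1)

lemma contMDiffAt_chart_real {c p : X} (hc : p ∈ (chartAt ℂ c).source) :
    ContMDiffAt 𝓘(ℝ, ℂ) 𝓘(ℝ, ℂ) ∞ (chartAt ℂ c) p :=
  (contMDiffOn_chart (x := c)).contMDiffAt ((chartAt ℂ c).open_source.mem_nhds hc)

lemma contMDiffAt_of_chart {f : X → F} {c p : X} (hc : p ∈ (chartAt ℂ c).source)
    (h : ContDiffAt ℝ ∞ (fun z => f ((chartAt ℂ c).symm z)) (chartAt ℂ c p)) :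
    ContMDiffAt 𝓘(ℝ, ℂ) 𝓘(ℝ, F) ∞ f p := by
  have h1 := (contMDiffAt_iff_contDiffAt.2 h).comp p (contMDiffAt_chart_real hc)
  refine h1.congr_of_eventuallyEq ?_
  filter_upwards [(chartAt ℂ c).open_source.mem_nhds hc] with y hy
  simp [(chartAt ℂ c).left_inv hy]

end Real

lemma HolomorphicAt.contMDiffAt_real {F : Type*} [NormedAddCommGroup F] [NormedSpace ℂ F]
    {a : X → F} {p : X} (h : ContMDiffAt 𝓘(ℂ, ℂ) 𝓘(ℂ, F) ω a p) :
    ContMDiffAt 𝓘(ℝ, ℂ) 𝓘(ℝ, F) ∞ a p := by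
  refine contMDiffAt_of_chart (mem_chart_source ℂ p) ?_
  have h1 : ContMDiffAt 𝓘(ℂ, ℂ) 𝓘(ℂ, ℂ) ω (chartAt ℂ p).symm (chartAt ℂ p p) :=
    (contMDiffOn_chart_symm (x := p)).contMDiffAt
      ((chartAt ℂ p).open_target.mem_nhds ((chartAt ℂ p).map_source (mem_chart_source ℂ p)))
  have h2 : ContMDiffAt 𝓘(ℂ, ℂ) 𝓘(ℂ, F) ω a ((chartAt ℂ p).symm (chartAt ℂ p p)) := by
    rwa [(chartAt ℂ p).left_inv (mem_chart_source ℂ p)]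
  exact ((contMDiffAt_iff_contDiffAt.1 (h2.comp _ h1)).restrict_scalars ℝ).of_le le_top

lemma HolomorphicAt.smooth_log_norm {a : X → ℂ} {p : X}
    (h : ContMDiffAt 𝓘(ℂ, ℂ) 𝓘(ℂ, ℂ) ω a p) (h0 : a p ≠ 0) :
    ContMDiffAt 𝓘(ℝ, ℂ) 𝓘(ℝ, ℝ) ∞ (fun y => Real.log ‖a y‖) p := by
  refine contMDiffAt_of_chart (mem_chart_source ℂ p) ?_
  refine contDiffAt_log_norm (HolomorphicAt.analyticAt_chart h (mem_chart_source ℂ p)) ?_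
  rwa [(chartAt ℂ p).left_inv (mem_chart_source ℂ p)]

/-! ### The Laplacian in a chart -/

/-- The Laplacian of `f` in the coordinate `chartAt ℂ c`. -/
def chartLap (c : X) (f : X → ℝ) (z : ℂ) : ℝ :=
  Laplacian.laplacian (fun w => f ((chartAt ℂ c).symm w)) z

lemma eventually_chart_symm {c p : X} (hc : p ∈ (chartAt ℂ c).source) {P : X → Prop}
    (h : ∀ᶠ y in 𝓝 p, P y) : ∀ᶠ z in 𝓝 (chartAt ℂ c p), P ((chartAt ℂ c).symm z) := by
  have h1 := (chartAt ℂ c).continuousAt_symm ((chartAt ℂ c).map_source hc)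
  rw [ContinuousAt, (chartAt ℂ c).left_inv hc] at h1
  exact h1.eventually h

lemma chartLap_congr {c p : X} (hc : p ∈ (chartAt ℂ c).source) {f g : X → ℝ}
    (h : f =ᶠ[𝓝 p] g) : chartLap c f (chartAt ℂ c p) = chartLap c g (chartAt ℂ c p) :=
  (InnerProductSpace.laplacian_congr_nhds (eventually_chart_symm (P := fun y => f y = g y) hc h)).self_of_nhds

lemma chartLap_add {c p : X} (hc : p ∈ (chartAt ℂ c).source) {f g : X → ℝ}
    (hf : ContMDiffAt 𝓘(ℝ, ℂ) 𝓘(ℝ, ℝ) ∞ f p) (hg : ContMDiffAt 𝓘(ℝ, ℂ) 𝓘(ℝ, ℝ) ∞ g p) :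
    chartLap c (fun y => f y + g y) (chartAt ℂ c p) =
      chartLap c f (chartAt ℂ c p) + chartLap c g (chartAt ℂ c p) :=
  ((hf.contDiffAt_chart hc).of_le two_le_infty).laplacian_add
    ((hg.contDiffAt_chart hc).of_le two_le_infty)

lemma chartLap_const_mul {c p : X} (hc : p ∈ (chartAt ℂ c).source) {f : X → ℝ} (r : ℝ)
    (hf : ContMDiffAt 𝓘(ℝ, ℂ) 𝓘(ℝ, ℝ) ∞ f p) :
    chartLap c (fun y => r * f y) (chartAt ℂ c p) = r * chartLap c f (chartAt ℂ c p) :=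
  InnerProductSpace.laplacian_smul r ((hf.contDiffAt_chart hc).of_le two_le_infty)

lemma chartLap_const (c : X) (r : ℝ) (z : ℂ) : chartLap c (fun _ => r) z = 0 := by
  simp [chartLap]

lemma chartLap_sum {ι : Type*} (s : Finset ι) {c p : X} (hc : p ∈ (chartAt ℂ c).source)
    {f : ι → X → ℝ} (hf : ∀ i ∈ s, ContMDiffAt 𝓘(ℝ, ℂ) 𝓘(ℝ, ℝ) ∞ (f i) p) :
    chartLap c (fun y => ∑ i ∈ s, f i y) (chartAt ℂ c p) =
      ∑ i ∈ s, chartLap c (f i) (chartAt ℂ c p) := by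
  classical
  induction s using Finset.induction_on with
  | empty => simp [chartLap_const]
  | insert i s hi ih =>
    simp only [Finset.sum_insert hi]
    rw [chartLap_add hc (hf i (by simp)), ih fun j hj => hf j (by simp [hj])]
    exact contMDiffAt_finsetSum fun j hj => hf j (by simp [hj])

lemma chartLap_log_norm {c p : X} (hc : p ∈ (chartAt ℂ c).source) {a : X → ℂ}
    (h : ContMDiffAt 𝓘(ℂ, ℂ) 𝓘(ℂ, ℂ) ω a p) (h0 : a p ≠ 0) :
    chartLap c (fun y => Real.log ‖a y‖) (chartAt ℂ c p) = 0 :=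
  laplacian_log_norm (HolomorphicAt.analyticAt_chart h hc) (by rwa [(chartAt ℂ c).left_inv hc])

/-- Conformal invariance under the holomorphic transition map: this is what makes `Δ f dx dy` a
density on the surface. -/
lemma chartLap_transition {c d p : X} (hc : p ∈ (chartAt ℂ c).source)
    (hd : p ∈ (chartAt ℂ d).source) {f : X → ℝ} (hf : ContMDiffAt 𝓘(ℝ, ℂ) 𝓘(ℝ, ℝ) ∞ f p) :
    chartLap c f (chartAt ℂ c p) =
      ‖deriv (fun z => chartAt ℂ d ((chartAt ℂ c).symm z)) (chartAt ℂ c p)‖ ^ 2 *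
        chartLap d f (chartAt ℂ d p) := by
  have h := laplacian_comp_holomorphic (g := fun w => f ((chartAt ℂ d).symm w))
    (analyticAt_chart_transition hc hd) (by
      rw [(chartAt ℂ c).left_inv hc]
      exact (hf.contDiffAt_chart hd).of_le two_le_infty)
  rw [(chartAt ℂ c).left_inv hc] at h
  rw [chartLap, chartLap, ← h]
  refine (InnerProductSpace.laplacian_congr_nhds ?_).self_of_nhds
  refine eventually_chart_symm (P := fun y => f y = f ((chartAt ℂ d).symm (chartAt ℂ d y))) hc ?_
  filter_upwards [(chartAt ℂ d).open_source.mem_nhds hd] with y hy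
  rw [(chartAt ℂ d).left_inv hy]

/-! ### Densities and their integrals -/

/-- A continuous density `δ c |dz|²`, given by its coefficient in each coordinate. -/
structure IsDensity (δ : X → ℂ → ℝ) : Prop where
  conformal : ∀ c d p : X, p ∈ (chartAt ℂ c).source → p ∈ (chartAt ℂ d).source →
    δ c (chartAt ℂ c p) =
      ‖deriv (fun z => chartAt ℂ d ((chartAt ℂ c).symm z)) (chartAt ℂ c p)‖ ^ 2 *
        δ d (chartAt ℂ d p)
  continuousOn : ∀ c, ContinuousOn (δ c) (chartAt ℂ c).target

lemma IsDensity.mul {δ : X → ℂ → ℝ} (h : IsDensity δ) {w : X → ℝ} (hw : Continuous w) :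
    IsDensity fun c z => w ((chartAt ℂ c).symm z) * δ c z where
  conformal c d p hc hd := by
    simp only [(chartAt ℂ c).left_inv hc, (chartAt ℂ d).left_inv hd]
    rw [h.conformal c d p hc hd]
    ring
  continuousOn c := (hw.comp_continuousOn (chartAt ℂ c).continuousOn_symm).mul (h.continuousOn c)

lemma IsDensity.const_mul {δ : X → ℂ → ℝ} (h : IsDensity δ) (r : ℝ) :
    IsDensity fun c z => r * δ c z := h.mul continuous_const

lemma IsDensity.sum {ι : Type*} (s : Finset ι) {δ : ι → X → ℂ → ℝ}
    (h : ∀ i ∈ s, IsDensity (δ i)) : IsDensity fun c z => ∑ i ∈ s, δ i c z where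
  conformal c d p hc hd := by
    rw [Finset.mul_sum]
    exact Finset.sum_congr rfl fun i hi => (h i hi).conformal c d p hc hd
  continuousOn c := continuousOn_finsetSum _ fun i hi => (h i hi).continuousOn c

/-- The integral of a density, computed with a partition of unity. -/
def surfInt (ρ : ChartPartition X) (δ : X → ℂ → ℝ) : ℝ :=
  ∑ᶠ c : X, ∫ z in (chartAt ℂ c).target, ρ.1 c ((chartAt ℂ c).symm z) * δ c z

lemma surfInt_congr (ρ : ChartPartition X) {δ ε : X → ℂ → ℝ}
    (h : ∀ c p : X, p ∈ (chartAt ℂ c).source → δ c (chartAt ℂ c p) = ε c (chartAt ℂ c p)) :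
    surfInt ρ δ = surfInt ρ ε := by
  refine finsum_congr fun c => setIntegral_congr_fun (chartAt ℂ c).open_target.measurableSet ?_
  intro z hz
  have := h c _ ((chartAt ℂ c).map_target hz)
  rw [(chartAt ℂ c).right_inv hz] at this
  simp only [this]

variable [CompactSpace X]

/-- A locally finite family of supports on a compact space has only finitely many nonempty members,
so `finsum` becomes a finite sum that commutes with integrals. -/
lemma ChartPartition.exists_finset (ρ : ChartPartition X) :
    ∃ S : Finset X, (∀ c ∉ S, ∀ y, ρ.1 c y = 0) ∧ ∀ y, ∑ c ∈ S, ρ.1 c y = 1 := by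
  have hf := ρ.1.locallyFinite.finite_nonempty_of_compact
  have h0 : ∀ c ∉ hf.toFinset, ∀ y, ρ.1 c y = 0 := by
    intro c hc y
    by_contra h
    exact hc (hf.mem_toFinset.2 ⟨y, h⟩)
  refine ⟨hf.toFinset, h0, fun y => ?_⟩
  rw [← ρ.1.sum_eq_one (Set.mem_univ y)]
  refine (finsum_eq_sum_of_support_subset _ fun c hc => ?_).symm
  by_contra h
  exact hc (h0 c h y)

lemma surfInt_eq_sum (ρ : ChartPartition X) {S : Finset X} (hS : ∀ c ∉ S, ∀ y, ρ.1 c y = 0)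
    (δ : X → ℂ → ℝ) : surfInt ρ δ =
      ∑ c ∈ S, ∫ z in (chartAt ℂ c).target, ρ.1 c ((chartAt ℂ c).symm z) * δ c z := by
  refine finsum_eq_sum_of_support_subset _ fun c hc => ?_
  by_contra h
  exact hc (by simp [hS c h])

/-- The coordinate domain need not have compact closure, so continuity alone does not suffice;
compact support inside the chart does. -/
lemma IsDensity.integrableOn {δ : X → ℂ → ℝ} (h : IsDensity δ) {c : X} {K : Set X}
    (hK : IsCompact K) (hKc : K ⊆ (chartAt ℂ c).source)
    (h0 : ∀ p ∈ (chartAt ℂ c).source, p ∉ K → δ c (chartAt ℂ c p) = 0) :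
    IntegrableOn (δ c) (chartAt ℂ c).target := by
  have hK' : IsCompact (chartAt ℂ c '' K) :=
    hK.image_of_continuousOn ((chartAt ℂ c).continuousOn.mono hKc)
  have hsub : chartAt ℂ c '' K ⊆ (chartAt ℂ c).target := by
    rintro _ ⟨p, hp, rfl⟩
    exact (chartAt ℂ c).map_source (hKc hp)
  refine IntegrableOn.of_forall_sdiff_eq_zero
    (((h.continuousOn c).mono hsub).integrableOn_compact hK')
    (chartAt ℂ c).open_target.measurableSet fun z hz => ?_
  have := h0 _ ((chartAt ℂ c).map_target hz.1) fun hzK => hz.2 ⟨_, hzK, (chartAt ℂ c).right_inv hz.1⟩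
  rwa [(chartAt ℂ c).right_inv hz.1] at this

lemma IsDensity.integrableOn_partition {δ : X → ℂ → ℝ} (h : IsDensity δ) (ρ : ChartPartition X)
    (c : X) : IntegrableOn (fun z => ρ.1 c ((chartAt ℂ c).symm z) * δ c z) (chartAt ℂ c).target := by
  refine (h.mul (ρ.1 c).contMDiff.continuous).integrableOn (c := c)
    (isClosed_tsupport (ρ.1 c)).isCompact (ρ.2 c) fun p hp hpK => ?_
  rw [(chartAt ℂ c).left_inv hp, image_eq_zero_of_notMem_tsupport hpK, zero_mul]

lemma surfInt_add (ρ : ChartPartition X) {δ ε : X → ℂ → ℝ} (h : IsDensity δ) (h' : IsDensity ε) :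
    surfInt ρ (fun c z => δ c z + ε c z) = surfInt ρ δ + surfInt ρ ε := by
  obtain ⟨S, hS, -⟩ := ρ.exists_finset
  simp only [surfInt_eq_sum ρ hS, ← Finset.sum_add_distrib, mul_add]
  exact Finset.sum_congr rfl fun c _ =>
    integral_add (h.integrableOn_partition ρ c) (h'.integrableOn_partition ρ c)

lemma surfInt_const_mul (ρ : ChartPartition X) (δ : X → ℂ → ℝ) (r : ℝ) :
    surfInt ρ (fun c z => r * δ c z) = r * surfInt ρ δ := by
  obtain ⟨S, hS, -⟩ := ρ.exists_finset
  simp only [surfInt_eq_sum ρ hS, Finset.mul_sum, ← integral_const_mul]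
  refine Finset.sum_congr rfl fun c _ => ?_
  congr 1; ext z; ring

lemma surfInt_sum (ρ : ChartPartition X) {ι : Type*} (s : Finset ι) {δ : ι → X → ℂ → ℝ}
    (h : ∀ i ∈ s, IsDensity (δ i)) :
    surfInt ρ (fun c z => ∑ i ∈ s, δ i c z) = ∑ i ∈ s, surfInt ρ (δ i) := by
  classical
  induction s using Finset.induction_on with
  | empty => simp [surfInt]
  | insert i s hi ih =>
    simp only [Finset.sum_insert hi]
    rw [surfInt_add ρ (h i (by simp)) (IsDensity.sum s fun j hj => h j (by simp [hj])),
      ih fun j hj => h j (by simp [hj])]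

/-- The integral of a density over the common domain of two charts. -/
lemma integral_chart_transfer (c d : X) {Fc Fd : ℂ → ℝ}
    (h : ∀ p ∈ (chartAt ℂ c).source, p ∈ (chartAt ℂ d).source → Fc (chartAt ℂ c p) =
      ‖deriv (fun z => chartAt ℂ d ((chartAt ℂ c).symm z)) (chartAt ℂ c p)‖ ^ 2 *
        Fd (chartAt ℂ d p))
    (hc : ∀ p ∈ (chartAt ℂ c).source, p ∉ (chartAt ℂ d).source → Fc (chartAt ℂ c p) = 0)
    (hd : ∀ p ∈ (chartAt ℂ d).source, p ∉ (chartAt ℂ c).source → Fd (chartAt ℂ d p) = 0) :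
    ∫ z in (chartAt ℂ c).target, Fc z = ∫ z in (chartAt ℂ d).target, Fd z := by
  set s := (chartAt ℂ c).target ∩ (chartAt ℂ c).symm ⁻¹' (chartAt ℂ d).source
  set t := (chartAt ℂ d).target ∩ (chartAt ℂ d).symm ⁻¹' (chartAt ℂ c).source
  have hs : IsOpen s := (chartAt ℂ c).isOpen_inter_preimage_symm (chartAt ℂ d).open_source
  have ht : IsOpen t := (chartAt ℂ d).isOpen_inter_preimage_symm (chartAt ℂ c).open_source
  have hst : (fun z => chartAt ℂ d ((chartAt ℂ c).symm z)) '' s = t := by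
    ext w
    constructor
    · rintro ⟨z, hz, rfl⟩
      refine ⟨(chartAt ℂ d).map_source hz.2, ?_⟩
      simp only [Set.mem_preimage, (chartAt ℂ d).left_inv hz.2]
      exact (chartAt ℂ c).map_target hz.1
    · intro hw
      refine ⟨chartAt ℂ c ((chartAt ℂ d).symm w), ⟨(chartAt ℂ c).map_source hw.2, ?_⟩, ?_⟩
      · simp only [Set.mem_preimage, (chartAt ℂ c).left_inv hw.2]
        exact (chartAt ℂ d).map_target hw.1
      · simp only [(chartAt ℂ c).left_inv hw.2, (chartAt ℂ d).right_inv hw.1]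
  have e1 : ∫ z in (chartAt ℂ c).target, Fc z = ∫ z in s, Fc z := by
    refine setIntegral_eq_of_subset_of_forall_sdiff_eq_zero
      (chartAt ℂ c).open_target.measurableSet Set.inter_subset_left fun z hz => ?_
    have := hc _ ((chartAt ℂ c).map_target hz.1) fun h' => hz.2 ⟨hz.1, h'⟩
    rwa [(chartAt ℂ c).right_inv hz.1] at this
  have e2 : ∫ z in (chartAt ℂ d).target, Fd z = ∫ z in t, Fd z := by
    refine setIntegral_eq_of_subset_of_forall_sdiff_eq_zero
      (chartAt ℂ d).open_target.measurableSet Set.inter_subset_left fun z hz => ?_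
    have := hd _ ((chartAt ℂ d).map_target hz.1) fun h' => hz.2 ⟨hz.1, h'⟩
    rwa [(chartAt ℂ d).right_inv hz.1] at this
  rw [e1, e2, ← hst, integral_image_holomorphic hs.measurableSet]
  · refine setIntegral_congr_fun hs.measurableSet fun z hz => ?_
    have := h _ ((chartAt ℂ c).map_target hz.1) hz.2
    rwa [(chartAt ℂ c).right_inv hz.1] at this
  · intro z hz
    have := analyticAt_chart_transition ((chartAt ℂ c).map_target hz.1) hz.2
    rw [(chartAt ℂ c).right_inv hz.1] at this
    exact this.differentiableAt
  · intro z hz w hw hzw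
    have h1 := (chartAt ℂ d).injOn hz.2 hw.2 hzw
    exact (chartAt ℂ c).symm.injOn hz.1 hw.1 h1

/-- The integral of a density supported in one coordinate domain. -/
lemma surfInt_eq_chart_integral (ρ : ChartPartition X) {δ : X → ℂ → ℝ} (h : IsDensity δ) {d : X}
    {K : Set X} (hK : IsCompact K) (hKd : K ⊆ (chartAt ℂ d).source)
    (h0 : ∀ c, ∀ p ∈ (chartAt ℂ c).source, p ∉ K → δ c (chartAt ℂ c p) = 0) :
    surfInt ρ δ = ∫ z in (chartAt ℂ d).target, δ d z := by
  obtain ⟨S, hS, hS1⟩ := ρ.exists_finset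
  have hρ : ∀ c, IsDensity fun d z => ρ.1 c ((chartAt ℂ d).symm z) * δ d z := fun c =>
    h.mul (ρ.1 c).contMDiff.continuous
  have h1 : ∀ c, ∫ z in (chartAt ℂ c).target, ρ.1 c ((chartAt ℂ c).symm z) * δ c z =
      ∫ z in (chartAt ℂ d).target, ρ.1 c ((chartAt ℂ d).symm z) * δ d z := by
    -- The weight `ρ c` confines the integrand to the chart at `c`, and `K` confines it to the chart
    -- at `d`. Both integrals thus live on the overlap.
    intro c
    refine integral_chart_transfer c d (fun p hpc hpd => (hρ c).conformal c d p hpc hpd)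
      (fun p hpc hpd => ?_) (fun p hpd hpc => ?_)
    · rw [h0 c p hpc fun hp => hpd (hKd hp), mul_zero]
    · rw [(chartAt ℂ d).left_inv hpd, image_eq_zero_of_notMem_tsupport fun hp => hpc (ρ.2 c hp),
        zero_mul]
  rw [surfInt_eq_sum ρ hS, Finset.sum_congr rfl fun c _ => h1 c, ← integral_finsetSum]
  · congr 1
    ext z
    rw [← Finset.sum_mul, hS1, one_mul]
  · intro c _
    refine (hρ c).integrableOn (c := d) hK hKd fun p hp hpK => ?_
    rw [h0 d p hp hpK, mul_zero]

lemma surfInt_eq_sum_mul (ρ σ : ChartPartition X) {δ : X → ℂ → ℝ} (h : IsDensity δ)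
    {S : Finset X} (hS1 : ∀ y, ∑ c ∈ S, σ.1 c y = 1) :
    surfInt ρ δ = ∑ d ∈ S, surfInt ρ fun c z => σ.1 d ((chartAt ℂ c).symm z) * δ c z := by
  rw [← surfInt_sum ρ S fun d _ => h.mul (σ.1 d).contMDiff.continuous]
  refine surfInt_congr ρ fun c p _ => ?_
  rw [← Finset.sum_mul, hS1, one_mul]

/-- The integral of a density does not depend on the partition of unity. -/
lemma surfInt_indep (ρ σ : ChartPartition X) {δ : X → ℂ → ℝ} (h : IsDensity δ) :
    surfInt ρ δ = surfInt σ δ := by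
  obtain ⟨S, hS, hS1⟩ := σ.exists_finset
  rw [surfInt_eq_sum_mul ρ σ h hS1, surfInt_eq_sum σ hS]
  refine Finset.sum_congr rfl fun d _ => ?_
  refine surfInt_eq_chart_integral ρ (h.mul (σ.1 d).contMDiff.continuous)
    (isClosed_tsupport (σ.1 d)).isCompact (σ.2 d) fun c p hp hpK => ?_
  rw [(chartAt ℂ c).left_inv hp, image_eq_zero_of_notMem_tsupport hpK, zero_mul]

end Surface

/-! ### Potentials and the residue formula -/

section Potentials

variable {X : Type*} [TopologicalSpace X] [ChartedSpace ℂ X] [IsManifold 𝓘(ℂ, ℂ) ω X]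

/-- A family of local potentials `u p`, smooth near `p`, with a common Laplacian. -/
def IsPotential (u : X → X → ℝ) : Prop :=
  ∀ p, ∀ᶠ y in 𝓝 p, ContMDiffAt 𝓘(ℝ, ℂ) 𝓘(ℝ, ℝ) ∞ (u p) y ∧
    ∀ c, y ∈ (chartAt ℂ c).source →
      chartLap c (u y) (chartAt ℂ c y) = chartLap c (u p) (chartAt ℂ c y)

lemma IsPotential.smooth {u : X → X → ℝ} (h : IsPotential u) (p : X) :
    ContMDiffAt 𝓘(ℝ, ℂ) 𝓘(ℝ, ℝ) ∞ (u p) p := (h p).self_of_nhds.1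

lemma IsPotential.add {u v : X → X → ℝ} (hu : IsPotential u) (hv : IsPotential v) :
    IsPotential fun p y => u p y + v p y := by
  intro p
  filter_upwards [hu p, hv p] with y hy1 hy2
  refine ⟨hy1.1.add hy2.1, fun c hc => ?_⟩
  rw [chartLap_add hc (hu.smooth y) (hv.smooth y), chartLap_add hc hy1.1 hy2.1, hy1.2 c hc,
    hy2.2 c hc]

lemma IsPotential.const_mul {u : X → X → ℝ} (hu : IsPotential u) (r : ℝ) :
    IsPotential fun p y => r * u p y := by
  intro p
  filter_upwards [hu p] with y hy1
  refine ⟨contMDiffAt_const.mul hy1.1, fun c hc => ?_⟩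
  rw [chartLap_const_mul hc r (hu.smooth y), chartLap_const_mul hc r hy1.1, hy1.2 c hc]

/-- The Laplacian of a family of local potentials. -/
def potentialDensity (u : X → X → ℝ) (c : X) (z : ℂ) : ℝ :=
  chartLap c (u ((chartAt ℂ c).symm z)) z

lemma potentialDensity_apply (u : X → X → ℝ) {c p : X} (hp : p ∈ (chartAt ℂ c).source) :
    potentialDensity u c (chartAt ℂ c p) = chartLap c (u p) (chartAt ℂ c p) := by
  rw [potentialDensity, (chartAt ℂ c).left_inv hp]

/-- Each point has its own potential, but near a given `p` all of them have the Laplacian of `u p`,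
which is continuous. -/
lemma IsPotential.isDensity {u : X → X → ℝ} (h : IsPotential u) :
    IsDensity (potentialDensity u) where
  conformal c d p hc hd := by
    rw [potentialDensity_apply u hc, potentialDensity_apply u hd]
    exact chartLap_transition hc hd (h.smooth p)
  continuousOn c := by
    intro z hz
    refine ContinuousAt.continuousWithinAt ?_
    obtain ⟨p, hp, rfl⟩ : ∃ p ∈ (chartAt ℂ c).source, chartAt ℂ c p = z :=
      ⟨_, (chartAt ℂ c).map_target hz, (chartAt ℂ c).right_inv hz⟩
    have h1 : ContinuousAt (chartLap c (u p)) (chartAt ℂ c p) :=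
      continuousAt_laplacian (((h.smooth p).contDiffAt_chart hp).of_le two_le_infty)
    refine h1.congr ?_
    have h2 := eventually_chart_symm hp (h p)
    filter_upwards [h2, (chartAt ℂ c).open_target.mem_nhds hz] with w hw hwt
    have := hw.2 c ((chartAt ℂ c).map_target hwt)
    rw [(chartAt ℂ c).right_inv hwt] at this
    exact this.symm

lemma isPotential_const {f : X → ℝ} (hf : ContMDiff 𝓘(ℝ, ℂ) 𝓘(ℝ, ℝ) ∞ f) :
    IsPotential fun _ => f :=
  fun _ => Filter.Eventually.of_forall fun y => ⟨hf y, fun _ _ => rfl⟩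

/-- Potentials that differ by the logarithm of the modulus of a holomorphic function. -/
lemma isPotential_of_log {u : X → X → ℝ}
    (h : ∀ p, ∀ᶠ y in 𝓝 p, ContMDiffAt 𝓘(ℝ, ℂ) 𝓘(ℝ, ℝ) ∞ (u p) y)
    (h' : ∀ p, ∀ᶠ y in 𝓝 p, ∃ a : X → ℂ, ContMDiffAt 𝓘(ℂ, ℂ) 𝓘(ℂ, ℂ) ω a y ∧ a y ≠ 0 ∧
      ∀ᶠ q in 𝓝 y, u p q = u y q + Real.log ‖a q‖) : IsPotential u := by
  intro p
  filter_upwards [h p, h' p] with y hys hy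
  refine ⟨hys, fun c hc => ?_⟩
  obtain ⟨a, ha, ha0, hu⟩ := hy
  rw [chartLap_congr hc hu, chartLap_add hc (h y).self_of_nhds (HolomorphicAt.smooth_log_norm ha ha0),
    chartLap_log_norm hc ha ha0, add_zero]

variable [CompactSpace X] [T2Space X]

/-- Extended by zero outside the chart, `f` becomes a compactly supported smooth function `g` on the
plane. -/
lemma integral_chartLap_eq_zero {f : X → ℝ} (hf : ContMDiff 𝓘(ℝ, ℂ) 𝓘(ℝ, ℝ) ∞ f) {d : X}
    {K : Set X} (hK : IsCompact K) (hKd : K ⊆ (chartAt ℂ d).source) (h0 : ∀ p ∉ K, f p = 0) :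
    ∫ z in (chartAt ℂ d).target, chartLap d f z = 0 := by
  classical
  set g : ℂ → ℝ := fun z => if z ∈ (chartAt ℂ d).target then f ((chartAt ℂ d).symm z) else 0
  have hK' : IsCompact (chartAt ℂ d '' K) :=
    hK.image_of_continuousOn ((chartAt ℂ d).continuousOn.mono hKd)
  have hg0 : ∀ z ∉ chartAt ℂ d '' K, g z = 0 := by
    intro z hz
    simp only [g]
    split_ifs with hzt
    · exact h0 _ fun h => hz ⟨_, h, (chartAt ℂ d).right_inv hzt⟩
    · rfl
  have hev : ∀ z ∈ (chartAt ℂ d).target, g =ᶠ[𝓝 z] fun z => f ((chartAt ℂ d).symm z) := by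
    intro z hz
    filter_upwards [(chartAt ℂ d).open_target.mem_nhds hz] with w hw
    simp [g, hw]
  have hg : ContDiff ℝ ∞ g := by
    rw [contDiff_iff_contDiffAt]
    intro z
    by_cases hz : z ∈ (chartAt ℂ d).target
    · refine ContDiffAt.congr_of_eventuallyEq ?_ (hev z hz)
      have := (hf ((chartAt ℂ d).symm z)).contDiffAt_chart ((chartAt ℂ d).map_target hz)
      rwa [(chartAt ℂ d).right_inv hz] at this
    · have hz' : z ∉ chartAt ℂ d '' K := by
        rintro ⟨p, hp, rfl⟩
        exact hz ((chartAt ℂ d).map_source (hKd hp))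
      refine (contDiffAt_const (c := (0 : ℝ))).congr_of_eventuallyEq ?_
      filter_upwards [hK'.isClosed.isOpen_compl.mem_nhds hz'] with w hw using hg0 w hw
  have hc : HasCompactSupport g := HasCompactSupport.intro hK' hg0
  have e : ∫ z in (chartAt ℂ d).target, chartLap d f z =
      ∫ z in (chartAt ℂ d).target, Laplacian.laplacian g z := by
    refine setIntegral_congr_fun (chartAt ℂ d).open_target.measurableSet fun z hz => ?_
    exact ((InnerProductSpace.laplacian_congr_nhds (hev z hz)).self_of_nhds).symm
  rw [e, setIntegral_eq_integral_of_forall_compl_eq_zero,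
    integral_laplacian_eq_zero (hg.of_le two_le_infty) hc]
  intro z hz
  have hz' : z ∉ chartAt ℂ d '' K := by
    rintro ⟨p, hp, rfl⟩
    exact hz ((chartAt ℂ d).map_source (hKd hp))
  have : g =ᶠ[𝓝 z] fun _ => 0 := by
    filter_upwards [hK'.isClosed.isOpen_compl.mem_nhds hz'] with w hw using hg0 w hw
  rw [(InnerProductSpace.laplacian_congr_nhds this).self_of_nhds]
  simp

/-- The Laplacian of a smooth function on a compact surface has integral zero. -/
lemma surfInt_smooth_eq_zero (ρ : ChartPartition X) {f : X → ℝ}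
    (hf : ContMDiff 𝓘(ℝ, ℂ) 𝓘(ℝ, ℝ) ∞ f) : surfInt ρ (potentialDensity fun _ => f) = 0 := by
  obtain ⟨S, hS, hS1⟩ := ρ.exists_finset
  have hs : ∀ d, ContMDiff 𝓘(ℝ, ℂ) 𝓘(ℝ, ℝ) ∞ (fun y => ρ.1 d y * f y) := fun d =>
    (ρ.1 d).contMDiff.mul hf
  -- Cutting `f` into the pieces `ρ d * f`, each supported in one chart, reduces to the planar
  -- statement.
  have h1 : surfInt ρ (potentialDensity fun _ => f) =
      surfInt ρ fun c z => ∑ d ∈ S, potentialDensity (fun _ y => ρ.1 d y * f y) c z := by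
    refine surfInt_congr ρ fun c p hp => ?_
    simp only [potentialDensity_apply _ hp]
    rw [← chartLap_sum S hp fun d _ => hs d p]
    simp only [← Finset.sum_mul, hS1, one_mul]
  rw [h1, surfInt_sum ρ S fun d _ => (isPotential_const (hs d)).isDensity]
  refine Finset.sum_eq_zero fun d _ => ?_
  have hK : IsCompact (tsupport (ρ.1 d)) := (isClosed_tsupport _).isCompact
  rw [surfInt_eq_chart_integral ρ (isPotential_const (hs d)).isDensity hK (ρ.2 d)]
  · exact integral_chartLap_eq_zero (hs d) hK (ρ.2 d) fun p hp => by
      rw [image_eq_zero_of_notMem_tsupport hp, zero_mul]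
  · intro c p hp hpK
    rw [potentialDensity_apply _ hp, chartLap_congr hp (g := fun _ => 0), chartLap_const]
    filter_upwards [(isClosed_tsupport (ρ.1 d)).isOpen_compl.mem_nhds hpK] with y hy
    rw [image_eq_zero_of_notMem_tsupport hy, zero_mul]

/-- A function supported near `t`, smooth outside `t`, with a logarithmic singularity at `t`. -/
lemma exists_log_singularity (ρ : ChartPartition X) (t : X) : ∃ g : X → ℝ,
    (∀ p ≠ t, ContMDiffAt 𝓘(ℝ, ℂ) 𝓘(ℝ, ℝ) ∞ g p) ∧
    (∀ᶠ y in 𝓝[≠] t, g y = Real.log ‖chartAt ℂ t y - chartAt ℂ t t‖) ∧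
    ∀ v : X → X → ℝ, (∀ p ≠ t, v p = g) → v t = (fun _ => 0) →
      IsPotential v ∧ surfInt ρ (potentialDensity v) = -(2 * Real.pi) := by
  classical
  have htt : t ∈ (chartAt ℂ t).source := mem_chart_source ℂ t
  obtain ⟨r, hr, hrt⟩ : ∃ r > 0, Metric.closedBall (chartAt ℂ t t) r ⊆ (chartAt ℂ t).target :=
    Metric.nhds_basis_closedBall.mem_iff.1
      ((chartAt ℂ t).open_target.mem_nhds ((chartAt ℂ t).map_source htt))
  set z₀ := chartAt ℂ t t
  set K : Set X := (chartAt ℂ t).symm '' Metric.closedBall z₀ r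
  have hK : IsCompact K := (isCompact_closedBall z₀ r).image_of_continuousOn
    ((chartAt ℂ t).continuousOn_symm.mono hrt)
  have hKt : K ⊆ (chartAt ℂ t).source := by
    rintro _ ⟨z, hz, rfl⟩
    exact (chartAt ℂ t).map_target (hrt hz)
  have htK : t ∈ K := ⟨z₀, Metric.mem_closedBall_self hr.le, (chartAt ℂ t).left_inv htt⟩
  set g : X → ℝ := fun y =>
    if y ∈ (chartAt ℂ t).source then cutLog r (chartAt ℂ t y - z₀) else 0
  have hg0 : ∀ y ∉ K, g y = 0 := by
    intro y hy
    simp only [g]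
    split_ifs with hys
    · refine cutLog_of_ge hr ?_
      by_contra hlt
      refine hy ⟨chartAt ℂ t y, ?_, (chartAt ℂ t).left_inv hys⟩
      rw [Metric.mem_closedBall, dist_eq_norm]
      exact (not_le.1 hlt).le
    · rfl
  have hg0' : ∀ y ∉ K, g =ᶠ[𝓝 y] fun _ => 0 := fun y hy => by
    filter_upwards [hK.isClosed.isOpen_compl.mem_nhds hy] with w hw using hg0 w hw
  have hgs : ∀ p ≠ t, ContMDiffAt 𝓘(ℝ, ℂ) 𝓘(ℝ, ℝ) ∞ g p := by
    intro p hp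
    by_cases hps : p ∈ (chartAt ℂ t).source
    · have h1 : ContDiffAt ℝ ∞ (fun z => cutLog r (z - z₀)) (chartAt ℂ t p) := by
        refine (contDiffAt_cutLog r ?_).comp (chartAt ℂ t p) (contDiffAt_id.sub contDiffAt_const)
        exact sub_ne_zero.2 fun h => hp ((chartAt ℂ t).injOn hps htt h)
      refine ((contMDiffAt_iff_contDiffAt.2 h1).comp p
        (contMDiffAt_chart_real hps)).congr_of_eventuallyEq ?_
      filter_upwards [(chartAt ℂ t).open_source.mem_nhds hps] with y hy
      simp [g, hy]
    · exact contMDiffAt_const.congr_of_eventuallyEq (hg0' p fun h => hps (hKt h))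
  have hglog : ∀ᶠ y in 𝓝[≠] t, g y = Real.log ‖chartAt ℂ t y - z₀‖ := by
    have h1 : Filter.Tendsto (fun y => chartAt ℂ t y - z₀) (𝓝[≠] t) (𝓝[≠] 0) := by
      refine tendsto_nhdsWithin_iff.2 ⟨?_, ?_⟩
      · have : ContinuousAt (fun y => chartAt ℂ t y - z₀) t :=
          ((chartAt ℂ t).continuousAt htt).sub continuousAt_const
        have h2 := this.tendsto
        rw [show chartAt ℂ t t - z₀ = 0 from sub_self _] at h2
        exact h2.mono_left nhdsWithin_le_nhds
      · filter_upwards [self_mem_nhdsWithin,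
          nhdsWithin_le_nhds ((chartAt ℂ t).open_source.mem_nhds htt)] with y hy hys
        exact sub_ne_zero.2 fun h => hy ((chartAt ℂ t).injOn hys htt h)
    filter_upwards [h1.eventually (cutLog_eventually r),
      nhdsWithin_le_nhds ((chartAt ℂ t).open_source.mem_nhds htt)] with y hy hys
    simp only [g, if_pos hys, hy]
  refine ⟨g, hgs, hglog, fun v hv hvt => ?_⟩
  -- Near `t` the potentials 0 and `g` differ by `log ‖z - z₀‖`, which is harmonic away from `t`;
  -- elsewhere they coincide.
  have hpot : IsPotential v := by
    intro p
    by_cases hp : p = t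
    · subst hp
      have h1 := eventually_eventually_nhdsWithin.2 hglog
      rw [eventually_nhdsWithin_iff] at h1
      filter_upwards [h1, (chartAt ℂ p).open_source.mem_nhds htt] with y hy hys
      refine ⟨hvt ▸ contMDiffAt_const, fun c hc => ?_⟩
      by_cases hyp : y = p
      · rw [hyp]
      have hy' := hy hyp
      rw [(isOpen_compl_singleton (x := p)).nhdsWithin_eq hyp] at hy'
      have ha : ContMDiffAt 𝓘(ℂ, ℂ) 𝓘(ℂ, ℂ) ω (fun q => chartAt ℂ p q - z₀) y :=
        ((contMDiffOn_chart (x := p)).contMDiffAt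
          ((chartAt ℂ p).open_source.mem_nhds hys)).sub contMDiffAt_const
      rw [hv y hyp, hvt, chartLap_const, chartLap_congr hc hy', chartLap_log_norm hc ha
        (sub_ne_zero.2 fun h => hyp ((chartAt ℂ p).injOn hys htt h))]
    · filter_upwards [isOpen_ne.mem_nhds hp] with y hy
      refine ⟨hv p hp ▸ hgs y hy, fun c _ => ?_⟩
      rw [hv p hp, hv y hy]
  refine ⟨hpot, ?_⟩
  rw [surfInt_eq_chart_integral ρ hpot.isDensity hK hKt]
  · have h1 : ∀ z ∈ (chartAt ℂ t).target, z ≠ z₀ → potentialDensity v t z =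
        Laplacian.laplacian (cutLog r) (z - z₀) := by
      intro z hz hz0
      obtain ⟨p, hp, rfl⟩ : ∃ p ∈ (chartAt ℂ t).source, chartAt ℂ t p = z :=
        ⟨_, (chartAt ℂ t).map_target hz, (chartAt ℂ t).right_inv hz⟩
      have hpt : p ≠ t := fun h => hz0 (by rw [h])
      have h2 := laplacian_comp_holomorphic (g := cutLog r) (φ := fun w => w - z₀)
        (z := chartAt ℂ t p) (by fun_prop)
        ((contDiffAt_cutLog r (sub_ne_zero.2 hz0)).of_le two_le_infty)
      simp only [deriv_sub_const, deriv_id'', norm_one, one_pow, one_mul] at h2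
      rw [potentialDensity_apply v hp, hv p hpt, ← h2]
      refine (InnerProductSpace.laplacian_congr_nhds ?_).self_of_nhds
      filter_upwards [(chartAt ℂ t).open_target.mem_nhds hz] with w hw
      simp only [g, if_pos ((chartAt ℂ t).map_target hw), (chartAt ℂ t).right_inv hw]
    have h2 : ∫ z in (chartAt ℂ t).target, potentialDensity v t z =
        ∫ z in (chartAt ℂ t).target, Laplacian.laplacian (cutLog r) (z - z₀) := by
      -- The two densities may disagree at `z₀`, a null set.
      refine setIntegral_congr_ae (chartAt ℂ t).open_target.measurableSet ?_
      have : ∀ᵐ z : ℂ, z ≠ z₀ := by simp [ae_iff]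
      filter_upwards [this] with z hz hzt using h1 z hzt hz
    rw [h2, setIntegral_eq_integral_of_forall_compl_eq_zero,
      integral_sub_right_eq_self (fun z => Laplacian.laplacian (cutLog r) z) z₀,
      integral_laplacian_cutLog]
    intro z hz
    have hz' : r < ‖z - z₀‖ := by
      by_contra hle
      exact hz (hrt (by rw [Metric.mem_closedBall, dist_eq_norm]; exact not_lt.1 hle))
    have : cutLog r =ᶠ[𝓝 (z - z₀)] fun _ => 0 := by
      filter_upwards [(isOpen_lt continuous_const continuous_norm).mem_nhds hz'] with w hw
      exact cutLog_of_ge hr (le_of_lt hw)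
    rw [(InnerProductSpace.laplacian_congr_nhds this).self_of_nhds]
    simp
  · intro c p hp hpK
    have hpt : p ≠ t := fun h => hpK (h ▸ htK)
    rw [potentialDensity_apply _ hp, hv p hpt, chartLap_congr hp (hg0' p hpK), chartLap_const]

/-- The residue formula: a potential which is globally defined up to logarithmic singularities. -/
theorem surfInt_potential_eq (ρ : ChartPartition X) {u : X → X → ℝ} (hu : IsPotential u)
    (f : X → ℝ) (T : Finset X) (m : X → ℝ)
    (h1 : ∀ p ∉ T, ∃ a : X → ℂ, ContMDiffAt 𝓘(ℂ, ℂ) 𝓘(ℂ, ℂ) ω a p ∧ a p ≠ 0 ∧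
      ∀ᶠ y in 𝓝 p, u p y = f y + Real.log ‖a y‖)
    (h2 : ∀ p ∈ T, ∃ a : X → ℂ, ContMDiffAt 𝓘(ℂ, ℂ) 𝓘(ℂ, ℂ) ω a p ∧ a p ≠ 0 ∧
      ∀ᶠ y in 𝓝[≠] p, u p y =
        f y + m p * Real.log ‖chartAt ℂ p y - chartAt ℂ p p‖ + Real.log ‖a y‖) :
    surfInt ρ (potentialDensity u) = 2 * Real.pi * ∑ p ∈ T, m p := by
  classical
  choose g hgs hglog hgv using fun t : X => exists_log_singularity ρ t
  set v : X → X → X → ℝ := fun t p => if p = t then fun _ => 0 else g t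
  -- Replacing `g t` by 0 at its own singular point gives an admissible family of potentials whose
  -- Laplacian has total integral -2π.
  have hv : ∀ t, IsPotential (v t) ∧ surfInt ρ (potentialDensity (v t)) = -(2 * Real.pi) :=
    fun t => hgv t (v t) (fun p hp => if_neg hp) (if_pos rfl)
  have hA : ∀ p, ∃ a : X → ℂ, ContMDiffAt 𝓘(ℂ, ℂ) 𝓘(ℂ, ℂ) ω a p ∧ a p ≠ 0 ∧
      (p ∉ T → ∀ᶠ y in 𝓝 p, u p y = f y + Real.log ‖a y‖) ∧
      (p ∈ T → ∀ᶠ y in 𝓝[≠] p, u p y =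
        f y + m p * Real.log ‖chartAt ℂ p y - chartAt ℂ p p‖ + Real.log ‖a y‖) := by
    intro p
    by_cases hp : p ∈ T
    · obtain ⟨a, ha, ha0, h⟩ := h2 p hp
      exact ⟨a, ha, ha0, fun h' => absurd hp h', fun _ => h⟩
    · obtain ⟨a, ha, ha0, h⟩ := h1 p hp
      exact ⟨a, ha, ha0, fun _ => h, fun h' => absurd h' hp⟩
  choose a ha ha0 haN haT using hA
  -- Off `T` this is `f + ∑ m t * g t`: the added terms cancel the logarithmic singularities of `f`.
  -- The diagonal expression also gives the correct values on `T`.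
  set G : X → ℝ := fun y => u y y - Real.log ‖a y y‖ + ∑ t ∈ T, m t * v t y y
  have hTfin : ∀ p, ∀ᶠ y in 𝓝[≠] p, y ∉ T := by
    intro p
    have : IsOpen ((T.erase p : Finset X) : Set X)ᶜ := (Finset.finite_toSet _).isClosed.isOpen_compl
    filter_upwards [self_mem_nhdsWithin, nhdsWithin_le_nhds (this.mem_nhds (x := p) (by simp))]
      with y hy hy' hyT
    exact hy' (by simp [hyT]; exact hy)
  -- near `p`, `G` coincides with a local expression
  have hG : ∀ p, G =ᶠ[𝓝 p] fun y => u p y + -1 * Real.log ‖a p y‖ + ∑ t ∈ T, m t * v t p y := by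
    intro p
    by_cases hp : p ∈ T
    · have key : ∀ᶠ y in 𝓝[≠] p, G y =
          u p y + -1 * Real.log ‖a p y‖ + ∑ t ∈ T, m t * v t p y := by
        filter_upwards [self_mem_nhdsWithin, hTfin p, haT p hp, hglog p] with y hyp hyT hy hgy
        have e1 : u y y - Real.log ‖a y y‖ = f y := by
          rw [(haN y hyT).self_of_nhds]; ring
        have e2 : ∑ t ∈ T, m t * v t y y = m p * g p y + ∑ t ∈ T, m t * v t p y := by
          rw [← Finset.add_sum_erase T _ hp, ← Finset.add_sum_erase T (fun t => m t * v t p y) hp]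
          have : v p p y = 0 := by simp [v]
          rw [this, mul_zero, zero_add]
          congr 1
          · simp only [v, if_neg (show y ≠ p from hyp)]
          · refine Finset.sum_congr rfl fun t ht => ?_
            have h3 : y ≠ t := fun h => hyT (h ▸ (Finset.mem_of_mem_erase ht))
            have h4 : p ≠ t := (Finset.ne_of_mem_erase ht).symm
            simp only [v, if_neg h3, if_neg h4]
        simp only [G]
        rw [e1, e2, hy, hgy]
        ring
      rw [eventually_nhdsWithin_iff] at key
      filter_upwards [key] with y hy
      by_cases hyp : y = p
      · rw [hyp]; simp only [G]; ring
      · exact hy hyp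
    · have hT' : ∀ᶠ y in 𝓝 p, y ∉ T :=
        (Finset.finite_toSet T).isClosed.isOpen_compl.mem_nhds (by simpa using hp)
      filter_upwards [hT', haN p hp] with y hyT hy
      have e1 : u y y - Real.log ‖a y y‖ = f y := by
        rw [(haN y hyT).self_of_nhds]; ring
      simp only [G]
      rw [e1, hy]
      have : ∑ t ∈ T, m t * v t y y = ∑ t ∈ T, m t * v t p y := by
        refine Finset.sum_congr rfl fun t ht => ?_
        have h3 : y ≠ t := fun h => hyT (h ▸ ht)
        have h4 : p ≠ t := fun h => hp (h ▸ ht)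
        simp only [v, if_neg h3, if_neg h4]
      rw [this]
      ring
  have hs1 : ∀ p, ContMDiffAt 𝓘(ℝ, ℂ) 𝓘(ℝ, ℝ) ∞ (fun y => Real.log ‖a p y‖) p := fun p =>
    HolomorphicAt.smooth_log_norm (ha p) (ha0 p)
  have hs2 : ∀ p, ContMDiffAt 𝓘(ℝ, ℂ) 𝓘(ℝ, ℝ) ∞ (fun y => -1 * Real.log ‖a p y‖) p := fun p =>
    contMDiffAt_const.mul (hs1 p)
  have hs3 : ∀ p t, ContMDiffAt 𝓘(ℝ, ℂ) 𝓘(ℝ, ℝ) ∞ (fun y => m t * v t p y) p := fun p t =>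
    contMDiffAt_const.mul ((hv t).1.smooth p)
  have hs4 : ∀ p, ContMDiffAt 𝓘(ℝ, ℂ) 𝓘(ℝ, ℝ) ∞ (fun y => ∑ t ∈ T, m t * v t p y) p := fun p =>
    contMDiffAt_finsetSum fun t _ => hs3 p t
  have hs5 : ∀ p, ContMDiffAt 𝓘(ℝ, ℂ) 𝓘(ℝ, ℝ) ∞ (fun y => u p y + -1 * Real.log ‖a p y‖) p :=
    fun p => (hu.smooth p).add (hs2 p)
  have hGs : ContMDiff 𝓘(ℝ, ℂ) 𝓘(ℝ, ℝ) ∞ G := fun p =>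
    ((hs5 p).add (hs4 p)).congr_of_eventuallyEq (hG p)
  -- The Laplacian of `G` is that of `u` plus those of the `m t * v t`, since the terms `log ‖a p‖`
  -- are harmonic. Its vanishing integral is the claim.
  have h0 := surfInt_smooth_eq_zero ρ hGs
  have hdens : surfInt ρ (potentialDensity fun _ => G) = surfInt ρ fun c z =>
      potentialDensity u c z + ∑ t ∈ T, m t * potentialDensity (v t) c z := by
    refine surfInt_congr ρ fun c p hp => ?_
    simp only [potentialDensity_apply _ hp]
    rw [chartLap_congr hp (hG p), chartLap_add hp (hs5 p) (hs4 p),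
      chartLap_add hp (hu.smooth p) (hs2 p), chartLap_const_mul hp _ (hs1 p),
      chartLap_log_norm hp (ha p) (ha0 p), chartLap_sum T hp fun t _ => hs3 p t]
    simp only [chartLap_const_mul hp _ ((hv _).1.smooth p)]
    ring
  have hd : ∀ t ∈ T, IsDensity fun c z => m t * potentialDensity (v t) c z := fun t _ =>
    (hv t).1.isDensity.const_mul _
  rw [hdens, surfInt_add ρ hu.isDensity (IsDensity.sum T hd), surfInt_sum ρ T hd] at h0
  simp only [surfInt_const_mul, (hv _).2] at h0
  rw [← Finset.sum_mul] at h0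
  linarith

lemma surfInt_potential_add (ρ : ChartPartition X) {u v : X → X → ℝ} (hu : IsPotential u)
    (hv : IsPotential v) : surfInt ρ (potentialDensity fun p y => u p y + v p y) =
      surfInt ρ (potentialDensity u) + surfInt ρ (potentialDensity v) := by
  rw [← surfInt_add ρ hu.isDensity hv.isDensity]
  refine surfInt_congr ρ fun c p hp => ?_
  simp only [potentialDensity_apply _ hp]
  exact chartLap_add hp (hu.smooth p) (hv.smooth p)

lemma surfInt_potential_const_mul (ρ : ChartPartition X) {u : X → X → ℝ} (hu : IsPotential u)
    (r : ℝ) : surfInt ρ (potentialDensity fun p y => r * u p y) =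
      r * surfInt ρ (potentialDensity u) := by
  rw [← surfInt_const_mul ρ]
  refine surfInt_congr ρ fun c p hp => ?_
  simp only [potentialDensity_apply _ hp]
  exact chartLap_const_mul hp r (hu.smooth p)

end Potentials

/-! ### Holomorphic sections and frames -/

/-- The function `a` is holomorphic near `p`. -/
abbrev HolFunAt {X : Type*} [TopologicalSpace X] [ChartedSpace ℂ X] (a : X → ℂ) (p : X) : Prop :=
  ContMDiffAt 𝓘(ℂ, ℂ) 𝓘(ℂ, ℂ) ω a p

/-- Gram determinants are products of complex-valued functions that are smooth only over `ℝ`, so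
multiplication on `ℂ` is needed as a real smooth operation. -/
instance contMDiffMul_complex_real : ContMDiffMul 𝓘(ℝ, ℂ) ∞ ℂ where
  contMDiff_mul := by
    rw [contMDiff_iff]
    refine ⟨continuous_mul, fun x y => ?_⟩
    simp only [mfld_simps, chartAt_self_eq]
    rw [contDiffOn_univ]
    exact contDiff_mul

section Frames

variable {X : Type*} [TopologicalSpace X] [ChartedSpace ℂ X] [IsManifold 𝓘(ℂ, ℂ) ω X]
variable (F : Type*) [NormedAddCommGroup F] [NormedSpace ℂ F] [FiniteDimensional ℂ F]
variable {E : X → Type*} [∀ x, AddCommGroup (E x)] [∀ x, Module ℂ (E x)]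
variable [TopologicalSpace (TotalSpace F E)] [∀ x, TopologicalSpace (E x)] [FiberBundle F E]
  [VectorBundle ℂ F E] [ContMDiffVectorBundle ω F E 𝓘(ℂ, ℂ)]

variable (E) in
/-- Fibre coordinates in the trivialization at `p`. -/
def fiberCoord (p y : X) : E y →ₗ[ℂ] F := (trivializationAt F E p).linearMapAt ℂ y

variable {F}

lemma holAt_iff {s : ∀ y, E y} {p q : X} (hq : q ∈ (trivializationAt F E p).baseSet) :
    HolAt F s q ↔ ContMDiffAt 𝓘(ℂ, ℂ) 𝓘(ℂ, F) ω (fun y => fiberCoord F E p y (s y)) q := by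
  rw [HolAt, (trivializationAt F E p).contMDiffAt_section_iff hq]
  refine Filter.EventuallyEq.contMDiffAt_iff ?_
  filter_upwards [(trivializationAt F E p).open_baseSet.mem_nhds hq] with y hy
  simp [fiberCoord, hy]

lemma fiberCoord_injective {p y : X} (hy : y ∈ (trivializationAt F E p).baseSet) :
    Function.Injective (fiberCoord F E p y) := by
  intro v w h
  simp only [fiberCoord, Trivialization.coe_linearMapAt_of_mem _ hy] at h
  exact ((trivializationAt F E p).linearEquivAt ℂ y hy).injective h

lemma HolAt.eventually {s : ∀ y, E y} {p : X} (h : HolAt F s p) : ∀ᶠ q in 𝓝 p, HolAt F s q := by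
  have hp := FiberBundle.mem_baseSet_trivializationAt' (F := F) (E := E) p
  have h1 := (contMDiffAt_iff_contMDiffAt_nhds (by simp)).1 ((holAt_iff hp).1 h)
  filter_upwards [h1, (trivializationAt F E p).open_baseSet.mem_nhds hp] with q hq hqb
  exact (holAt_iff hqb).2 hq

lemma HolFunAt.div {a b : X → ℂ} {p : X} (ha : HolFunAt a p) (hb : HolFunAt b p) (h0 : b p ≠ 0) :
    HolFunAt (fun y => a y / b y) p := ContMDiffAt.div₀ ha hb h0

lemma HolAt.clm {s : ∀ y, E y} {p q : X} (hq : q ∈ (trivializationAt F E p).baseSet)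
    (h : HolAt F s q) (ℓ : F →ₗ[ℂ] ℂ) : HolFunAt (fun y => ℓ (fiberCoord F E p y (s y))) q :=
  (LinearMap.toContinuousLinearMap ℓ).contDiff.contMDiff.contMDiffAt.comp q ((holAt_iff hq).1 h)

lemma HolAt.smul {s : ∀ y, E y} {p : X} {a : X → ℂ} (ha : HolFunAt a p) (h : HolAt F s p) :
    HolAt F (fun y => a y • s y) p := by
  have hp := FiberBundle.mem_baseSet_trivializationAt' (F := F) (E := E) p
  rw [holAt_iff hp] at h ⊢
  simp only [map_smul]
  exact ContMDiffAt.smul ha h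

variable (F) in
/-- Holomorphic fibrewise linear functionals, dual at `p` to given independent vectors. -/
lemma exists_dual_functionals {p : X} {k : ℕ} {v : Fin k → E p} (hv : LinearIndependent ℂ v) :
    ∃ l : Fin k → ∀ y, E y →ₗ[ℂ] ℂ,
      (∀ᶠ q in 𝓝 p, ∀ s, HolAt F s q → ∀ j, HolFunAt (fun y => l j y (s y)) q) ∧
      ∀ i j, l j p (v i) = if i = j then 1 else 0 := by
  have hp := FiberBundle.mem_baseSet_trivializationAt' (F := F) (E := E) p
  have hc : LinearIndependent ℂ (fun i => fiberCoord F E p p (v i)) :=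
    hv.map' _ (LinearMap.ker_eq_bot.2 (fiberCoord_injective hp))
  obtain ⟨g, hg⟩ := (Fintype.linearCombination ℂ fun i => fiberCoord F E p p
    (v i)).exists_leftInverse_of_injective
      (LinearMap.ker_eq_bot.2 (linearIndependent_iff_injective_fintypeLinearCombination.1 hc))
  refine ⟨fun j y => ((LinearMap.proj j).comp g).comp (fiberCoord F E p y), ?_, fun i j => ?_⟩
  · filter_upwards [(trivializationAt F E p).open_baseSet.mem_nhds hp] with q hq s hs j
    exact hs.clm hq ((LinearMap.proj j).comp g)
  · have := congrArg (fun f => f (Pi.single i 1) j) hg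
    simp only [LinearMap.comp_apply, Fintype.linearCombination_apply_single, one_smul,
      LinearMap.id_apply] at this
    simp only [LinearMap.comp_apply, LinearMap.proj_apply, this, Pi.single_apply, eq_comm]

lemma HolFunAt.det {k : ℕ} {M : X → Matrix (Fin k) (Fin k) ℂ} {p : X}
    (h : ∀ i j, HolFunAt (fun y => M y i j) p) : HolFunAt (fun y => (M y).det) p := by
  simp only [Matrix.det_apply']
  exact contMDiffAt_finsetSum fun σ _ =>
    contMDiffAt_const.mul (contMDiffAt_finsetProd fun i _ => h _ _)

lemma IsLocalFrame.eventually {S : ∀ y, Submodule ℂ (E y)} {p : X} {k : ℕ}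
    {s : Fin k → ∀ y, E y} (h : IsLocalFrame F S p s) :
    ∀ᶠ q in 𝓝 p, IsLocalFrame F S q s := by
  filter_upwards [Filter.eventually_all.2 fun i => (h.1 i).eventually,
    eventually_eventually_nhds.2 h.2] with q h1 h2
  exact ⟨h1, h2⟩

lemma IsLocalFrame.rank_eq {S : ∀ y, Submodule ℂ (E y)} {p : X} {k : ℕ}
    {s : Fin k → ∀ y, E y} (h : IsLocalFrame F S p s) : Module.finrank ℂ (S p) = k := by
  obtain ⟨h1, h2⟩ := h.2.self_of_nhds
  rw [← h2, finrank_span_eq_card h1, Fintype.card_fin]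

lemma IsHolSubbundle.rank_eq {S : ∀ y, Submodule ℂ (E y)} {k : ℕ} (h : IsHolSubbundle F S k)
    (p : X) : Module.finrank ℂ (S p) = k := by
  obtain ⟨s, hs⟩ := h p
  exact hs.rank_eq

open scoped ComplexOrder in
lemma gramDet_pos (h : HermitianMetric F E) {k : ℕ} {s : Fin k → ∀ y, E y} {y : X}
    (hs : LinearIndependent ℂ fun i => s i y) : 0 < gramDet F h s y := by
  have hP : (Matrix.of fun i j => h.form y (s i y) (s j y)).PosDef := by
    refine Matrix.PosDef.of_dotProduct_mulVec_pos ?_ fun x hx => ?_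
    · ext i j
      simp only [Matrix.conjTranspose_apply, Matrix.of_apply]
      exact (h.symm y (s i y) (s j y)).symm
    · have hne : ∑ i, x i • s i y ≠ 0 := fun h0 =>
        hx (funext fun i => Fintype.linearIndependent_iff.1 hs x h0 i)
      have e : star x ⬝ᵥ (Matrix.of fun i j => h.form y (s i y) (s j y)).mulVec x =
          h.form y (∑ i, x i • s i y) (∑ i, x i • s i y) := by
        simp only [dotProduct, Matrix.mulVec, map_sum, LinearMap.sum_apply, map_smulₛₗ,
          LinearMap.smul_apply, Matrix.of_apply, Pi.star_apply, smul_eq_mul, RCLike.star_def,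
          Finset.mul_sum]
        rw [Finset.sum_comm]
        refine Finset.sum_congr rfl fun i _ => Finset.sum_congr rfl fun j _ => ?_
        simp only [RingHom.id_apply]
        ring
      rw [e]
      have him : (h.form y (∑ i, x i • s i y) (∑ i, x i • s i y)).im = 0 :=
        Complex.conj_eq_iff_im.1 (h.symm y _ _).symm
      rw [Complex.lt_def]
      exact ⟨h.pos y _ hne, him.symm⟩
  have := hP.det_pos
  rw [Complex.lt_def] at this
  exact this.1

lemma gramDet_smooth (h : HermitianMetric F E) {k : ℕ} {s : Fin k → ∀ y, E y} {p : X}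
    (hs : ∀ i, HolAt F (s i) p) : ContMDiffAt 𝓘(ℝ, ℂ) 𝓘(ℝ, ℝ) ∞ (gramDet F h s) p := by
  have h1 : ContMDiffAt 𝓘(ℝ, ℂ) 𝓘(ℝ, ℂ) ∞
      (fun y => (Matrix.of fun i j => h.form y (s i y) (s j y)).det) p := by
    simp only [Matrix.det_apply']
    exact contMDiffAt_finsetSum fun σ _ => contMDiffAt_const.mul
      (contMDiffAt_finsetProd fun i _ => h.smooth p _ _ (hs _) (hs _))
  exact Complex.reCLM.contDiff.contMDiff.contMDiffAt.comp p h1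

lemma log_gramDet_smooth (h : HermitianMetric F E) {S : ∀ y, Submodule ℂ (E y)} {k : ℕ}
    {s : Fin k → ∀ y, E y} {p : X} (hs : IsLocalFrame F S p s) :
    ContMDiffAt 𝓘(ℝ, ℂ) 𝓘(ℝ, ℝ) ∞ (fun y => Real.log (gramDet F h s y)) p :=
  (Real.contDiffAt_log.2 (gramDet_pos h hs.2.self_of_nhds.1).ne').contMDiffAt.comp p
    (gramDet_smooth h hs.1)

/-- The Gram determinants of two frames differ by the square modulus of a holomorphic function. -/
lemma IsLocalFrame.exists_log_gramDet_eq (h : HermitianMetric F E) {S : ∀ y, Submodule ℂ (E y)}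
    {p : X} {k k' : ℕ} {s : Fin k → ∀ y, E y} {s' : Fin k' → ∀ y, E y}
    (hs : IsLocalFrame F S p s) (hs' : IsLocalFrame F S p s') :
    ∃ a : X → ℂ, HolFunAt a p ∧ a p ≠ 0 ∧
      ∀ᶠ y in 𝓝 p, Real.log (gramDet F h s' y) = Real.log (gramDet F h s y) + Real.log ‖a y‖ := by
  obtain rfl : k = k' := hs.rank_eq.symm.trans hs'.rank_eq
  obtain ⟨l, hl, hd⟩ := exists_dual_functionals F hs.2.self_of_nhds.1
  have hl := hl.self_of_nhds
  set M : X → Matrix (Fin k) (Fin k) ℂ := fun y => Matrix.of fun i j => l j y (s i y)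
  set M' : X → Matrix (Fin k) (Fin k) ℂ := fun y => Matrix.of fun i j => l j y (s' i y)
  have hM : HolFunAt (fun y => (M y).det) p := HolFunAt.det fun i j => hl _ (hs.1 i) j
  have hM' : HolFunAt (fun y => (M' y).det) p := HolFunAt.det fun i j => hl _ (hs'.1 i) j
  have hMp : (M p).det ≠ 0 := by
    have : M p = 1 := by
      ext i j
      simp only [M, Matrix.of_apply, hd, Matrix.one_apply]
    simp [this]
  have ha := hM'.div hM hMp
  -- the relation between the Gram determinants
  have key : ∀ᶠ y in 𝓝 p, gramDet F h s' y = ‖(M' y).det / (M y).det‖ ^ 2 * gramDet F h s y := by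
    filter_upwards [hs.2, hs'.2, hM.continuousAt.eventually_ne hMp] with y h1 h2 h3
    have hmem : ∀ i, ∃ g : Fin k → ℂ, ∑ j, g j • s j y = s' i y := fun i => by
      have : s' i y ∈ Submodule.span ℂ (Set.range fun i => s i y) := by
        rw [h1.2, ← h2.2]
        exact Submodule.subset_span ⟨i, rfl⟩
      exact Submodule.mem_span_range_iff_exists_fun ℂ |>.1 this
    choose g hg using hmem
    have e1 : M' y = Matrix.of g * M y := by
      ext i j
      simp only [M, M', Matrix.mul_apply, Matrix.of_apply, ← hg i, map_sum, map_smul, smul_eq_mul]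
    have e2 : (Matrix.of fun i j => h.form y (s' i y) (s' j y)) =
        (Matrix.of g).map conj * (Matrix.of fun i j => h.form y (s i y) (s j y)) *
          (Matrix.of g).transpose := by
      ext i j
      simp only [Matrix.mul_apply, Matrix.of_apply, ← hg, map_sum, LinearMap.sum_apply, map_smulₛₗ,
        LinearMap.smul_apply, smul_eq_mul, Matrix.map_apply, Matrix.transpose_apply,
        Finset.sum_mul, RingHom.id_apply]
      refine Finset.sum_congr rfl fun a _ => ?_
      rw [Finset.mul_sum]
      refine Finset.sum_congr rfl fun b _ => ?_
      ring
    have e3 : (M' y).det / (M y).det = (Matrix.of g).det := by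
      rw [e1, Matrix.det_mul, mul_div_cancel_right₀ _ h3]
    have e4 : ((Matrix.of g).map conj).det = conj (Matrix.of g).det := by
      rw [RingHom.map_det]; rfl
    rw [gramDet, gramDet, e2, e3, Matrix.det_mul, Matrix.det_mul, Matrix.det_transpose, e4]
    rw [mul_right_comm, ← Complex.normSq_eq_conj_mul_self, Complex.re_ofReal_mul,
      Complex.normSq_eq_norm_sq]
  have hap : (M' p).det / (M p).det ≠ 0 := by
    intro h0
    have h1 := key.self_of_nhds
    rw [h0, norm_zero] at h1
    have h2 := gramDet_pos h hs'.2.self_of_nhds.1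
    rw [h1] at h2
    simp at h2
  -- The square absorbs the exponent in `‖det g‖ ^ 2`.
  refine ⟨fun y => ((M' y).det / (M y).det) ^ 2, ha.pow 2, pow_ne_zero 2 hap, ?_⟩
  filter_upwards [key, ha.continuousAt.eventually_ne hap, hs.2] with y hy hy0 hy1
  rw [hy, norm_pow, Real.log_mul (by simpa using hy0) (gramDet_pos h hy1.1).ne', add_comm]

/-- The local potentials of the first Chern form in a family of local frames. -/
def gramPotential (h : HermitianMetric F E) {k : ℕ} (s : X → Fin k → ∀ y, E y) (p y : X) : ℝ :=
  Real.log (gramDet F h (s p) y)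

/-- A frame at `p` and a frame at a nearby `y` give Gram logarithms that differ by a harmonic `log
‖a‖`. -/
lemma isPotential_gramPotential (h : HermitianMetric F E) {S : ∀ y, Submodule ℂ (E y)} {k : ℕ}
    {s : X → Fin k → ∀ y, E y} (hs : ∀ p, IsLocalFrame F S p (s p)) :
    IsPotential (gramPotential h s) := by
  refine isPotential_of_log
    (fun p => (hs p).eventually.mono fun y hy => log_gramDet_smooth h hy) fun p => ?_
  filter_upwards [(hs p).eventually] with y hy
  exact (hs y).exists_log_gramDet_eq h hy

variable (F) in
lemma someLocalFrame_isLocalFrame {S : ∀ y, Submodule ℂ (E y)} {p : X} {k : ℕ}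
    {s : Fin k → ∀ y, E y} (hs : IsLocalFrame F S p s) :
    IsLocalFrame F S p (someLocalFrame F S p).2 := by
  have H : ∃ q : Σ k : ℕ, Fin k → ∀ y, E y, IsLocalFrame F S p q.2 := ⟨⟨k, s⟩, hs⟩
  rw [someLocalFrame, dif_pos H]
  exact H.choose_spec

/-- The Chern density uses an arbitrarily chosen frame at each point. Any other family of frames has
the same Laplacians, so it can be replaced by frames suited to the computation. -/
lemma chernNumber_eq_surfInt (h : HermitianMetric F E) (ρ : ChartPartition X)
    {S : ∀ y, Submodule ℂ (E y)} {k : ℕ} {s : X → Fin k → ∀ y, E y}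
    (hs : ∀ p, IsLocalFrame F S p (s p)) :
    chernNumber F h ρ S =
      -(1 / (4 * Real.pi)) * surfInt ρ (potentialDensity (gramPotential h s)) := by
  rw [surfInt, ← smul_eq_mul, smul_finsum, chernNumber]
  refine finsum_congr fun c => ?_
  rw [smul_eq_mul, ← integral_const_mul]
  refine setIntegral_congr_fun (chartAt ℂ c).open_target.measurableSet fun z hz => ?_
  obtain ⟨p, hp, rfl⟩ : ∃ p ∈ (chartAt ℂ c).source, chartAt ℂ c p = z :=
    ⟨_, (chartAt ℂ c).map_target hz, (chartAt ℂ c).right_inv hz⟩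
  obtain ⟨a, ha, ha0, hev⟩ := (hs p).exists_log_gramDet_eq h (someLocalFrame_isLocalFrame F (hs p))
  have : chernDensity F h S c (chartAt ℂ c p) = -(1 / (4 * Real.pi)) *
      chartLap c (gramPotential h s p) (chartAt ℂ c p) := by
    rw [chernDensity, (chartAt ℂ c).left_inv hp]
    congr 1
    have e := chartLap_congr hp hev
    rw [chartLap_add hp (log_gramDet_smooth h (hs p)) (HolomorphicAt.smooth_log_norm ha ha0),
      chartLap_log_norm hp ha ha0, add_zero] at e
    exact e
  simp only [this, potentialDensity_apply _ hp]
  ring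

end Frames

/-! ### Existence of metrics, and the degree -/

section Existence

variable {X : Type*} [TopologicalSpace X] [ChartedSpace ℂ X] [IsManifold 𝓘(ℂ, ℂ) ω X]
  [CompactSpace X] [T2Space X]

variable (X) in
lemma nonempty_chartPartition : Nonempty (ChartPartition X) := by
  obtain ⟨ρ, hρ⟩ := SmoothPartitionOfUnity.exists_isSubordinate_chartAt_source 𝓘(ℝ, ℂ) X
  exact ⟨⟨ρ, hρ⟩⟩

variable (F : Type*) [NormedAddCommGroup F] [NormedSpace ℂ F] [FiniteDimensional ℂ F]
variable (E : X → Type*) [∀ x, AddCommGroup (E x)] [∀ x, Module ℂ (E x)]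
variable [TopologicalSpace (TotalSpace F E)] [∀ x, TopologicalSpace (E x)] [FiberBundle F E]
  [VectorBundle ℂ F E] [ContMDiffVectorBundle ω F E 𝓘(ℂ, ℂ)]

/-- Standard metrics in local trivializations are glued by a partition of unity. A convex
combination of positive semidefinite forms, one of them definite with positive weight, is definite.
-/
lemma nonempty_hermitianMetric : Nonempty (HermitianMetric F E) := by
  classical
  obtain ⟨ρ, hρ⟩ := SmoothPartitionOfUnity.exists_isSubordinate 𝓘(ℝ, ℂ) (M := X) (s := Set.univ)
    isClosed_univ (fun c : X => (trivializationAt F E c).baseSet)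
    (fun c => (trivializationAt F E c).open_baseSet)
    (fun x _ => Set.mem_iUnion.2 ⟨x, FiberBundle.mem_baseSet_trivializationAt' x⟩)
  have hf := ρ.locallyFinite.finite_nonempty_of_compact
  set S := hf.toFinset
  have hS : ∀ c x, ρ c x ≠ 0 → c ∈ S := fun c x h => hf.mem_toFinset.2 ⟨x, h⟩
  set n := Module.finrank ℂ F
  let L : F ≃ₗ[ℂ] (Fin n → ℂ) := (Module.finBasis ℂ F).equivFun
  let co : ∀ c x, Fin n → E x →ₗ[ℂ] ℂ := fun c x i =>
    ((LinearMap.proj i).comp L.toLinearMap).comp (fiberCoord F E c x)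
  let B : ∀ x, E x → E x → ℂ := fun x v w =>
    ∑ c ∈ S, (ρ c x : ℂ) * ∑ i, conj (co c x i v) * co c x i w
  have hBv : ∀ x v, B x v v = ((∑ c ∈ S, ρ c x * ∑ i, ‖co c x i v‖ ^ 2 : ℝ) : ℂ) := by
    intro x v
    simp only [B, Complex.ofReal_sum, Complex.ofReal_mul]
    refine Finset.sum_congr rfl fun c _ => ?_
    congr 1
    refine Finset.sum_congr rfl fun i _ => ?_
    rw [← Complex.normSq_eq_conj_mul_self, Complex.normSq_eq_norm_sq]
  refine ⟨{
    form := fun x => LinearMap.mk₂'ₛₗ (starRingEnd ℂ) (RingHom.id ℂ) (B x) ?_ ?_ ?_ ?_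
    symm := ?_
    pos := ?_
    smooth := ?_ }⟩
  · intro v v' w
    simp only [B, map_add, add_mul, Finset.sum_add_distrib, mul_add]
  · intro r v w
    simp only [B, map_smul, smul_eq_mul, map_mul, Finset.mul_sum]
    refine Finset.sum_congr rfl fun c _ => Finset.sum_congr rfl fun i _ => ?_
    ring
  · intro v w w'
    simp only [B, map_add, Finset.sum_add_distrib, mul_add]
  · intro r v w
    simp only [B, map_smul, smul_eq_mul, Finset.mul_sum, RingHom.id_apply]
    refine Finset.sum_congr rfl fun c _ => Finset.sum_congr rfl fun i _ => ?_
    ring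
  · intro x v w
    simp only [LinearMap.mk₂'ₛₗ_apply, B, map_sum, map_mul, Complex.conj_ofReal, Complex.conj_conj]
    refine Finset.sum_congr rfl fun c _ => ?_
    congr 1
    exact Finset.sum_congr rfl fun i _ => mul_comm _ _
  · intro x v hv
    simp only [LinearMap.mk₂'ₛₗ_apply]
    rw [hBv, Complex.ofReal_re]
    obtain ⟨c, hc⟩ := ρ.exists_pos_of_mem (Set.mem_univ x)
    refine Finset.sum_pos' (fun c _ => mul_nonneg (ρ.nonneg c x)
      (Finset.sum_nonneg fun i _ => by positivity)) ⟨c, hS c x hc.ne', mul_pos hc ?_⟩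
    have hxc : x ∈ (trivializationAt F E c).baseSet :=
      hρ c (subset_tsupport _ (by simpa using hc.ne'))
    have hne : L (fiberCoord F E c x v) ≠ 0 := by
      intro h0
      rw [LinearEquiv.map_eq_zero_iff] at h0
      exact hv (fiberCoord_injective hxc (by rw [h0, map_zero]))
    obtain ⟨i, hi⟩ := Function.ne_iff.1 hne
    refine Finset.sum_pos' (fun i _ => by positivity) ⟨i, Finset.mem_univ i, ?_⟩
    have : co c x i v ≠ 0 := hi
    positivity
  · intro x s t hs ht
    simp only [LinearMap.mk₂'ₛₗ_apply, B]
    refine contMDiffAt_finsetSum fun c _ => ?_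
    by_cases hxc : x ∈ tsupport (ρ c)
    · have hb := hρ c hxc
      have hco : ∀ (s : ∀ y, E y), HolAt F s x → ∀ i,
          ContMDiffAt 𝓘(ℝ, ℂ) 𝓘(ℝ, ℂ) ∞ (fun y => co c y i (s y)) x := fun s hs i =>
        HolomorphicAt.contMDiffAt_real (hs.clm hb ((LinearMap.proj i).comp L.toLinearMap))
      refine ContMDiffAt.mul ?_ (contMDiffAt_finsetSum fun i _ => ContMDiffAt.mul ?_ (hco t ht i))
      · exact Complex.ofRealCLM.contDiff.contMDiff.contMDiffAt.comp x (ρ c).contMDiff.contMDiffAt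
      · exact Complex.conjCLE.contDiff.contMDiff.contMDiffAt.comp x (hco s hs i)
    · refine (contMDiffAt_const (c := (0 : ℂ))).congr_of_eventuallyEq ?_
      filter_upwards [(isClosed_tsupport (ρ c)).isOpen_compl.mem_nhds hxc] with y hy
      rw [image_eq_zero_of_notMem_tsupport hy, Complex.ofReal_zero, zero_mul]

/-- The degree, computed with one metric and one partition of unity from any local frames. -/
lemma exists_bundleDegree_eq : ∃ (h : HermitianMetric F E) (ρ : ChartPartition X),
    ∀ (S : ∀ y, Submodule ℂ (E y)) (k : ℕ) (s : X → Fin k → ∀ y, E y),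
      (∀ p, IsLocalFrame F S p (s p)) → bundleDegree F S =
        -(1 / (4 * Real.pi)) * surfInt ρ (potentialDensity (gramPotential h s)) := by
  have H : Nonempty (HermitianMetric F E × ChartPartition X) := by
    obtain ⟨h⟩ := nonempty_hermitianMetric F E
    obtain ⟨ρ⟩ := nonempty_chartPartition X
    exact ⟨(h, ρ)⟩
  -- The choice made in `bundleDegree` depends on the bundle only and not on `S`, so the degrees of
  -- different subbundles are directly comparable.
  refine ⟨H.some.1, H.some.2, fun S k s hs => ?_⟩
  rw [bundleDegree, dif_pos H, chernNumber_eq_surfInt H.some.1 H.some.2 hs]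

end Existence

/-! ### The canonical bundle -/

section Canonical

variable {X : Type*} [TopologicalSpace X] [ChartedSpace ℂ X] [IsManifold 𝓘(ℂ, ℂ) ω X]

lemma coordDiff_eq {p y : X} (hy : y ∈ (chartAt ℂ p).source) :
    coordDiff p y = (trivializationAt ℂ (TangentSpace 𝓘(ℂ, ℂ)) p).continuousLinearMapAt ℂ y := by
  have : IsManifold 𝓘(ℂ, ℂ) 1 X := IsManifold.of_le (n := ω) le_top
  rw [TangentBundle.continuousLinearMapAt_trivializationAt hy]
  rfl

lemma mem_tangent_baseSet {p y : X} (hy : y ∈ (chartAt ℂ p).source) :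
    y ∈ (trivializationAt ℂ (TangentSpace 𝓘(ℂ, ℂ) : X → Type _) p).baseSet := by
  simpa using hy

/-- Tangent vectors are determined by their value under the differential of a coordinate. -/
lemma exists_coordDiff_eq_one {p y : X} (hy : y ∈ (chartAt ℂ p).source) :
    ∃ v : TangentSpace 𝓘(ℂ, ℂ) y, coordDiff p y v = 1 ∧ ∀ w, w = coordDiff p y w • v := by
  have hb := mem_tangent_baseSet hy
  set e := (trivializationAt ℂ (TangentSpace 𝓘(ℂ, ℂ) : X → Type _) p).continuousLinearEquivAt ℂ y hb
  have he : ∀ w, coordDiff p y w = e w := fun w => by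
    rw [coordDiff_eq hy, ← Trivialization.coe_continuousLinearEquivAt_eq _ hb]
  refine ⟨e.symm 1, by rw [he, e.apply_symm_apply], fun w => e.injective ?_⟩
  rw [he, map_smul, e.apply_symm_apply, smul_eq_mul, mul_one]

/-- In the trivialization of the tangent bundle at `p` the covector `coordDiff p` is the constant
identity of `ℂ`. -/
lemma holAt_coordDiff (p : X) :
    HolAt (ℂ →L[ℂ] ℂ) (E := fun x : X => TangentSpace 𝓘(ℂ, ℂ) x →L[ℂ] Bundle.Trivial X ℂ x)
      (fun y => coordDiff p y) p := by
  rw [HolAt, contMDiffAt_hom_bundle]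
  refine ⟨contMDiffAt_id, ?_⟩
  refine (contMDiffAt_const (c := ContinuousLinearMap.id ℂ ℂ)).congr_of_eventuallyEq ?_
  filter_upwards [(chartAt ℂ p).open_source.mem_nhds (mem_chart_source ℂ p)] with y hy
  have hb := mem_tangent_baseSet hy
  ext1
  have ht : (trivializationAt ℂ (Bundle.Trivial X ℂ) p).continuousLinearMapAt ℂ y =
      ContinuousLinearMap.id ℂ ℂ := Bundle.Trivial.continuousLinearMapAt_trivialization ℂ X ℂ y
  rw [ContinuousLinearMap.inCoordinates, ht]
  change coordDiff p y ((trivializationAt ℂ (TangentSpace 𝓘(ℂ, ℂ) : X → Type _) p).symmL ℂ y 1) = 1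
  rw [coordDiff_eq hy]
  exact (trivializationAt ℂ (TangentSpace 𝓘(ℂ, ℂ) : X → Type _) p).continuousLinearMapAt_symmL hb 1

/-- The differential of a coordinate is a frame of the canonical bundle. -/
lemma isLocalFrame_coordDiff (p : X) :
    IsLocalFrame (ℂ →L[ℂ] ℂ)
      (E := fun x : X => TangentSpace 𝓘(ℂ, ℂ) x →L[ℂ] Bundle.Trivial X ℂ x) (fun _ => ⊤) p
      (fun (_ : Fin 1) y => coordDiff p y) := by
  refine ⟨fun _ => holAt_coordDiff p, ?_⟩
  filter_upwards [(chartAt ℂ p).open_source.mem_nhds (mem_chart_source ℂ p)] with y hy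
  obtain ⟨v, hv, hw⟩ := exists_coordDiff_eq_one hy
  constructor
  · refine LinearIndependent.of_subsingleton (0 : Fin 1) fun h0 => ?_
    have := congrArg (fun f : TangentSpace 𝓘(ℂ, ℂ) y →L[ℂ] ℂ => f v) h0
    simp only [hv] at this
    exact one_ne_zero this
  · rw [eq_top_iff]
    intro η _
    have : η = (show ℂ from η v) • (coordDiff p y :
        TangentSpace 𝓘(ℂ, ℂ) y →L[ℂ] Bundle.Trivial X ℂ y) := by
      refine ContinuousLinearMap.ext fun w => ?_
      change (show ℂ from η w) = (show ℂ from η v) * coordDiff p y w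
      conv_lhs => rw [hw w, map_smul]
      exact mul_comm _ _
    rw [this]
    exact Submodule.smul_mem _ _ (Submodule.subset_span ⟨0, rfl⟩)

instance isManifold_one : IsManifold 𝓘(ℂ, ℂ) 1 X := IsManifold.of_le (n := ω) le_top

variable (X) in
lemma exists_canonicalDegree_eq [CompactSpace X] [T2Space X] : ∃ (h : HermitianMetric (ℂ →L[ℂ] ℂ)
      (fun x : X => TangentSpace 𝓘(ℂ, ℂ) x →L[ℂ] Bundle.Trivial X ℂ x)) (ρ : ChartPartition X),
    canonicalDegree X = -(1 / (4 * Real.pi)) * surfInt ρ (potentialDensity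
      (gramPotential h fun p (_ : Fin 1) y => coordDiff p y)) := by
  obtain ⟨h, ρ, hd⟩ := exists_bundleDegree_eq (ℂ →L[ℂ] ℂ)
    (fun x : X => TangentSpace 𝓘(ℂ, ℂ) x →L[ℂ] Bundle.Trivial X ℂ x)
  exact ⟨h, ρ, hd _ 1 _ isLocalFrame_coordDiff⟩

end Canonical

/-! ### Holomorphic functions in one variable on the surface -/

section Surface

variable {X : Type*} [TopologicalSpace X] [ChartedSpace ℂ X] [IsManifold 𝓘(ℂ, ℂ) ω X]

lemma tendsto_chart_symm_nhdsNE (p : X) :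
    Filter.Tendsto (chartAt ℂ p).symm (𝓝[≠] (chartAt ℂ p p)) (𝓝[≠] p) := by
  have hp := mem_chart_source ℂ p
  refine tendsto_nhdsWithin_iff.2 ⟨?_, ?_⟩
  · have h1 := (chartAt ℂ p).continuousAt_symm ((chartAt ℂ p).map_source hp)
    rw [ContinuousAt, (chartAt ℂ p).left_inv hp] at h1
    exact h1.mono_left nhdsWithin_le_nhds
  · filter_upwards [self_mem_nhdsWithin, nhdsWithin_le_nhds
      ((chartAt ℂ p).open_target.mem_nhds ((chartAt ℂ p).map_source hp))] with z hz hzt h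
    refine hz ?_
    rw [Set.mem_singleton_iff] at h ⊢
    rw [← (chartAt ℂ p).right_inv hzt, h]

lemma tendsto_chart_nhdsNE (p : X) :
    Filter.Tendsto (chartAt ℂ p) (𝓝[≠] p) (𝓝[≠] (chartAt ℂ p p)) := by
  have hp := mem_chart_source ℂ p
  refine tendsto_nhdsWithin_iff.2
    ⟨((chartAt ℂ p).continuousAt hp).tendsto.mono_left nhdsWithin_le_nhds, ?_⟩
  filter_upwards [self_mem_nhdsWithin, nhdsWithin_le_nhds
    ((chartAt ℂ p).open_source.mem_nhds hp)] with y hy hys h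
  exact hy ((chartAt ℂ p).injOn hys hp h)

/-- No point is isolated. This allows the choice of nearby points outside `D` at which a given
morphism is nonzero. -/
instance nhdsNE_neBot_surface (p : X) : (𝓝[≠] p).NeBot :=
  (tendsto_chart_symm_nhdsNE p).neBot

lemma eventually_notMem_finset [T1Space X] (D : Finset X) (p : X) : ∀ᶠ y in 𝓝[≠] p, y ∉ D := by
  classical
  have : IsOpen ((D.erase p : Finset X) : Set X)ᶜ := (Finset.finite_toSet _).isClosed.isOpen_compl
  filter_upwards [self_mem_nhdsWithin, nhdsWithin_le_nhds (this.mem_nhds (x := p) (by simp))]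
    with y hy hy' hyD
  exact hy' (by simp [hyD]; exact hy)

lemma HolFunAt.eventually_eq_zero_or_ne_zero {b : X → ℂ} {p : X} (hb : HolFunAt b p) :
    (∀ᶠ y in 𝓝 p, b y = 0) ∨ ∀ᶠ y in 𝓝[≠] p, b y ≠ 0 := by
  have hp := mem_chart_source ℂ p
  have hs := (chartAt ℂ p).open_source.mem_nhds hp
  rcases (HolomorphicAt.analyticAt_chart hb hp).eventually_eq_zero_or_eventually_ne_zero with h | h
  · left
    filter_upwards [((chartAt ℂ p).continuousAt hp).eventually h, hs] with y hy hys
    rwa [(chartAt ℂ p).left_inv hys] at hy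
  · right
    filter_upwards [(tendsto_chart_nhdsNE p).eventually h, nhdsWithin_le_nhds hs] with y hy hys
    rwa [(chartAt ℂ p).left_inv hys] at hy

/-- The exponent `n` is the order of vanishing, which becomes the coefficient of the logarithmic
pole in the residue formula. -/
lemma HolFunAt.exists_eq_pow_mul {b : X → ℂ} {p : X} (hb : HolFunAt b p)
    (h0 : ¬ ∀ᶠ y in 𝓝 p, b y = 0) : ∃ (n : ℕ) (g : X → ℂ), HolFunAt g p ∧ g p ≠ 0 ∧
      ∀ᶠ y in 𝓝 p, b y = (chartAt ℂ p y - chartAt ℂ p p) ^ n * g y := by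
  have hp := mem_chart_source ℂ p
  have hs := (chartAt ℂ p).open_source.mem_nhds hp
  have h1 : ¬ ∀ᶠ z in 𝓝 (chartAt ℂ p p), b ((chartAt ℂ p).symm z) = 0 := by
    intro h
    refine h0 ?_
    filter_upwards [((chartAt ℂ p).continuousAt hp).eventually h, hs] with y hy hys
    rwa [(chartAt ℂ p).left_inv hys] at hy
  obtain ⟨n, g, hg, hg0, hev⟩ :=
    (HolomorphicAt.analyticAt_chart hb hp).exists_eventuallyEq_pow_smul_nonzero_iff.2 h1
  refine ⟨n, fun y => g (chartAt ℂ p y), ?_, hg0, ?_⟩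
  · have h2 : ContMDiffAt 𝓘(ℂ, ℂ) 𝓘(ℂ, ℂ) ω g (chartAt ℂ p p) :=
      contMDiffAt_iff_contDiffAt.2 hg.contDiffAt
    exact h2.comp p ((contMDiffOn_chart (x := p)).contMDiffAt hs)
  · filter_upwards [((chartAt ℂ p).continuousAt hp).eventually hev, hs] with y hy hys
    rwa [(chartAt ℂ p).left_inv hys, smul_eq_mul] at hy

variable {F : Type*} [NormedAddCommGroup F] [NormedSpace ℂ F] [FiniteDimensional ℂ F]
variable {E : X → Type*} [∀ x, AddCommGroup (E x)] [∀ x, Module ℂ (E x)]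
variable [TopologicalSpace (TotalSpace F E)] [∀ x, TopologicalSpace (E x)] [FiberBundle F E]
  [VectorBundle ℂ F E] [ContMDiffVectorBundle ω F E 𝓘(ℂ, ℂ)]

/-! ### Holomorphic line subbundles -/

lemma IsHolSubbundle.exists_line_frames {S : ∀ y, Submodule ℂ (E y)} (h : IsHolSubbundle F S 1) :
    ∃ s : X → ∀ y, E y, ∀ p, IsLocalFrame F S p (fun _ : Fin 1 => s p) := by
  choose s hs using h
  refine ⟨fun p => s p 0, fun p => ?_⟩
  have : (fun _ : Fin 1 => s p 0) = s p := by
    funext i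
    rw [Subsingleton.elim i 0]
  rw [this]
  exact hs p

lemma isLocalFrame_line_iff {S : ∀ y, Submodule ℂ (E y)} {p : X} {s : ∀ y, E y} :
    IsLocalFrame F S p (fun _ : Fin 1 => s) ↔
      HolAt F s p ∧ ∀ᶠ y in 𝓝 p, s y ≠ 0 ∧ Submodule.span ℂ {s y} = S y := by
  simp only [IsLocalFrame, forall_const, Set.range_const, linearIndependent_unique_iff]

lemma HolAt.sub {s t : ∀ y, E y} {p : X} (hs : HolAt F s p) (ht : HolAt F t p) :
    HolAt F (fun y => s y - t y) p := by
  have hp := FiberBundle.mem_baseSet_trivializationAt' (F := F) (E := E) p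
  rw [holAt_iff hp] at hs ht ⊢
  simp only [map_sub]
  exact ContMDiffAt.sub hs ht

lemma HolAt.eq_zero_of_eventually {s : ∀ y, E y} {p : X} (hs : HolAt F s p)
    (h : ∀ᶠ y in 𝓝[≠] p, s y = 0) : s p = 0 := by
  have hp := FiberBundle.mem_baseSet_trivializationAt' (F := F) (E := E) p
  refine fiberCoord_injective hp ?_
  rw [map_zero]
  have h1 := ((holAt_iff hp).1 hs).continuousAt.tendsto.mono_left (nhdsWithin_le_nhds (s := {p}ᶜ))
  refine tendsto_nhds_unique (h1.congr' (f₂ := fun _ => 0) ?_) tendsto_const_nhds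
  filter_upwards [h] with y hy
  rw [hy, map_zero]

/-- A holomorphic section with values in a line subbundle is a multiple of the frame. -/
lemma IsLocalFrame.exists_coefficient {T : ∀ y, Submodule ℂ (E y)} {p : X} {t w : ∀ y, E y}
    (ht : IsLocalFrame F T p (fun _ : Fin 1 => t)) (hw : HolAt F w p)
    (hmem : ∀ᶠ y in 𝓝[≠] p, w y ∈ T y) :
    ∃ b : X → ℂ, HolFunAt b p ∧ ∀ᶠ y in 𝓝 p, w y = b y • t y := by
  obtain ⟨l, hl, hd⟩ := exists_dual_functionals F ht.2.self_of_nhds.1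
  have hl := hl.self_of_nhds
  rw [isLocalFrame_line_iff] at ht
  have hlt := hl t ht.1 0
  have hlp : l 0 p (t p) ≠ 0 := by simp [hd 0 0]
  have hb := (hl w hw 0).div hlt hlp
  -- Dividing by `l 0 y (t y)` is necessary because the functional is normalized on `t` at `p` only.
  -- The relation at `p` itself follows by continuity.
  refine ⟨fun y => l 0 y (w y) / l 0 y (t y), hb, ?_⟩
  have h1 : ∀ᶠ y in 𝓝[≠] p, w y = (l 0 y (w y) / l 0 y (t y)) • t y := by
    filter_upwards [hmem, nhdsWithin_le_nhds ht.2,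
      nhdsWithin_le_nhds (hlt.continuousAt.eventually_ne hlp)] with y hy hy2 hy3
    rw [← hy2.2, Submodule.mem_span_singleton] at hy
    obtain ⟨c, hc⟩ := hy
    rw [← hc, map_smul, smul_eq_mul, mul_div_cancel_right₀ _ hy3]
  have h2 := (hw.sub (HolAt.smul hb ht.1)).eq_zero_of_eventually
    (h1.mono fun y hy => sub_eq_zero.2 hy)
  rw [eventually_nhdsWithin_iff] at h1
  filter_upwards [h1] with y hy
  by_cases hyp : y = p
  · rw [hyp]; exact sub_eq_zero.1 h2
  · exact hy hyp

/-- Inclusion of line subbundles extends by continuity. -/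
lemma IsHolSubbundle.le_of_eventually {S T : ∀ y, Submodule ℂ (E y)} (hS : IsHolSubbundle F S 1)
    (hT : IsHolSubbundle F T 1) {p : X} (h : ∀ᶠ y in 𝓝[≠] p, S y ≤ T y) : S p ≤ T p := by
  obtain ⟨s, hs⟩ := hS.exists_line_frames
  obtain ⟨t, ht⟩ := hT.exists_line_frames
  have hs' := isLocalFrame_line_iff.1 (hs p)
  have ht' := isLocalFrame_line_iff.1 (ht p)
  obtain ⟨b, -, hb⟩ := (ht p).exists_coefficient hs'.1 (by
    filter_upwards [h, nhdsWithin_le_nhds hs'.2] with y hy hy2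
    exact hy (hy2.2 ▸ Submodule.mem_span_singleton_self _))
  rw [← hs'.2.self_of_nhds.2, Submodule.span_singleton_le_iff_mem, hb.self_of_nhds,
    ← ht'.2.self_of_nhds.2]
  exact Submodule.smul_mem _ _ (Submodule.mem_span_singleton_self _)

lemma IsHolSubbundle.eq_of_eventually {S T : ∀ y, Submodule ℂ (E y)} (hS : IsHolSubbundle F S 1)
    (hT : IsHolSubbundle F T 1) {p : X} (h : ∀ᶠ y in 𝓝[≠] p, S y = T y) : S p = T p :=
  le_antisymm (hS.le_of_eventually hT (h.mono fun _ hy => hy.le))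
    (hT.le_of_eventually hS (h.mono fun _ hy => hy.ge))

/-! ### Degrees of line subbundles and their sums -/

/-- The squared norm of a vector. -/
def HermitianMetric.sqNorm (h : HermitianMetric F E) {y : X} (v : E y) : ℝ := (h.form y v v).re

lemma HermitianMetric.sqNorm_smul (h : HermitianMetric F E) {y : X} (c : ℂ) (v : E y) :
    h.sqNorm (c • v) = ‖c‖ ^ 2 * h.sqNorm v := by
  simp only [sqNorm, map_smulₛₗ, LinearMap.smul_apply, smul_eq_mul, RingHom.id_apply]
  rw [← mul_assoc, mul_comm c, ← Complex.normSq_eq_conj_mul_self, Complex.re_ofReal_mul,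
    Complex.normSq_eq_norm_sq]

lemma HermitianMetric.log_sqNorm_smul (h : HermitianMetric F E) {y : X} {c : ℂ} (hc : c ≠ 0)
    {v : E y} (hv : v ≠ 0) :
    Real.log (h.sqNorm (c • v)) = 2 * Real.log ‖c‖ + Real.log (h.sqNorm v) := by
  rw [h.sqNorm_smul, Real.log_mul (by simpa using hc) (show h.sqNorm v ≠ 0 from (h.pos y v hv).ne'), Real.log_pow]
  norm_num

lemma gramPotential_line (h : HermitianMetric F E) (s : X → ∀ y, E y) (p y : X) :
    gramPotential h (fun p (_ : Fin 1) => s p) p y = Real.log (h.sqNorm (s p y)) := by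
  simp [gramPotential, gramDet, HermitianMetric.sqNorm]

lemma isLocalFrame_pair {S T : ∀ y, Submodule ℂ (E y)} {p : X} {s t : ∀ y, E y}
    (hs : IsLocalFrame F S p (fun _ : Fin 1 => s)) (ht : IsLocalFrame F T p (fun _ : Fin 1 => t))
    (hST : ∀ y, Disjoint (S y) (T y)) :
    IsLocalFrame F (fun y => S y ⊔ T y) p ![s, t] := by
  rw [isLocalFrame_line_iff] at hs ht
  refine ⟨fun i => ?_, ?_⟩
  · fin_cases i
    · exact hs.1
    · exact ht.1
  · filter_upwards [hs.2, ht.2] with y h1 h2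
    have e : (fun i => (![s, t] : Fin 2 → ∀ y, E y) i y) = ![s y, t y] := by
      funext i; fin_cases i <;> rfl
    rw [e]
    constructor
    · rw [LinearIndependent.pair_iff]
      intro a b hab
      have h3 : a • s y = 0 := by
        refine (Submodule.disjoint_def.1 (hST y)) _ ?_ ?_
        · rw [← h1.2]; exact Submodule.smul_mem _ _ (Submodule.mem_span_singleton_self _)
        · rw [eq_neg_of_add_eq_zero_left hab, ← h2.2]
          exact Submodule.neg_mem _ (Submodule.smul_mem _ _ (Submodule.mem_span_singleton_self _))
      have ha : a = 0 := (smul_eq_zero.1 h3).resolve_right h1.1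
      refine ⟨ha, ?_⟩
      rw [ha, zero_smul, zero_add] at hab
      exact (smul_eq_zero.1 hab).resolve_right h2.1
    · rw [← h1.2, ← h2.2, Matrix.range_cons, Matrix.range_cons, Matrix.range_empty,
        Set.union_empty, Submodule.span_union]

lemma gramDet_pair_smul (h : HermitianMetric F E) {y : X} (s t s' t' : ∀ y, E y) {a b : ℂ}
    (hs : s' y = a • s y) (ht : t' y = b • t y) :
    gramDet F h ![s', t'] y = ‖a‖ ^ 2 * ‖b‖ ^ 2 * gramDet F h ![s, t] y := by
  simp only [gramDet, Matrix.det_fin_two, Matrix.of_apply, Matrix.cons_val_zero,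
    Matrix.cons_val_one, hs, ht, map_smulₛₗ, LinearMap.smul_apply, smul_eq_mul, RingHom.id_apply]
  rw [← Complex.normSq_eq_norm_sq, ← Complex.normSq_eq_norm_sq, ← Complex.re_ofReal_mul]
  congr 1
  push_cast
  rw [Complex.normSq_eq_conj_mul_self, Complex.normSq_eq_conj_mul_self]
  ring

variable [CompactSpace X] [T2Space X]

/-- The degree is additive on direct sums of line subbundles. -/
lemma bundleDegree_sup {S T : ∀ y, Submodule ℂ (E y)} (hS : IsHolSubbundle F S 1)
    (hT : IsHolSubbundle F T 1) (hST : ∀ y, Disjoint (S y) (T y)) :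
    bundleDegree F (fun y => S y ⊔ T y) = bundleDegree F S + bundleDegree F T := by
  obtain ⟨h, ρ, hd⟩ := exists_bundleDegree_eq F E
  obtain ⟨s, hs⟩ := hS.exists_line_frames
  obtain ⟨t, ht⟩ := hT.exists_line_frames
  have hst := fun p => isLocalFrame_pair (hs p) (ht p) hST
  rw [hd _ 2 _ hst, hd _ 1 _ hs, hd _ 1 _ ht]
  have u1 := isPotential_gramPotential h hs
  have u2 := isPotential_gramPotential h ht
  have u3 := isPotential_gramPotential h hst
  have u4 := u1.add u2
  -- The ratio of the Gram determinant of `(s, t)` to the product of the squared norms of `s` and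
  -- `t` is unchanged by rescaling. Its logarithm is therefore a global function, and the residue
  -- formula applies without poles.
  have key := surfInt_potential_eq ρ (u3.add (u4.const_mul (-1)))
    (fun y => Real.log (gramDet F h ![s y, t y] y) +
      -1 * (Real.log (h.sqNorm (s y y)) + Real.log (h.sqNorm (t y y)))) ∅ 0 (fun p _ => by
    refine ⟨fun _ => 1, contMDiffAt_const, one_ne_zero, ?_⟩
    filter_upwards [(isLocalFrame_line_iff.1 (hs p)).2, (isLocalFrame_line_iff.1 (ht p)).2,
      (hst p).2] with y h1 h2 h3
    have h1' := (isLocalFrame_line_iff.1 (hs y)).2.self_of_nhds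
    have h2' := (isLocalFrame_line_iff.1 (ht y)).2.self_of_nhds
    obtain ⟨a, ha⟩ : ∃ a : ℂ, a • s p y = s y y := by
      rw [← Submodule.mem_span_singleton, h1.2, ← h1'.2]
      exact Submodule.mem_span_singleton_self _
    obtain ⟨b, hb⟩ : ∃ b : ℂ, b • t p y = t y y := by
      rw [← Submodule.mem_span_singleton, h2.2, ← h2'.2]
      exact Submodule.mem_span_singleton_self _
    have ha0 : a ≠ 0 := by
      rintro rfl
      exact h1'.1 (by rw [← ha, zero_smul])
    have hb0 : b ≠ 0 := by
      rintro rfl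
      exact h2'.1 (by rw [← hb, zero_smul])
    rw [gramPotential_line, gramPotential_line, gramPotential,
      gramDet_pair_smul h (s p) (t p) (s y) (t y) ha.symm hb.symm, ← ha, ← hb,
      h.log_sqNorm_smul ha0 h1.1, h.log_sqNorm_smul hb0 h2.1,
      Real.log_mul (by positivity) (gramDet_pos h h3.1).ne', Real.log_mul (by positivity)
      (by positivity), Real.log_pow, Real.log_pow]
    simp
    ring) (by simp)
  rw [surfInt_potential_add ρ u3 (u4.const_mul (-1)), surfInt_potential_const_mul ρ u4,
    surfInt_potential_add ρ u1 u2] at key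
  simp only [Finset.sum_empty, mul_zero] at key
  rw [← mul_add]
  congr 1
  linarith

lemma bundleDegree_bot : bundleDegree F (fun y => (⊥ : Submodule ℂ (E y))) = 0 := by
  obtain ⟨h, ρ, hd⟩ := exists_bundleDegree_eq F E
  have hs : ∀ p : X, IsLocalFrame F (fun y => (⊥ : Submodule ℂ (E y))) p
      (fun (i : Fin 0) y => i.elim0) := fun p =>
    ⟨fun i => i.elim0, Filter.Eventually.of_forall fun y =>
      ⟨linearIndependent_empty_type, by simp⟩⟩
  rw [hd _ 0 _ hs]
  have key := surfInt_potential_eq ρ (isPotential_gramPotential h hs) (fun _ => 0) ∅ 0 (fun p _ =>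
    ⟨fun _ => 1, contMDiffAt_const, one_ne_zero, Filter.Eventually.of_forall fun y => by
      simp [gramPotential, gramDet]⟩) (by simp)
  simp [key]

/-- A line subbundle with a nondegenerate holomorphic quadratic form has degree zero. -/
lemma bundleDegree_eq_zero_of_form {S : ∀ y, Submodule ℂ (E y)} (hS : IsHolSubbundle F S 1)
    (Q : ∀ x, LinearMap.BilinForm ℂ (E x))
    (hQ : ∀ (x : X) (s t : ∀ y, E y), HolAt F s x → HolAt F t x →
      ContMDiffAt 𝓘(ℂ, ℂ) 𝓘(ℂ, ℂ) ω (fun y => Q y (s y) (t y)) x)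
    (hne : ∀ x, ∀ v ∈ S x, Q x v v = 0 → v = 0) : bundleDegree F S = 0 := by
  obtain ⟨h, ρ, hd⟩ := exists_bundleDegree_eq F E
  obtain ⟨s, hs⟩ := hS.exists_line_frames
  rw [hd _ 1 _ hs]
  have hmem : ∀ p, s p p ∈ S p := fun p =>
    (isLocalFrame_line_iff.1 (hs p)).2.self_of_nhds.2 ▸ Submodule.mem_span_singleton_self _
  -- Since `Q` trivializes the square of `S`, the ratio of `‖s‖²` to `|Q(s, s)|` does not depend on
  -- the frame. It gives a global function without poles.
  have key := surfInt_potential_eq ρ (isPotential_gramPotential h hs)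
    (fun y => Real.log (h.sqNorm (s y y)) - Real.log ‖Q y (s y y) (s y y)‖) ∅ 0 (fun p _ => by
    have h0 := (isLocalFrame_line_iff.1 (hs p)).2.self_of_nhds
    have hQp := hQ p (s p) (s p) (isLocalFrame_line_iff.1 (hs p)).1 (isLocalFrame_line_iff.1 (hs p)).1
    have hQ0 : Q p (s p p) (s p p) ≠ 0 := fun h' => h0.1 (hne p _ (hmem p) h')
    refine ⟨fun y => Q y (s p y) (s p y), hQp, hQ0, ?_⟩
    filter_upwards [(isLocalFrame_line_iff.1 (hs p)).2, hQp.continuousAt.eventually_ne hQ0]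
      with y h1 h2
    have h1' := (isLocalFrame_line_iff.1 (hs y)).2.self_of_nhds
    obtain ⟨a, ha⟩ : ∃ a : ℂ, a • s p y = s y y := by
      rw [← Submodule.mem_span_singleton, h1.2, ← h1'.2]
      exact Submodule.mem_span_singleton_self _
    have ha0 : a ≠ 0 := by
      rintro rfl
      exact h1'.1 (by rw [← ha, zero_smul])
    have ha0' : ‖a‖ ≠ 0 := by simpa using ha0
    have h2' : ‖Q y (s p y) (s p y)‖ ≠ 0 := by simpa using h2
    rw [gramPotential_line, ← ha, h.log_sqNorm_smul ha0 h1.1]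
    simp only [map_smul, LinearMap.smul_apply, smul_eq_mul, norm_mul]
    rw [Real.log_mul ha0' (mul_ne_zero ha0' h2'), Real.log_mul ha0' h2']
    ring) (by simp)
  simp [key]

end Surface

section HiggsMorphism

variable {X : Type*} [TopologicalSpace X] [ChartedSpace ℂ X] [IsManifold 𝓘(ℂ, ℂ) ω X]
variable {D : Finset X} {E : X → Type*}
    [∀ x, AddCommGroup (E x)] [∀ x, Module ℂ (E x)]
    [TopologicalSpace (TotalSpace (Fin 5 → ℂ) E)] [∀ x, TopologicalSpace (E x)]
    [FiberBundle (Fin 5 → ℂ) E] [VectorBundle ℂ (Fin 5 → ℂ) E]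
    [ContMDiffVectorBundle ω (Fin 5 → ℂ) E 𝓘(ℂ, ℂ)]

namespace ParabolicHiggsBundle

/-! ### Components of the Higgs field between line subbundles -/

open Classical in
/-- The factor `1 / z` by which the Higgs field differs from `A dz` near a marked point. -/
def poleFactor (D : Finset X) (p y : X) : ℂ :=
  if p ∈ D then (chartAt ℂ p y - chartAt ℂ p p)⁻¹ else 1

lemma poleFactor_ne_zero {D : Finset X} {p y : X} (hy : y ∈ (chartAt ℂ p).source) (hyD : y ∉ D) :
    poleFactor D p y ≠ 0 := by
  rw [poleFactor]
  split_ifs with hp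
  · refine inv_ne_zero (sub_ne_zero.2 fun h => hyD ?_)
    rwa [(chartAt ℂ p).injOn hy (mem_chart_source ℂ p) h]
  · exact one_ne_zero

/-- Treats marked and unmarked points uniformly: the Higgs field is a holomorphic endomorphism field
times `dz`, with a pole factor that is 1 unless `p ∈ D`. -/
lemma exists_higgs_matrix (P : ParabolicHiggsBundle D E) (p : X) :
    ∃ A : ∀ y, Module.End ℂ (E y), HolEndAt (Fin 5 → ℂ) A p ∧ (∀ hp : p ∈ D, A p = P.res ⟨p, hp⟩) ∧
      ∀ᶠ y in 𝓝 p, y ∉ D → ∀ ξ, P.Φ y ξ = (coordDiff p y ξ * poleFactor D p y) • A y := by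
  by_cases hp : p ∈ D
  · obtain ⟨A, hA, hres, hev⟩ := P.Φ_log ⟨p, hp⟩
    refine ⟨A, hA, fun _ => hres, ?_⟩
    rw [eventually_nhdsWithin_iff] at hev
    filter_upwards [hev] with y hy hyD ξ
    rw [poleFactor, if_pos hp, ← div_eq_mul_inv]
    exact hy (fun h => hyD (by rw [h]; exact hp)) ξ
  · obtain ⟨A, hA, hev⟩ := P.Φ_hol p hp
    refine ⟨A, hA, fun h => absurd h hp, ?_⟩
    filter_upwards [hev] with y hy _ ξ
    rw [poleFactor, if_neg hp, mul_one]
    exact hy ξ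

variable [T2Space X]

/-- In local frames, a component of the Higgs field is a holomorphic function `b`. -/
lemma exists_local_coefficient (P : ParabolicHiggsBundle D E) {S T : ∀ x, Submodule ℂ (E x)}
    (hΦ : ∀ x ∉ D, ∀ ξ, ∀ e ∈ S x, P.Φ x ξ e ∈ T x) {p : X} {s t : ∀ y, E y}
    (hs : IsLocalFrame (Fin 5 → ℂ) S p (fun _ : Fin 1 => s))
    (ht : IsLocalFrame (Fin 5 → ℂ) T p (fun _ : Fin 1 => t)) :
    ∃ b : X → ℂ, HolFunAt b p ∧
      (∀ᶠ y in 𝓝 p, y ∉ D → ∀ ξ, P.Φ y ξ (s y) =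
        (coordDiff p y ξ * poleFactor D p y * b y) • t y) ∧
      ∀ hp : p ∈ D, P.res ⟨p, hp⟩ (s p) = b p • t p := by
  obtain ⟨A, hA, hres, hev⟩ := P.exists_higgs_matrix p
  have hs' := isLocalFrame_line_iff.1 hs
  have hsrc : ∀ᶠ y in 𝓝 p, y ∈ (chartAt ℂ p).source :=
    (chartAt ℂ p).open_source.mem_nhds (mem_chart_source ℂ p)
  -- Off `D`, evaluation at the tangent vector with `dz ξ = 1` and division by the pole factor show
  -- that `A s` lies in `T`; continuity extends this to `p`.
  obtain ⟨b, hb, hbe⟩ := ht.exists_coefficient (hA s hs'.1) (by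
    filter_upwards [eventually_notMem_finset D p, nhdsWithin_le_nhds hev, nhdsWithin_le_nhds hsrc,
      nhdsWithin_le_nhds hs'.2] with y hyD hy hys hsy
    obtain ⟨ξ, hξ, -⟩ := exists_coordDiff_eq_one hys
    have h1 := hΦ y hyD ξ (s y) (hsy.2 ▸ Submodule.mem_span_singleton_self _)
    rw [hy hyD, hξ, one_mul, LinearMap.smul_apply] at h1
    exact (Submodule.smul_mem_iff _ (poleFactor_ne_zero hys hyD)).1 h1)
  refine ⟨b, hb, ?_, fun hp => ?_⟩
  · filter_upwards [hev, hbe] with y hy hy2 hyD ξ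
    rw [hy hyD, LinearMap.smul_apply, hy2, smul_smul]
  · rw [← hres hp]
    exact hbe.self_of_nhds

/-- The restriction of the Higgs field to the family `S` is nonzero at `y`. -/
def NonzeroAt (P : ParabolicHiggsBundle D E) (S : ∀ x, Submodule ℂ (E x)) (y : X) : Prop :=
  ∃ ξ, ∃ e ∈ S y, P.Φ y ξ e ≠ 0

lemma nonzeroAt_iff_coefficient (P : ParabolicHiggsBundle D E) {S T : ∀ x, Submodule ℂ (E x)}
    {p : X} {s t : ∀ y, E y} {b : X → ℂ}
    (hs : IsLocalFrame (Fin 5 → ℂ) S p (fun _ : Fin 1 => s))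
    (ht : IsLocalFrame (Fin 5 → ℂ) T p (fun _ : Fin 1 => t))
    (hb : ∀ᶠ y in 𝓝 p, y ∉ D → ∀ ξ, P.Φ y ξ (s y) =
        (coordDiff p y ξ * poleFactor D p y * b y) • t y) :
    ∀ᶠ y in 𝓝 p, y ∉ D → (P.NonzeroAt S y ↔ b y ≠ 0) := by
  have hsrc : ∀ᶠ y in 𝓝 p, y ∈ (chartAt ℂ p).source :=
    (chartAt ℂ p).open_source.mem_nhds (mem_chart_source ℂ p)
  filter_upwards [hb, hsrc, (isLocalFrame_line_iff.1 hs).2, (isLocalFrame_line_iff.1 ht).2]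
    with y hy hys hsy hty hyD
  constructor
  · rintro ⟨ξ, e, he, hne⟩ h0
    rw [← hsy.2, Submodule.mem_span_singleton] at he
    obtain ⟨c, rfl⟩ := he
    exact hne (by rw [map_smul, hy hyD, h0, mul_zero, zero_smul, smul_zero])
  · intro h0
    obtain ⟨ξ, hξ, -⟩ := exists_coordDiff_eq_one hys
    refine ⟨ξ, s y, hsy.2 ▸ Submodule.mem_span_singleton_self _, ?_⟩
    rw [hy hyD, hξ, one_mul]
    exact smul_ne_zero (mul_ne_zero (poleFactor_ne_zero hys hyD) h0) hty.1

/-- The identity theorem for a component of the Higgs field. -/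
lemma eventually_nonzeroAt [ConnectedSpace X] (P : ParabolicHiggsBundle D E)
    {S T : ∀ x, Submodule ℂ (E x)}
    (hS : IsHolSubbundle (Fin 5 → ℂ) S 1) (hT : IsHolSubbundle (Fin 5 → ℂ) T 1)
    (hΦ : ∀ x ∉ D, ∀ ξ, ∀ e ∈ S x, P.Φ x ξ e ∈ T x) (hne : ∃ x ∉ D, P.NonzeroAt S x) (p : X) :
    ∀ᶠ y in 𝓝[≠] p, P.NonzeroAt S y := by
  obtain ⟨s, hs⟩ := hS.exists_line_frames
  obtain ⟨t, ht⟩ := hT.exists_line_frames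
  have hloc : ∀ p, ∃ b : X → ℂ, HolFunAt b p ∧ ∀ᶠ y in 𝓝 p, y ∉ D → (P.NonzeroAt S y ↔ b y ≠ 0) := by
    intro p
    obtain ⟨b, hb, hb1, -⟩ := P.exists_local_coefficient hΦ (hs p) (ht p)
    exact ⟨b, hb, P.nonzeroAt_iff_coefficient (hs p) (ht p) hb1⟩
  have dich : ∀ p, (∀ᶠ y in 𝓝[≠] p, ¬ P.NonzeroAt S y) ∨ ∀ᶠ y in 𝓝[≠] p, P.NonzeroAt S y := by
    intro p
    obtain ⟨b, hb, hbe⟩ := hloc p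
    rcases hb.eventually_eq_zero_or_ne_zero with h | h
    · left
      filter_upwards [nhdsWithin_le_nhds h, nhdsWithin_le_nhds hbe, eventually_notMem_finset D p]
        with y h1 h2 h3
      rw [h2 h3, not_not]
      exact h1
    · right
      filter_upwards [h, nhdsWithin_le_nhds hbe, eventually_notMem_finset D p] with y h1 h2 h3
      exact (h2 h3).2 h1
  -- By the local dichotomy both `Z` and its complement are open, so connectedness and one point of
  -- nonvanishing leave `Z` empty.
  set Z : Set X := {p | ∀ᶠ y in 𝓝[≠] p, ¬ P.NonzeroAt S y}
  have key : ∀ (R : X → Prop) (p : X), (∀ᶠ y in 𝓝[≠] p, R y) →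
      ∀ᶠ y in 𝓝[≠] p, ∀ᶠ q in 𝓝[≠] y, R q := by
    intro R p h
    have h1 := eventually_eventually_nhdsWithin.2 h
    filter_upwards [h1, self_mem_nhdsWithin] with y hy hyp
    rw [(isOpen_compl_singleton (x := p)).nhdsWithin_eq hyp] at hy
    exact hy.filter_mono nhdsWithin_le_nhds
  have hopen : IsOpen Z := by
    rw [isOpen_iff_mem_nhds]
    intro p hp
    have h1 := key _ p hp
    rw [eventually_nhdsWithin_iff] at h1
    filter_upwards [h1] with y hy
    by_cases hyp : y = p
    · rw [hyp]; exact hp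
    · exact hy hyp
  have hclosed : IsOpen Zᶜ := by
    rw [isOpen_iff_mem_nhds]
    intro p hp
    have h1 := key _ p ((dich p).resolve_left hp)
    rw [eventually_nhdsWithin_iff] at h1
    filter_upwards [h1] with y hy
    by_cases hyp : y = p
    · rw [hyp]; exact hp
    · intro hyZ
      obtain ⟨q, hq1, hq2⟩ := ((hy hyp).and hyZ).exists
      exact hq2 hq1
  have hZ : Z = ∅ := by
    rcases isClopen_iff.1 ⟨isOpen_compl_iff.1 hclosed, hopen⟩ with h | h
    · exact h
    · exfalso
      obtain ⟨x, hxD, hx⟩ := hne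
      have hxZ : x ∈ Z := h ▸ Set.mem_univ x
      obtain ⟨b, hb, hbe⟩ := hloc x
      have hbx : b x ≠ 0 := (hbe.self_of_nhds hxD).1 hx
      have h2 : ∀ᶠ y in 𝓝[≠] x, b y ≠ 0 :=
        nhdsWithin_le_nhds (hb.continuousAt.eventually_ne hbx)
      have h3 : ∀ᶠ y in 𝓝[≠] x, y ∉ D → (P.NonzeroAt S y ↔ b y ≠ 0) := nhdsWithin_le_nhds hbe
      obtain ⟨q, ⟨⟨hq1, hq2⟩, hq3⟩, hq4⟩ :=
        (((h2.and h3).and (eventually_notMem_finset D x)).and hxZ).exists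
      exact hq4 ((hq2 hq3).2 hq1)
  refine (dich p).resolve_left fun h => ?_
  have : p ∈ Z := h
  rw [hZ] at this
  exact this

/-- If the Higgs field induces a nonzero morphism `S → T ⊗ K(D)` of line subbundles, then
`deg T - deg S + deg K(D)` is the number of zeros of this morphism. -/
theorem exists_vanishing_orders [ConnectedSpace X] [CompactSpace X] (P : ParabolicHiggsBundle D E)
    {S T : ∀ x, Submodule ℂ (E x)}
    (hS : IsHolSubbundle (Fin 5 → ℂ) S 1) (hT : IsHolSubbundle (Fin 5 → ℂ) T 1)
    (hΦ : ∀ x ∉ D, ∀ ξ, ∀ e ∈ S x, P.Φ x ξ e ∈ T x) (hne : ∃ x ∉ D, P.NonzeroAt S x) :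
    ∃ (n : X → ℕ) (Z : Finset X), D ⊆ Z ∧
      bundleDegree (Fin 5 → ℂ) T - bundleDegree (Fin 5 → ℂ) S + logCanonicalDegree D =
        ∑ p ∈ Z, (n p : ℝ) ∧
      (∀ p ∉ D, P.NonzeroAt S p → n p = 0) ∧
      ∀ p : D, n p = 0 ↔ ∃ e ∈ S p, P.res p e ≠ 0 := by
  classical
  obtain ⟨h, ρ, hd⟩ := exists_bundleDegree_eq (Fin 5 → ℂ) E
  obtain ⟨hK, ρK, hdK⟩ := exists_canonicalDegree_eq X
  obtain ⟨s, hs⟩ := hS.exists_line_frames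
  obtain ⟨t, ht⟩ := hT.exists_line_frames
  have hs' := fun p => isLocalFrame_line_iff.1 (hs p)
  have ht' := fun p => isLocalFrame_line_iff.1 (ht p)
  have hk' := fun p : X => isLocalFrame_line_iff.1 (isLocalFrame_coordDiff p)
  have hnz := P.eventually_nonzeroAt hS hT hΦ hne
  choose b hb hb1 hbres using fun p => P.exists_local_coefficient hΦ (hs p) (ht p)
  have hbnz := fun p => P.nonzeroAt_iff_coefficient (hs p) (ht p) (hb1 p)
  have hb0 : ∀ p, ¬ ∀ᶠ y in 𝓝 p, b p y = 0 := by
    intro p hp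
    have h1 : ∀ᶠ y in 𝓝[≠] p, b p y = 0 := nhdsWithin_le_nhds hp
    have h2 : ∀ᶠ y in 𝓝[≠] p, y ∉ D → (P.NonzeroAt S y ↔ b p y ≠ 0) :=
      nhdsWithin_le_nhds (hbnz p)
    obtain ⟨q, ⟨⟨hq1, hq2⟩, hq3⟩, hq4⟩ :=
      (((h1.and h2).and (eventually_notMem_finset D p)).and (hnz p)).exists
    exact ((hq2 hq3).1 hq4) hq1
  choose n g hg hg0 hbg using fun p => (hb p).exists_eq_pow_mul (hb0 p)
  have hn0 : ∀ p, n p = 0 ↔ b p p ≠ 0 := by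
    intro p
    rw [(hbg p).self_of_nhds, sub_self]
    constructor
    · intro h0
      rw [h0, pow_zero, one_mul]
      exact hg0 p
    · intro h1
      by_contra h0
      exact h1 (by rw [zero_pow h0, zero_mul])
  -- Infinitely many zeros would accumulate by compactness, contradicting their isolation.
  have hfin : {p | n p ≠ 0}.Finite := by
    by_contra hinf
    obtain ⟨x, hx⟩ := Set.Infinite.exists_accPt_principal hinf
    rw [accPt_iff_frequently_nhdsNE] at hx
    obtain ⟨q, hq1, hq2, hq3⟩ := (hx.and_eventually
      ((hnz x).and (eventually_notMem_finset D x))).exists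
    exact hq1 ((hn0 q).2 (((hbnz q).self_of_nhds hq3).1 hq2))
  choose ξ hξ hξ' using fun y : X => exists_coordDiff_eq_one (mem_chart_source ℂ y)
  -- the globally defined logarithm of the norm of the morphism
  set f : X → ℝ := fun y => Real.log (h.sqNorm (s y y)) -
    Real.log (h.sqNorm (P.Φ y (ξ y) (s y y))) - Real.log (hK.sqNorm (coordDiff y y))
  -- The factor 2 comes from squared norms, and the subtracted 1 is the simple pole allowed at a
  -- point of `D`.
  set m : X → ℝ := fun p => 2 * ((n p : ℝ) - if p ∈ D then 1 else 0)
  set Z : Finset X := D ∪ hfin.toFinset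
  have u1 := isPotential_gramPotential h hs
  have u2 := isPotential_gramPotential h ht
  have u3 := isPotential_gramPotential hK (isLocalFrame_coordDiff (X := X))
  have u4 := u2.add u3
  set u : X → X → ℝ := fun p y => gramPotential h (fun p (_ : Fin 1) => s p) p y +
    -1 * (gramPotential h (fun p (_ : Fin 1) => t p) p y +
      gramPotential hK (fun p (_ : Fin 1) y => coordDiff p y) p y)
  have hu : IsPotential u := u1.add (u4.const_mul (-1))
  -- Rescaling the frame of `S` and changing the coordinate cancel in `f`, which is minus the
  -- logarithm of the squared norm of the morphism. Relative to fixed frames only the pole factor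
  -- and `b` remain.
  have hloc : ∀ p, ∀ᶠ y in 𝓝 p, y ∉ D → b p y ≠ 0 → u p y =
      f y + -2 * Real.log ‖poleFactor D p y‖⁻¹ + 2 * Real.log ‖b p y‖ := by
    intro p
    have hsrc : ∀ᶠ y in 𝓝 p, y ∈ (chartAt ℂ p).source :=
      (chartAt ℂ p).open_source.mem_nhds (mem_chart_source ℂ p)
    filter_upwards [hsrc, (hs' p).2, (ht' p).2, (hk' p).2, hb1 p] with y hys h1 h2 h3 h4 hyD hby
    have h1' := (hs' y).2.self_of_nhds
    have h3' := (hk' y).2.self_of_nhds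
    obtain ⟨a, ha⟩ : ∃ a : ℂ, a • s p y = s y y := by
      rw [← Submodule.mem_span_singleton, h1.2, ← h1'.2]
      exact Submodule.mem_span_singleton_self _
    have ha0 : a ≠ 0 := by
      rintro rfl
      exact h1'.1 (by rw [← ha, zero_smul])
    obtain ⟨c, hc⟩ : ∃ c : ℂ, c • (coordDiff y y) = coordDiff p y :=
      Submodule.mem_span_singleton.1 (h3'.2 ▸ Submodule.mem_top)
    have hc0 : c ≠ 0 := by
      rintro rfl
      obtain ⟨v, hv, -⟩ := exists_coordDiff_eq_one hys
      rw [← hc] at hv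
      simp at hv
    have hcξ : coordDiff p y (ξ y) = c := by
      rw [← hc]
      simp [hξ y]
    have hpf := poleFactor_ne_zero hys hyD
    have e1 : P.Φ y (ξ y) (s y y) = (a * (c * poleFactor D p y * b p y)) • t p y := by
      rw [← ha, map_smul, h4 hyD, hcξ, smul_smul]
    have hcoef : a * (c * poleFactor D p y * b p y) ≠ 0 :=
      mul_ne_zero ha0 (mul_ne_zero (mul_ne_zero hc0 hpf) hby)
    have e2 : Real.log (hK.sqNorm (coordDiff p y)) =
        2 * Real.log ‖c‖ + Real.log (hK.sqNorm (coordDiff y y)) := by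
      rw [← hK.log_sqNorm_smul hc0 h3'.1]
      exact congrArg (fun v => Real.log (hK.sqNorm v)) hc.symm
    have e3 : Real.log ‖a * (c * poleFactor D p y * b p y)‖ =
        Real.log ‖a‖ + Real.log ‖c‖ + Real.log ‖poleFactor D p y‖ + Real.log ‖b p y‖ := by
      rw [norm_mul, norm_mul, norm_mul, Real.log_mul, Real.log_mul, Real.log_mul]
      · ring
      all_goals simp [ha0, hc0, hpf, hby]
    simp only [u, f, gramPotential_line]
    rw [e1, e2, ← ha, h.log_sqNorm_smul ha0 h1.1, h.log_sqNorm_smul hcoef h2.1, e3, Real.log_inv]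
    ring
  have key := surfInt_potential_eq ρ hu f Z m (fun p hp => by
    have hpD : p ∉ D := fun h' => hp (Finset.mem_union_left _ h')
    have hnp : n p = 0 := by
      by_contra h'
      exact hp (Finset.mem_union_right _ (hfin.mem_toFinset.2 h'))
    have hbp := (hn0 p).1 hnp
    refine ⟨fun y => b p y ^ 2, (hb p).pow 2, pow_ne_zero 2 hbp, ?_⟩
    have hD : ∀ᶠ y in 𝓝 p, y ∉ D := by
      have := eventually_notMem_finset D p
      rw [eventually_nhdsWithin_iff] at this
      filter_upwards [this] with y hy
      by_cases hyp : y = p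
      · rw [hyp]; exact hpD
      · exact hy hyp
    filter_upwards [hloc p, hD, (hb p).continuousAt.eventually_ne hbp] with y hy hyD hby
    rw [hy hyD hby, poleFactor, if_neg hpD, norm_pow, Real.log_pow]
    simp) (fun p hp => by
    refine ⟨fun y => g p y ^ 2, (hg p).pow 2, pow_ne_zero 2 (hg0 p), ?_⟩
    have hsrc : ∀ᶠ y in 𝓝 p, y ∈ (chartAt ℂ p).source :=
      (chartAt ℂ p).open_source.mem_nhds (mem_chart_source ℂ p)
    filter_upwards [nhdsWithin_le_nhds (hloc p), eventually_notMem_finset D p,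
      nhdsWithin_le_nhds (hbg p), nhdsWithin_le_nhds ((hg p).continuousAt.eventually_ne (hg0 p)),
      nhdsWithin_le_nhds hsrc, self_mem_nhdsWithin] with y hy hyD hybg hgy hys hyp
    have hz : chartAt ℂ p y - chartAt ℂ p p ≠ 0 :=
      sub_ne_zero.2 fun h' => hyp ((chartAt ℂ p).injOn hys (mem_chart_source ℂ p) h')
    have hby : b p y ≠ 0 := by
      rw [hybg]
      exact mul_ne_zero (pow_ne_zero _ hz) hgy
    rw [hy hyD hby, hybg, norm_mul, norm_pow, norm_pow, Real.log_mul (by simp [hz])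
      (by simpa using hgy), Real.log_pow, Real.log_pow]
    simp only [m, poleFactor]
    split_ifs with hpD
    · rw [norm_inv, inv_inv]
      push_cast
      ring
    · simp
      ring)
  have hZsum : ∑ p ∈ Z, (if p ∈ D then (1 : ℝ) else 0) = D.card := by
    rw [Finset.sum_ite_mem, Finset.inter_eq_right.2 Finset.subset_union_left]
    simp
  refine ⟨n, Z, Finset.subset_union_left, ?_, fun p hpD hp =>
    (hn0 p).2 (((hbnz p).self_of_nhds hpD).1 hp), fun p => ?_⟩
  · rw [logCanonicalDegree, hd _ 1 _ hs, hd _ 1 _ ht, hdK, surfInt_indep ρK ρ u3.isDensity]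
    simp only [u] at key
    rw [surfInt_potential_add ρ u1 (u4.const_mul (-1)), surfInt_potential_const_mul ρ u4,
      surfInt_potential_add ρ u2 u3] at key
    simp only [m, ← Finset.mul_sum, Finset.sum_sub_distrib, hZsum] at key
    have hpi := Real.pi_pos
    field_simp
    linarith
  · have hsp := (hs' p).2.self_of_nhds
    have htp := (ht' p).2.self_of_nhds
    rw [hn0]
    constructor
    · intro hbp
      refine ⟨s p p, hsp.2 ▸ Submodule.mem_span_singleton_self _, ?_⟩
      rw [hbres p p.2]
      exact smul_ne_zero hbp htp.1
    · rintro ⟨e, he, hne⟩ hbp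
      rw [← hsp.2, Submodule.mem_span_singleton] at he
      obtain ⟨c, rfl⟩ := he
      refine hne ?_
      rw [map_smul, hbres p p.2, hbp, zero_smul, smul_zero]

end ParabolicHiggsBundle

end HiggsMorphism

/-! ### Linear algebra in one fibre: flag contributions and invariant isotropic subspaces -/

section LinearAlgebra

open Module

variable {W : Type*} [AddCommGroup W] [Module ℂ W]

/-- Coordinate subspaces of one basis intersect as their index sets do. This reduces parabolic
weights to counting. -/
lemma finrank_span_image_inf {ι : Type*} [DecidableEq ι] (b : Basis ι ℂ W) (s t : Finset ι) :
    finrank ℂ ↥(Submodule.span ℂ (b '' s) ⊓ Submodule.span ℂ (b '' t)) = (s ∩ t).card := by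
  have h : Submodule.span ℂ (b '' s) ⊓ Submodule.span ℂ (b '' t) =
      Submodule.span ℂ (Set.range fun i : ↥(s ∩ t) => b i) := by
    have : (Set.range fun i : ↥(s ∩ t) => b i) = b '' ↑(s ∩ t) := (Set.image_eq_range _ _).symm
    ext m
    rw [this, Submodule.mem_inf, b.mem_span_image, b.mem_span_image, b.mem_span_image,
      Finset.coe_inter, Set.subset_inter_iff]
  have hli : LinearIndependent ℂ fun i : ↥(s ∩ t) => b i :=
    b.linearIndependent.comp _ Subtype.val_injective
  rw [h, finrank_span_eq_card hli, Fintype.card_coe]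

lemma WeightedFlag.contribution_bot (f : WeightedFlag W) : f.contribution ⊥ = 0 := by
  refine Finset.sum_eq_zero fun i _ => ?_
  rw [bot_inf_eq, finrank_bot, Nat.cast_zero, mul_zero]

lemma WeightedFlag.contribution_trivial (S : Submodule ℂ W) :
    (⟨1, ![⊤, ⊥], ![0]⟩ : WeightedFlag W).contribution S = 0 := by
  simp [contribution]

lemma WeightedFlag.contribution_span_image {n : ℕ} (b : Basis (Fin n) ℂ W) (s t u : Finset (Fin n))
    (ζ : ℝ) :
    (⟨3, ![⊤, Submodule.span ℂ (b '' t), Submodule.span ℂ (b '' u), ⊥], ![ζ, 0, -ζ]⟩ :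
      WeightedFlag W).contribution (Submodule.span ℂ (b '' s)) =
      ζ * (s.card - (s ∩ t).card - (s ∩ u).card) := by
  have htop : finrank ℂ ↥(Submodule.span ℂ (b '' s)) = s.card := by
    have h := finrank_span_image_inf b s s
    rwa [inf_idem, Finset.inter_self] at h
  simp only [contribution, Fin.sum_univ_three]
  -- The increments of the weights `ζ, 0, -ζ`, counted from the initial value 0, are `ζ`, `-ζ`,
  -- `-ζ`.
  change (ζ - 0) * (finrank ℂ ↥(Submodule.span ℂ (b '' s) ⊓ ⊤) : ℝ) +
    (0 - ζ) * (finrank ℂ ↥(Submodule.span ℂ (b '' s) ⊓ Submodule.span ℂ (b '' t)) : ℝ) +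
    (-ζ - 0) * (finrank ℂ ↥(Submodule.span ℂ (b '' s) ⊓ Submodule.span ℂ (b '' u)) : ℝ) = _
  rw [inf_top_eq, htop, finrank_span_image_inf, finrank_span_image_inf]
  ring

/-- The basis `b` is adapted to the cyclic grading of an orthogonal space of dimension five. -/
def IsAntidiagonal (Q : LinearMap.BilinForm ℂ W) (b : Basis (Fin 5) ℂ W) : Prop :=
  (∀ i j, j ≠ i.rev → Q (b i) (b j) = 0) ∧ ∀ i, Q (b i) (b i.rev) ≠ 0

/-- The isotropic invariant subspaces, compatible with the orthogonal splitting, of a cyclic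
endomorphism with nonvanishing `τ` and `β`. -/
lemma IsAntidiagonal.isotropic_invariant {Q : LinearMap.BilinForm ℂ W} {b : Basis (Fin 5) ℂ W}
    (hb : IsAntidiagonal Q b) (hsymm : ∀ v w, Q v w = Q w v) {M : End ℂ W}
    (hskew : ∀ v w, Q (M v) w + Q v (M w) = 0) {σ l μ α δ g : ℂ}
    (h0 : M (b 0) = σ • b 1) (h1 : M (b 1) = l • b 2) (h2 : M (b 2) = μ • b 3)
    (h3 : M (b 3) = α • b 0 + δ • b 4) (h4 : M (b 4) = g • b 1) (hμ : μ ≠ 0) (hδ : δ ≠ 0)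
    {U V : Submodule ℂ W} (hU : ∀ u ∈ U, ∃ x y : ℂ, u = x • b 1 + y • b 3)
    (hV : ∀ v ∈ V, ∃ x y z : ℂ, v = x • b 0 + y • b 2 + z • b 4)
    (hUU : ∀ u ∈ U, Q u u = 0) (hVV : ∀ v ∈ V, Q v v = 0)
    (hMU : ∀ u ∈ U, M u ∈ V) (hMV : ∀ v ∈ V, M v ∈ U) :
    (∀ u ∈ U, ∃ y : ℂ, u = y • b 3) ∧ (∀ v ∈ V, ∃ z : ℂ, v = z • b 4) ∧ (U ≠ ⊥ → V ≠ ⊥) := by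
  obtain ⟨hz, hn⟩ := hb
  have q0 : Q (b 0) (b 4) ≠ 0 := hn 0
  have q1 : Q (b 1) (b 3) ≠ 0 := hn 1
  have q2 : Q (b 2) (b 2) ≠ 0 := hn 2
  have s3 := hsymm (b 3) (b 1)
  have s4 := hsymm (b 4) (b 0)
  -- Skewness ties each entry to its dual: `σ` to `δ`, `l` to `μ`, and `g` to `α`.
  have r0 : σ * Q (b 1) (b 3) + δ * Q (b 0) (b 4) = 0 := by
    simpa [h0, h3, hz] using hskew (b 0) (b 3)
  have r1 : l * Q (b 2) (b 2) + μ * Q (b 1) (b 3) = 0 := by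
    simpa [h1, h2, hz] using hskew (b 1) (b 2)
  have r2 : α * Q (b 0) (b 4) + g * Q (b 1) (b 3) = 0 := by
    simpa [h3, h4, hz, s3] using hskew (b 3) (b 4)
  have hl : l ≠ 0 := by
    rintro rfl
    simp [hμ, q1] at r1
  have hσ : σ ≠ 0 := by
    rintro rfl
    simp [hδ, q0] at r0
  have cU : ∀ u ∈ U, ∃ y : ℂ, u = y • b 3 := by
    intro u hu
    obtain ⟨x, y, rfl⟩ := hU u hu
    have e1 := hUU _ hu
    have e2 := hVV _ (hMU _ hu)
    -- If `x ≠ 0`, isotropy of `u` gives `y = 0`. Then `M u` is a nonzero multiple of the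
    -- anisotropic vector `b 2`, although it lies in the isotropic `V`.
    have hx : x = 0 := by
      by_contra hx
      have hy : y = 0 := by
        simp [hz, s3] at e1
        have : 2 * x * y * Q (b 1) (b 3) = 0 := by linear_combination e1
        simpa [hx, q1] using this
      subst hy
      simp [h1, hx, hl, q2] at e2
    exact ⟨y, by rw [hx, zero_smul, zero_add]⟩
  have hcoef : ∀ x y z : ℂ, x • b 1 + y • b 3 = z • b 3 → x = 0 ∧ y = z := by
    intro x y z h
    have e := congrArg b.repr h
    constructor
    · simpa using DFunLike.congr_fun e 1
    · simpa using DFunLike.congr_fun e 3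
  refine ⟨cU, ?_, ?_⟩
  · intro v hv
    obtain ⟨x, y, z, rfl⟩ := hV v hv
    obtain ⟨w, hw⟩ := cU _ (hMV _ hv)
    have e1 : x * σ + z * g = 0 := by
      refine (hcoef (x * σ + z * g) (y * μ) w ?_).1
      rw [← hw]
      simp only [map_add, map_smul, h0, h2, h4]
      module
    have e2 := hVV _ hv
    simp [hz, s4] at e2
    have e2' : y ^ 2 * Q (b 2) (b 2) + 2 * x * z * Q (b 0) (b 4) = 0 := by linear_combination e2
    -- If `U = 0`, then `M v = 0` kills `y`, isotropy gives `x z = 0`, and `x σ + z g = 0` excludes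
    -- `x ≠ 0`. If `U ≠ 0`, it contains `b 3`; isotropy of `M (b 3)` gives `α = 0`, hence `g = 0`,
    -- and so `x σ = 0`.
    have hx : x = 0 := by
      by_cases hU0 : U = ⊥
      · by_contra hx
        have hy : y = 0 := by
          have h5 := hMV _ hv
          rw [hU0, Submodule.mem_bot] at h5
          have : (x * σ + z * g) • b 1 + (y * μ) • b 3 = (0 : ℂ) • b 3 := by
            rw [zero_smul, ← h5]
            simp only [map_add, map_smul, h0, h2, h4]
            module
          simpa [hμ] using (hcoef _ _ _ this).2
        have hz0 : z = 0 := by simpa [hy, hx, q0] using e2'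
        exact hx (by simpa [hz0, hσ] using e1)
      · obtain ⟨u, hu, hu0⟩ := Submodule.exists_mem_ne_zero_of_ne_bot hU0
        obtain ⟨c, rfl⟩ := cU u hu
        have hc : c ≠ 0 := fun h => hu0 (by rw [h, zero_smul])
        have h5 := hVV _ (hMU _ hu)
        simp [h3, hz, s4] at h5
        have h6 : α * (2 * δ * Q (b 0) (b 4)) = 0 := by
          have h7 : c ^ 2 * (α * (2 * δ * Q (b 0) (b 4))) = 0 := by linear_combination h5
          simpa only [mul_eq_zero, pow_eq_zero_iff two_ne_zero, hc, false_or] using h7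
        have hα : α = 0 := by simpa [hδ, q0] using h6
        have hg : g = 0 := by simpa [hα, q1] using r2
        simpa [hg, hσ] using e1
    have hy : y = 0 := by simpa [hx, q2] using e2'
    exact ⟨z, by rw [hx, hy, zero_smul, zero_smul, zero_add, zero_add]⟩
  · intro hU0 hV0
    obtain ⟨u, hu, hu0⟩ := Submodule.exists_mem_ne_zero_of_ne_bot hU0
    obtain ⟨c, rfl⟩ := cU u hu
    have hc : c ≠ 0 := fun h => hu0 (by rw [h, zero_smul])
    have h5 := hMU _ hu
    rw [hV0, Submodule.mem_bot, map_smul, h3] at h5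
    have := DFunLike.congr_fun (congrArg b.repr h5) 4
    simp [hc, hδ] at this

end LinearAlgebra

/-! ### Adapted bases, classification of the test pairs, and weights -/

section Cyclic

variable {X : Type*} [TopologicalSpace X] [ChartedSpace ℂ X] [IsManifold 𝓘(ℂ, ℂ) ω X]
variable {D : Finset X} {E : X → Type*}
    [∀ x, AddCommGroup (E x)] [∀ x, Module ℂ (E x)]
    [TopologicalSpace (TotalSpace (Fin 5 → ℂ) E)] [∀ x, TopologicalSpace (E x)]
    [FiberBundle (Fin 5 → ℂ) E] [VectorBundle ℂ (Fin 5 → ℂ) E]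
    [ContMDiffVectorBundle ω (Fin 5 → ℂ) E 𝓘(ℂ, ℂ)]

variable (E) in
lemma finrank_fiber (y : X) : Module.finrank ℂ (E y) = 5 := by
  rw [((trivializationAt (Fin 5 → ℂ) E y).continuousLinearEquivAt ℂ y
    (mem_baseSet_trivializationAt _ _ _)).toLinearEquiv.finrank_eq]
  simp

namespace ParabolicHiggsBundle

/-- Linearity of `Φ` in the tangent vector is not part of the structure; it is read off from the
local form `A dz`. -/
lemma Φ_apply_zero (P : ParabolicHiggsBundle D E) {y : X} (hy : y ∉ D) : P.Φ y 0 = 0 := by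
  obtain ⟨A, -, hA⟩ := P.Φ_hol y hy
  rw [hA.self_of_nhds 0, map_zero, zero_smul]

namespace CyclicStructure

variable {P : ParabolicHiggsBundle D E}

/-- The basis `b` of a fibre consists of generators of the five line subbundles. -/
structure IsAdapted (C : P.CyclicStructure) {y : X} (b : Module.Basis (Fin 5) ℂ (E y)) : Prop where
  antidiagonal : IsAntidiagonal (P.Q y) b
  Lm2 : C.Lm2 y = Submodule.span ℂ {b 0}
  Lm1 : C.Lm1 y = Submodule.span ℂ {b 1}
  L0 : C.L0 y = Submodule.span ℂ {b 2}
  L1 : C.L1 y = Submodule.span ℂ {b 3}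
  L2 : C.L2 y = Submodule.span ℂ {b 4}

/-- Generators of the five lines span the fibre, which has dimension five. The listed orthogonality
relations leave only the antidiagonal of the Gram matrix, and nondegeneracy makes its entries
nonzero. -/
lemma exists_basis (C : P.CyclicStructure) (y : X) :
    ∃ b : Module.Basis (Fin 5) ℂ (E y), C.IsAdapted b := by
  set L : Fin 5 → Submodule ℂ (E y) := ![C.Lm2 y, C.Lm1 y, C.L0 y, C.L1 y, C.L2 y]
  have hrank : ∀ i, Module.finrank ℂ (L i) = 1 := by
    intro i
    fin_cases i
    exacts [C.Lm2_hol.rank_eq y, C.Lm1_hol.rank_eq y, C.L0_hol.rank_eq y, C.L1_hol.rank_eq y,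
      C.L2_hol.rank_eq y]
  have hgen : ∀ i, ∃ v, L i = Submodule.span ℂ {v} := fun i => by
    obtain ⟨v, -, hv⟩ := finrank_eq_one_iff'.1 (hrank i)
    refine ⟨v, le_antisymm (fun w hw => ?_)
      ((Submodule.span_singleton_le_iff_mem _ _).2 v.2)⟩
    obtain ⟨c, hc⟩ := hv ⟨w, hw⟩
    exact Submodule.mem_span_singleton.2 ⟨c, congrArg Subtype.val hc⟩
  choose v hv using hgen
  have hmem : ∀ i, v i ∈ L i := fun i => hv i ▸ Submodule.mem_span_singleton_self _
  have hspan : (⊤ : Submodule ℂ (E y)) ≤ Submodule.span ℂ (Set.range v) := by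
    have hle : ∀ i, L i ≤ Submodule.span ℂ (Set.range v) := fun i => by
      rw [hv i]
      exact Submodule.span_mono (Set.singleton_subset_iff.2 ⟨i, rfl⟩)
    rw [← (P.isCompl y).sup_eq_top, C.U_eq, C.V_eq]
    exact sup_le (sup_le (hle 1) (hle 3)) (sup_le (sup_le (hle 0) (hle 2)) (hle 4))
  set b := basisOfTopLeSpanOfCardEqFinrank v hspan (by rw [finrank_fiber, Fintype.card_fin])
  have hbv : ⇑b = v := coe_basisOfTopLeSpanOfCardEqFinrank _ _ _
  have m0 : v 0 ∈ C.Lm2 y := hmem 0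
  have m1 : v 1 ∈ C.Lm1 y := hmem 1
  have m2 : v 2 ∈ C.L0 y := hmem 2
  have m3 : v 3 ∈ C.L1 y := hmem 3
  have m4 : v 4 ∈ C.L2 y := hmem 4
  have u1 : v 1 ∈ P.U y := C.U_eq y ▸ Submodule.mem_sup_left m1
  have u3 : v 3 ∈ P.U y := C.U_eq y ▸ Submodule.mem_sup_right m3
  have v0 : v 0 ∈ P.V y := C.V_eq y ▸ Submodule.mem_sup_left (Submodule.mem_sup_left m0)
  have v2 : v 2 ∈ P.V y := C.V_eq y ▸ Submodule.mem_sup_left (Submodule.mem_sup_right m2)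
  have v4 : v 4 ∈ P.V y := C.V_eq y ▸ Submodule.mem_sup_right m4
  have hle : ∀ i j : Fin 5, i ≤ j → j ≠ i.rev → P.Q y (v i) (v j) = 0 := by
    -- Pairs of opposite type are orthogonal by `Q_UV`; the remaining ones are the conditions within
    -- `U` and within `V`.
    intro i j hij hj
    fin_cases i <;> fin_cases j <;> first
      | exact absurd hij (by decide)
      | exact absurd rfl hj
      | exact P.Q_UV y _ (by assumption) _ (by assumption)
      | exact (P.Q_symm y _ _).trans (P.Q_UV y _ (by assumption) _ (by assumption))
      | exact C.Q_Lm2 y _ m0 _ m0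
      | exact C.Q_Lm1 y _ m1 _ m1
      | exact C.Q_L1 y _ m3 _ m3
      | exact C.Q_L2 y _ m4 _ m4
      | exact C.Q_L0_L2 y _ m2 _ m4
      | exact (P.Q_symm y _ _).trans (C.Q_L0_Lm2 y _ m2 _ m0)
  have hzero : ∀ i j : Fin 5, j ≠ i.rev → P.Q y (v i) (v j) = 0 := by
    intro i j hj
    rcases le_total i j with h | h
    · exact hle i j h hj
    · rw [P.Q_symm]
      exact hle j i h fun h' => hj (by rw [h', Fin.rev_rev])
  have hL : ∀ i, L i = Submodule.span ℂ {b i} := fun i => by rw [hbv, hv i]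
  refine ⟨b, ⟨by rwa [hbv], fun i hi => ?_⟩, hL 0, hL 1, hL 2, hL 3, hL 4⟩
  have h0 : P.Q y (b i) = 0 := b.ext fun j => by
    by_cases hj : j = i.rev
    · rw [hj, hi]; rfl
    · rw [hbv, hzero i j hj]; rfl
  have h1 : b i = 0 := (P.Q_nondeg y).1 _ fun w => by rw [h0]; rfl
  exact b.ne_zero i h1

/-- Evaluation of the Higgs field in an adapted basis, away from the marked points. -/
lemma exists_matrix (C : P.CyclicStructure) {y : X} (hy : y ∉ D)
    (ξ : TangentSpace 𝓘(ℂ, ℂ) y) {b : Module.Basis (Fin 5) ℂ (E y)}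
    (hb : C.IsAdapted b) : ∃ σ l μ α δ g : ℂ,
      P.Φ y ξ (b 0) = σ • b 1 ∧ P.Φ y ξ (b 1) = l • b 2 ∧ P.Φ y ξ (b 2) = μ • b 3 ∧
      P.Φ y ξ (b 3) = α • b 0 + δ • b 4 ∧ P.Φ y ξ (b 4) = g • b 1 := by
  have hmem : ∀ {S : Submodule ℂ (E y)} {v : E y}, S = Submodule.span ℂ {v} → v ∈ S := by
    rintro _ v rfl
    exact Submodule.mem_span_singleton_self v
  have hget : ∀ {S : Submodule ℂ (E y)} {v w : E y}, S = Submodule.span ℂ {v} → w ∈ S →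
      ∃ c : ℂ, w = c • v := by
    rintro _ v w rfl hw
    obtain ⟨c, hc⟩ := Submodule.mem_span_singleton.1 hw
    exact ⟨c, hc.symm⟩
  obtain ⟨σ, hσ⟩ := hget hb.Lm1 (C.Φ_Lm2 y hy ξ _ (hmem hb.Lm2))
  obtain ⟨l, hl⟩ := hget hb.L0 (C.Φ_Lm1 y hy ξ _ (hmem hb.Lm1))
  obtain ⟨μ, hμ⟩ := hget hb.L1 (C.Φ_L0 y hy ξ _ (hmem hb.L0))
  obtain ⟨v, hv, w, hw, hvw⟩ := Submodule.mem_sup.1 (C.Φ_L1 y hy ξ _ (hmem hb.L1))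
  obtain ⟨α, rfl⟩ := hget hb.Lm2 hv
  obtain ⟨δ, rfl⟩ := hget hb.L2 hw
  obtain ⟨g, hg⟩ := hget hb.Lm1 (C.Φ_L2 y hy ξ _ (hmem hb.L2))
  exact ⟨σ, l, μ, α, δ, g, hσ, hl, hμ, hvw.symm, hg⟩

lemma nonzeroAt_L1 (C : P.CyclicStructure) {y : X} (hy : y ∉ D) : P.NonzeroAt C.L1 y := by
  obtain ⟨b, hb⟩ := C.exists_basis y
  obtain ⟨ξ, hξ, -⟩ := exists_coordDiff_eq_one (mem_chart_source ℂ y)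
  have hξ0 : ξ ≠ 0 := by
    rintro rfl
    simp at hξ
  have h3 : b 3 ∈ C.L1 y := hb.L1 ▸ Submodule.mem_span_singleton_self _
  exact ⟨ξ, b 3, h3, fun h => b.ne_zero 3 (C.τ_iso y hy ξ hξ0 _ h3 (h ▸ Submodule.zero_mem _))⟩

/-- If `γ` vanishes, so does its dual. -/
lemma Φ_L1_of_gammaEqZero (C : P.CyclicStructure) (hγ : C.GammaEqZero) :
    ∀ y ∉ D, ∀ ξ, ∀ e ∈ C.L1 y, P.Φ y ξ e ∈ C.L2 y := by
  intro y hy ξ e he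
  obtain ⟨b, hb⟩ := C.exists_basis y
  obtain ⟨hz, hn⟩ := hb.antidiagonal
  obtain ⟨σ, l, μ, α, δ, g, -, -, -, h3, -⟩ := C.exists_matrix hy ξ hb
  have hskew := P.Φ_skew y hy ξ (b 3) (b 4)
  rw [hγ y hy ξ (b 4) (hb.L2 ▸ Submodule.mem_span_singleton_self _), h3] at hskew
  have hα : α = 0 := by
    have q0 : P.Q y (b 0) (b 4) ≠ 0 := hn 0
    simpa [hz, q0] using hskew
  rw [hb.L1, Submodule.mem_span_singleton] at he
  obtain ⟨c, rfl⟩ := he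
  rw [map_smul, h3, hα, zero_smul, zero_add, hb.L2]
  exact Submodule.smul_mem _ _ (Submodule.smul_mem _ _ (Submodule.mem_span_singleton_self _))

/-- Test pairs at a point where `β` does not vanish. -/
lemma testPair_at (C : P.CyclicStructure) {U' V' : ∀ x, Submodule ℂ (E x)}
    (h : P.IsTestPair U' V') {y : X} (hy : y ∉ D) (hβ : P.NonzeroAt C.L0 y) :
    U' y ≤ C.L1 y ∧ V' y ≤ C.L2 y ∧ (U' y ≠ ⊥ → V' y ≠ ⊥) ∧
      (∀ ξ, ∀ v ∈ V' y, P.Φ y ξ v ∈ U' y) := by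
  obtain ⟨b, hb⟩ := C.exists_basis y
  obtain ⟨ξ, e, he, hne⟩ := hβ
  have hξ : ξ ≠ 0 := by
    rintro rfl
    rw [P.Φ_apply_zero hy] at hne
    exact hne rfl
  obtain ⟨σ, l, μ, α, δ, g, h0, h1, h2, h3, h4⟩ := C.exists_matrix hy ξ hb
  have hμ : μ ≠ 0 := by
    rintro rfl
    rw [hb.L0, Submodule.mem_span_singleton] at he
    obtain ⟨c, rfl⟩ := he
    exact hne (by rw [map_smul, h2, zero_smul, smul_zero])
  have hδ : δ ≠ 0 := by
    rintro rfl
    refine b.ne_zero 3 (C.τ_iso y hy ξ hξ _ (hb.L1 ▸ Submodule.mem_span_singleton_self _) ?_)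
    rw [h3, zero_smul, add_zero, hb.Lm2]
    exact Submodule.smul_mem _ _ (Submodule.mem_span_singleton_self _)
  have hdisj : ∀ w ∈ P.U y, w ∈ P.V y → w = 0 := fun w hu hv =>
    (Submodule.disjoint_def.1 (P.isCompl y).disjoint) w hu hv
  -- The Higgs field exchanges `U` and `V`, so the `U'`-component of the image of `u` lies in `U ∩ V
  -- = 0`.
  have hMU : ∀ η, ∀ u ∈ U' y, P.Φ y η u ∈ V' y := fun η u hu => by
    obtain ⟨a, ha, c, hc, hac⟩ := Submodule.mem_sup.1
      (h.invariant y hy η u (Submodule.mem_sup_left hu))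
    have hV := P.Φ_UV y hy η u (h.U_le y hu)
    have ha0 := hdisj a (h.U_le y ha) (by
      rw [eq_sub_of_add_eq hac]
      exact Submodule.sub_mem _ hV (h.V_le y hc))
    rwa [← hac, ha0, zero_add]
  have hMV : ∀ η, ∀ v ∈ V' y, P.Φ y η v ∈ U' y := fun η v hv => by
    obtain ⟨a, ha, c, hc, hac⟩ := Submodule.mem_sup.1
      (h.invariant y hy η v (Submodule.mem_sup_right hv))
    have hU := P.Φ_VU y hy η v (h.V_le y hv)
    have hc0 := hdisj c (by
      rw [eq_sub_of_add_eq' hac]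
      exact Submodule.sub_mem _ hU (h.U_le y ha)) (h.V_le y hc)
    rwa [← hac, hc0, add_zero]
  obtain ⟨r1, r2, r3⟩ := hb.antidiagonal.isotropic_invariant (P.Q_symm y) (P.Φ_skew y hy ξ) h0 h1 h2 h3 h4 hμ hδ
    (U := U' y) (V := V' y)
    (fun u hu => by
      have := h.U_le y hu
      rw [C.U_eq, hb.Lm1, hb.L1] at this
      obtain ⟨v, hv, w, hw, rfl⟩ := Submodule.mem_sup.1 this
      obtain ⟨c, rfl⟩ := Submodule.mem_span_singleton.1 hv
      obtain ⟨d, rfl⟩ := Submodule.mem_span_singleton.1 hw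
      exact ⟨c, d, rfl⟩)
    (fun v hv => by
      have := h.V_le y hv
      rw [C.V_eq, hb.Lm2, hb.L0, hb.L2] at this
      obtain ⟨u, hu, w, hw, rfl⟩ := Submodule.mem_sup.1 this
      obtain ⟨c, hc, d, hd, rfl⟩ := Submodule.mem_sup.1 hu
      obtain ⟨x, rfl⟩ := Submodule.mem_span_singleton.1 hc
      obtain ⟨x', rfl⟩ := Submodule.mem_span_singleton.1 hd
      obtain ⟨z, rfl⟩ := Submodule.mem_span_singleton.1 hw
      exact ⟨x, x', z, rfl⟩)
    (fun u hu => h.isotropic y u (Submodule.mem_sup_left hu) u (Submodule.mem_sup_left hu))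
    (fun v hv => h.isotropic y v (Submodule.mem_sup_right hv) v (Submodule.mem_sup_right hv))
    (hMU ξ) (hMV ξ)
  refine ⟨fun u hu => ?_, fun v hv => ?_, r3, hMV⟩
  · obtain ⟨c, rfl⟩ := r1 u hu
    exact hb.L1 ▸ Submodule.smul_mem _ _ (Submodule.mem_span_singleton_self _)
  · obtain ⟨c, rfl⟩ := r2 v hv
    exact hb.L2 ▸ Submodule.smul_mem _ _ (Submodule.mem_span_singleton_self _)

lemma disjoint_L1_L2 (C : P.CyclicStructure) (y : X) : Disjoint (C.L1 y) (C.L2 y) := by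
  refine (P.isCompl y).disjoint.mono ?_ ?_
  · rw [C.U_eq]; exact le_sup_right
  · rw [C.V_eq]; exact le_sup_right

lemma disjoint_Lm1_L1 (C : P.CyclicStructure) (y : X) : Disjoint (C.Lm1 y) (C.L1 y) := by
  obtain ⟨b, hb⟩ := C.exists_basis y
  obtain ⟨hz, hn⟩ := hb.antidiagonal
  rw [Submodule.disjoint_def]
  intro v hv hw
  obtain ⟨c, rfl⟩ := Submodule.mem_span_singleton.1 (show v ∈ Submodule.span ℂ {b 1} from hb.Lm1 ▸ hv)
  have := C.Q_L1 y _ hw (b 3) (hb.L1 ▸ Submodule.mem_span_singleton_self _)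
  have q1 : P.Q y (b 1) (b 3) ≠ 0 := hn 1
  have hc : c = 0 := by simpa [q1] using this
  rw [hc, zero_smul]

lemma eq_zero_of_Q_L0 (C : P.CyclicStructure) (y : X) :
    ∀ v ∈ C.L0 y, P.Q y v v = 0 → v = 0 := by
  obtain ⟨b, hb⟩ := C.exists_basis y
  obtain ⟨hz, hn⟩ := hb.antidiagonal
  intro v hv h
  obtain ⟨c, rfl⟩ := Submodule.mem_span_singleton.1 (show v ∈ Submodule.span ℂ {b 2} from hb.L0 ▸ hv)
  have q2 : P.Q y (b 2) (b 2) ≠ 0 := hn 2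
  have hc : c = 0 := by simpa [q2] using h
  rw [hc, zero_smul]

variable [T2Space X]

lemma eventually_nonzeroAt_L0 [ConnectedSpace X] (C : P.CyclicStructure) (p : X) :
    ∀ᶠ y in 𝓝[≠] p, y ∉ D ∧ P.NonzeroAt C.L0 y :=
  (eventually_notMem_finset D p).and
    (P.eventually_nonzeroAt C.L0_hol C.L1_hol C.Φ_L0 C.β_ne_zero p)

/-- The classification of the test pairs. -/
theorem testPair_cases [ConnectedSpace X] (C : P.CyclicStructure)
    {U' V' : ∀ x, Submodule ℂ (E x)} (h : P.IsTestPair U' V') :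
    (U' = (fun _ => ⊥) ∧ V' = fun _ => ⊥) ∨
      (C.GammaEqZero ∧ (U' = (fun _ => ⊥) ∨ U' = C.L1) ∧ V' = C.L2) := by
  have hgood := C.eventually_nonzeroAt_L0
  -- A subbundle contained in a line subbundle off isolated points has rank at most one. In rank one
  -- the two agree off these points, and then everywhere by continuity.
  have key : ∀ (S L : ∀ x, Submodule ℂ (E x)), (∃ k, IsHolSubbundle (Fin 5 → ℂ) S k) →
      IsHolSubbundle (Fin 5 → ℂ) L 1 → (∀ y ∉ D, P.NonzeroAt C.L0 y → S y ≤ L y) →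
      S = (fun _ => ⊥) ∨ (S = L ∧ ∀ y, S y ≠ ⊥) := by
    rintro S L ⟨k, hk⟩ hL hle
    have hfd : ∀ y, FiniteDimensional ℂ (E y) := fun y =>
      FiniteDimensional.of_finrank_pos (by rw [finrank_fiber]; norm_num)
    have hrank : ∀ y, Module.finrank ℂ (S y) = k := hk.rank_eq
    have hk1 : k ≤ 1 := by
      obtain ⟨p⟩ := (inferInstance : Nonempty X)
      obtain ⟨y, hy, hβ⟩ := (hgood p).exists
      rw [← hrank y, ← hL.rank_eq y]
      exact Submodule.finrank_mono (hle y hy hβ)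
    interval_cases k
    · exact Or.inl (funext fun y => Submodule.finrank_eq_zero.1 (hrank y))
    · refine Or.inr ⟨funext fun p => hk.eq_of_eventually hL ?_, fun y h0 => ?_⟩
      · filter_upwards [hgood p] with y hy
        exact Submodule.eq_of_le_of_finrank_eq (hle y hy.1 hy.2) (by rw [hrank, hL.rank_eq])
      · have := hrank y
        rw [h0] at this
        simp at this
  rcases key V' C.L2 h.V_hol C.L2_hol fun y hy hβ => (C.testPair_at h hy hβ).2.1 with hV | ⟨hV, -⟩
  · rcases key U' C.L1 h.U_hol C.L1_hol fun y hy hβ => (C.testPair_at h hy hβ).1 with hU | ⟨-, hU⟩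
    · exact Or.inl ⟨hU, hV⟩
    · exfalso
      obtain ⟨p⟩ := (inferInstance : Nonempty X)
      obtain ⟨y, hy, hβ⟩ := (hgood p).exists
      -- The pair `(L₁, 0)` is not invariant, because τ maps `L₁` to `L₂` without zeros.
      exact (C.testPair_at h hy hβ).2.2.1 (hU y) (by rw [hV])
  · right
    refine ⟨?_, ?_, hV⟩
    -- Choose a point where both β and γ are nonzero. Invariance sends `Φ(L₂)` into `U' ⊆ L₁`, while
    -- cyclicity puts it in `L₋₁`; these lines meet in 0.
    · by_contra hγ
      have hne : ∃ x ∉ D, P.NonzeroAt C.L2 x := by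
        by_contra hcon
        push Not at hcon
        refine hγ fun x hx ξ e he => ?_
        by_contra h0
        exact hcon x hx ⟨ξ, e, he, h0⟩
      obtain ⟨p⟩ := (inferInstance : Nonempty X)
      obtain ⟨y, ⟨hy, hβ⟩, ξ, e, he, h0⟩ := ((hgood p).and
        (P.eventually_nonzeroAt C.L2_hol C.Lm1_hol C.Φ_L2 hne p)).exists
      obtain ⟨k1, -, -, k4⟩ := C.testPair_at h hy hβ
      exact h0 (Submodule.disjoint_def.1 (C.disjoint_Lm1_L1 y) _ (C.Φ_L2 y hy ξ e he)
        (k1 (k4 ξ e (hV ▸ he))))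
    · exact (key U' C.L1 h.U_hol C.L1_hol fun y hy hβ => (C.testPair_at h hy hβ).1).imp_right And.left

/-- The parabolic contributions of the line subbundles at a marked point. -/
lemma AssumptionA.exists_contribution {C : P.CyclicStructure} (hA : C.AssumptionA) (x : D) :
    ∃ c : ℝ, c < 1 / 2 ∧ (P.flag x).contribution (C.L1 x) = c ∧
      (P.flag x).contribution (C.L2 x) = c ∧ (P.flag x).contribution (C.L1 x ⊔ C.L2 x) = 2 * c ∧
      (0 < c → ∀ e ∈ C.L0 x, P.res x e ∈ C.Lm2 x ⊔ C.Lm1 x ⊔ C.L0 x) := by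
  obtain ⟨ζ, h0, h1, hz, hnz⟩ := hA.flag_eq x
  by_cases hζ : ζ = 0
  · refine ⟨0, by norm_num, ?_⟩
    rw [hz hζ]
    simp [WeightedFlag.contribution_trivial]
  obtain ⟨b, hb⟩ := C.exists_basis (x : X)
  have s3 : C.L1 (x : X) = Submodule.span ℂ (b '' ↑({3} : Finset (Fin 5))) := by simp [hb.L1]
  have s4 : C.L2 (x : X) = Submodule.span ℂ (b '' ↑({4} : Finset (Fin 5))) := by simp [hb.L2]
  have s34 : C.L1 (x : X) ⊔ C.L2 (x : X) =
      Submodule.span ℂ (b '' ↑({3, 4} : Finset (Fin 5))) := by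
    simp [hb.L1, hb.L2, Set.image_insert_eq, Submodule.span_insert]
  have s01 : C.Lm2 (x : X) ⊔ C.Lm1 (x : X) =
      Submodule.span ℂ (b '' ↑({0, 1} : Finset (Fin 5))) := by
    simp [hb.Lm2, hb.Lm1, Set.image_insert_eq, Submodule.span_insert]
  have s234 : C.L0 (x : X) ⊔ C.L1 (x : X) ⊔ C.L2 (x : X) =
      Submodule.span ℂ (b '' ↑({2, 3, 4} : Finset (Fin 5))) := by
    simp [hb.L0, hb.L1, hb.L2, Set.image_insert_eq, Submodule.span_insert, sup_assoc]
  have s012 : C.Lm2 (x : X) ⊔ C.Lm1 (x : X) ⊔ C.L0 (x : X) =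
      Submodule.span ℂ (b '' ↑({0, 1, 2} : Finset (Fin 5))) := by
    simp [hb.Lm2, hb.Lm1, hb.L0, Set.image_insert_eq, Submodule.span_insert, sup_assoc]
  rcases hnz hζ with hf | hf
  -- Here `L₁` and `L₂` lie in the last nonzero step, of weight `-ζ`.
  · refine ⟨-ζ, by linarith, ?_, ?_, ?_, fun h => absurd h (by linarith)⟩
    · rw [hf, s34, s234, s3, WeightedFlag.contribution_span_image]
      simp
    · rw [hf, s34, s234, s4, WeightedFlag.contribution_span_image]
      simp
    · rw [hf, s34, s234, WeightedFlag.contribution_span_image]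
      simp
      ring
  -- Here `L₁` and `L₂` meet every proper step in 0, so they carry the weight `ζ`, and the middle
  -- step contains `L₀` but not `L₁`.
  · refine ⟨ζ, h1, ?_, ?_, ?_, fun _ e he => ?_⟩
    · rw [hf, s012, s01, s3, WeightedFlag.contribution_span_image]
      simp
    · rw [hf, s012, s01, s4, WeightedFlag.contribution_span_image]
      simp
    · rw [hf, s012, s01, s34, WeightedFlag.contribution_span_image]
      simp
      ring
    -- Stated for a variable flag so that the equation for `P.flag x` can be substituted despite the
    -- dependent index type.
    · have key : ∀ f : WeightedFlag (E x), P.flag x = f → ∀ i, ∀ v ∈ f.fil i,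
          P.res x v ∈ f.fil i := by
        rintro _ rfl
        exact P.res_flag x
      exact key _ hf 1 e (Submodule.mem_sup_right he)

end CyclicStructure

/-- The residue of a component of the Higgs field. -/
lemma res_mem [T2Space X] (P : ParabolicHiggsBundle D E) {S T : ∀ x, Submodule ℂ (E x)}
    (hS : IsHolSubbundle (Fin 5 → ℂ) S 1) (hT : IsHolSubbundle (Fin 5 → ℂ) T 1)
    (hΦ : ∀ x ∉ D, ∀ ξ, ∀ e ∈ S x, P.Φ x ξ e ∈ T x) (p : D) :
    ∀ e ∈ S p, P.res p e ∈ T p := by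
  obtain ⟨s, hs⟩ := hS.exists_line_frames
  obtain ⟨t, ht⟩ := hT.exists_line_frames
  obtain ⟨b, -, -, hres⟩ := P.exists_local_coefficient hΦ (hs p) (ht p)
  intro e he
  rw [← (isLocalFrame_line_iff.1 (hs p)).2.self_of_nhds.2, Submodule.mem_span_singleton] at he
  obtain ⟨c, rfl⟩ := he
  rw [map_smul, hres p.2]
  exact Submodule.smul_mem _ _ (Submodule.smul_mem _ _
    ((isLocalFrame_line_iff.1 (ht p)).2.self_of_nhds.2 ▸ Submodule.mem_span_singleton_self _))

/-! ### Parabolic degrees of `L₁` and `L₂` -/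

namespace CyclicStructure

variable {P : ParabolicHiggsBundle D E} [T2Space X] [CompactSpace X] [ConnectedSpace X]

/-- As `β` is nonzero, `L₁ ⊗ K(D)` has nonnegative parabolic degree. -/
lemma pardeg_L1_add_nonneg {C : P.CyclicStructure} (hA : C.AssumptionA) :
    0 ≤ P.pardeg C.L1 + logCanonicalDegree D := by
  choose c hc hc1 hc2 hc3 hcr using hA.exists_contribution
  obtain ⟨n, Z, hDZ, hsum, -, hnD⟩ :=
    P.exists_vanishing_orders C.L0_hol C.L1_hol C.Φ_L0 C.β_ne_zero
  rw [bundleDegree_eq_zero_of_form C.L0_hol P.Q P.Q_hol C.eq_zero_of_Q_L0] at hsum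
  -- For `c x > 0` the residue of β maps `L₀` into `L₁ ∩ (L₋₂ ⊕ L₋₁ ⊕ L₀) = 0`. Then β, as a
  -- morphism to `L₁ ⊗ K(D)`, has a zero at `x`, and `n x ≥ 1 > c x`.
  have hle : ∀ x : D, c x ≤ n x := by
    intro x
    by_cases h0 : 0 < c x
    · have hn : n x ≠ 0 := by
        rw [Ne, hnD x]
        rintro ⟨e, he, hne⟩
        refine hne ?_
        have k1 := P.res_mem C.L0_hol C.L1_hol C.Φ_L0 x e he
        obtain ⟨b, hb⟩ := C.exists_basis (x : X)
        have k2 := hcr x h0 e he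
        rw [hb.L1, Submodule.mem_span_singleton] at k1
        obtain ⟨d, hd⟩ := k1
        rw [hb.Lm2, hb.Lm1, hb.L0, ← hd] at k2
        obtain ⟨v, hv, w, hw, hvw⟩ := Submodule.mem_sup.1 k2
        obtain ⟨v', hv', v'', hv'', rfl⟩ := Submodule.mem_sup.1 hv
        obtain ⟨a0, rfl⟩ := Submodule.mem_span_singleton.1 hv'
        obtain ⟨a1, rfl⟩ := Submodule.mem_span_singleton.1 hv''
        obtain ⟨a2, rfl⟩ := Submodule.mem_span_singleton.1 hw
        have := DFunLike.congr_fun (congrArg b.repr hvw) 3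
        simp at this
        rw [← hd, ← this, zero_smul]
      have : (1 : ℝ) ≤ n x := by exact_mod_cast Nat.one_le_iff_ne_zero.2 hn
      linarith [hc x]
    · exact (not_lt.1 h0).trans (Nat.cast_nonneg _)
  have h1 : ∑ x : D, c x ≤ ∑ p ∈ Z, (n p : ℝ) :=
    (Finset.sum_le_sum fun x _ => hle x).trans ((Finset.sum_coe_sort D fun p => (n p : ℝ)).le.trans
      (Finset.sum_le_sum_of_subset_of_nonneg hDZ fun _ _ _ => Nat.cast_nonneg _))
  rw [pardeg]
  simp only [hc1]
  linarith

/-- As `τ` is an isomorphism, the parabolic degrees of `L₁` and `L₂ ⊗ K(D)` agree. -/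
lemma pardeg_L2 {C : P.CyclicStructure} (hA : C.AssumptionA) (hγ : C.GammaEqZero) :
    P.pardeg C.L2 = P.pardeg C.L1 - logCanonicalDegree D := by
  choose c hc hc1 hc2 hc3 hcr using hA.exists_contribution
  have hΦ := C.Φ_L1_of_gammaEqZero hγ
  obtain ⟨x, hx, -⟩ := C.β_ne_zero
  obtain ⟨n, Z, hDZ, hsum, hn, hnD⟩ :=
    P.exists_vanishing_orders C.L1_hol C.L2_hol hΦ ⟨x, hx, C.nonzeroAt_L1 hx⟩
  -- Off `D` this is the isomorphism condition in the cyclic structure; at `D` it is the additional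
  -- condition in assumption A.
  have hn0 : ∀ p, n p = 0 := by
    intro p
    by_cases hp : p ∈ D
    · refine (hnD ⟨p, hp⟩).2 ?_
      obtain ⟨b, hb⟩ := C.exists_basis p
      have h3 : b 3 ∈ C.L1 p := hb.L1 ▸ Submodule.mem_span_singleton_self _
      exact ⟨b 3, h3, fun h => b.ne_zero 3 (hA.τ_iso ⟨p, hp⟩ _ h3 (h ▸ Submodule.zero_mem _))⟩
    · exact hn p hp (C.nonzeroAt_L1 hp)
  simp only [hn0, Nat.cast_zero, Finset.sum_const_zero] at hsum
  simp only [pardeg, hc1, hc2]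
  linarith

lemma pardeg_L1_sup_L2 {C : P.CyclicStructure} (hA : C.AssumptionA) :
    P.pardeg (fun x => C.L1 x ⊔ C.L2 x) = P.pardeg C.L1 + P.pardeg C.L2 := by
  choose c hc hc1 hc2 hc3 hcr using hA.exists_contribution
  simp only [pardeg, hc1, hc2, hc3, ← Finset.mul_sum]
  rw [bundleDegree_sup C.L1_hol C.L2_hol C.disjoint_L1_L2]
  ring

/-- This pair makes the inequalities necessary. Its invariance needs both γ and its dual to vanish.
-/
lemma isTestPair_L1_L2 (C : P.CyclicStructure) (hγ : C.GammaEqZero) :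
    P.IsTestPair C.L1 C.L2 where
  U_hol := ⟨1, C.L1_hol⟩
  V_hol := ⟨1, C.L2_hol⟩
  U_le x := by rw [C.U_eq]; exact le_sup_right
  V_le x := by rw [C.V_eq]; exact le_sup_right
  isotropic x a ha b hb := by
    obtain ⟨a1, h1, a2, h2, rfl⟩ := Submodule.mem_sup.1 ha
    obtain ⟨b1, h3, b2, h4, rfl⟩ := Submodule.mem_sup.1 hb
    have hU : C.L1 x ≤ P.U x := by rw [C.U_eq]; exact le_sup_right
    have hV : C.L2 x ≤ P.V x := by rw [C.V_eq]; exact le_sup_right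
    simp only [map_add, LinearMap.add_apply]
    rw [C.Q_L1 x _ h1 _ h3, C.Q_L2 x _ h2 _ h4, P.Q_UV x _ (hU h1) _ (hV h4),
      P.Q_symm x a2, P.Q_UV x _ (hU h3) _ (hV h2)]
    simp
  invariant x hx ξ a ha := by
    obtain ⟨a1, h1, a2, h2, rfl⟩ := Submodule.mem_sup.1 ha
    rw [map_add, hγ x hx ξ a2 h2, add_zero]
    exact Submodule.mem_sup_right (C.Φ_L1_of_gammaEqZero hγ x hx ξ a1 h1)

end CyclicStructure

lemma pardeg_bot [T2Space X] [CompactSpace X] (P : ParabolicHiggsBundle D E) :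
    P.pardeg (fun _ => ⊥) = 0 := by
  simp only [pardeg, WeightedFlag.contribution_bot, Finset.sum_const_zero, sub_zero]
  exact bundleDegree_bot

end ParabolicHiggsBundle

end Cyclic

end

/-! ### The stability criterion -/

theorem mainTheorem4 {X : Type*} [TopologicalSpace X] [T2Space X] [CompactSpace X]
    [ConnectedSpace X] [ChartedSpace ℂ X] [IsManifold 𝓘(ℂ, ℂ) ω X]
    (D : Finset X) (E : X → Type*)
    [∀ x, AddCommGroup (E x)] [∀ x, Module ℂ (E x)]
    [TopologicalSpace (TotalSpace (Fin 5 → ℂ) E)] [∀ x, TopologicalSpace (E x)]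
    [FiberBundle (Fin 5 → ℂ) E] [VectorBundle ℂ (Fin 5 → ℂ) E]
    [ContMDiffVectorBundle ω (Fin 5 → ℂ) E 𝓘(ℂ, ℂ)]
    (P : ParabolicHiggsBundle D E) (C : P.CyclicStructure) (hA : C.AssumptionA) :
    (P.IsSemistable ↔
      ¬ C.GammaEqZero ∨ (C.GammaEqZero ∧ P.pardeg C.L1 ≤ logCanonicalDegree D / 2)) ∧
    (P.IsStable ↔
      ¬ C.GammaEqZero ∨ (C.GammaEqZero ∧ P.pardeg C.L1 < logCanonicalDegree D / 2)) := by
  have hne : ∀ x, C.L2 x ≠ ⊥ := fun x h => by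
    have := C.L2_hol.rank_eq x
    rw [h] at this
    simp at this
  have hpair : C.GammaEqZero → P.pardeg (fun x => C.L1 x ⊔ C.L2 x) =
      2 * P.pardeg C.L1 - logCanonicalDegree D := fun hγ => by
    rw [C.pardeg_L1_sup_L2 hA, C.pardeg_L2 hA hγ]
    ring
  have hnonneg := C.pardeg_L1_add_nonneg hA
  have hss : ¬ C.GammaEqZero ∨ (C.GammaEqZero ∧ P.pardeg C.L1 ≤ logCanonicalDegree D / 2) →
      P.IsSemistable := by
    intro h U' V' hT
    rcases C.testPair_cases hT with ⟨rfl, rfl⟩ | ⟨hγ, rfl | rfl, rfl⟩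
    · simp only [bot_sup_eq, P.pardeg_bot, le_refl]
    all_goals have hle := (h.resolve_left (not_not.2 hγ)).2
    · simp only [bot_sup_eq]
      -- For `(0, L₂)`: with `p = pardeg L₁` and `k = deg K(D)`, the bounds `-k ≤ p ≤ k / 2` give `k
      -- ≥ 0`, so `p - k ≤ -k / 2 ≤ 0`.
      rw [C.pardeg_L2 hA hγ]
      linarith
    · rw [hpair hγ]
      linarith
  refine ⟨⟨fun h => ?_, hss⟩, ⟨fun h => ?_, fun h => ⟨hss (h.imp_right (And.imp_right le_of_lt)),
    fun U' V' hT hV => ?_⟩⟩⟩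
  · refine (Classical.em C.GammaEqZero).symm.imp_right fun hγ => ⟨hγ, ?_⟩
    have := h _ _ (C.isTestPair_L1_L2 hγ)
    rw [hpair hγ] at this
    linarith
  · refine (Classical.em C.GammaEqZero).symm.imp_right fun hγ => ⟨hγ, ?_⟩
    obtain ⟨x⟩ := (inferInstance : Nonempty X)
    have := h.2 _ _ (C.isTestPair_L1_L2 hγ) ⟨x, hne x⟩
    rw [hpair hγ] at this
    linarith
  · rcases C.testPair_cases hT with ⟨rfl, rfl⟩ | ⟨hγ, rfl | rfl, rfl⟩
    -- The zero pair has parabolic degree 0 and is excluded only by the condition `V' ≠ 0`.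
    · obtain ⟨x, hx⟩ := hV
      exact absurd rfl hx
    all_goals have hlt := (h.resolve_left (not_not.2 hγ)).2
    · simp only [bot_sup_eq]
      rw [C.pardeg_L2 hA hγ]
      linarith
    · rw [hpair hγ]
      linarith
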